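/- **Setting.** All graphs are simple, undirected, with at most countably many nodes and bounded degrees. Let $\mathcal{O}$ be a set of output values and $\bot\notin\mathcal{O}$. A node-LCL $\mathcal{P}=\langle\mathcal{O},\mathcal{G},\mathcal{L}\rangle$ consists of a family $\mathcal{G}$ of graphs and predicates $\ell_d(o,M)$ for $o\in\mathcal{O}$ and multisets $M$ over $\mathcal{O}$ of size $d$. For a configuration $C:V(G)\to\mathcal{O}\cup\{\bot\}$ let $C[v]$ be the multiset of the outputs of the decided (i.e. $\neq\bot$) neighbors of $v$; a decided node $v$ is *content* if $\ell_{|C[v]|}(C(v),C[v])$ is true. $C$ is *strong* if all decided nodes are content, and *legal* if all nodes are decided and content. $\Gamma(C)$, $D(C)$, $U(C)$ denote the sets of content, decided, undecided nodes. For an edge configuration the same notions are taken in the line graph $L(G)$ (vertex set $E(G)$, adjacency = sharing an endpoint); an edge-LCL asks for a legal edge configuration. **Algorithms** are randomized, synchronous and anonymous, in the port numbering model; nodes know only the degree bound (which is hard-coded). A *phase-based* node algorithm $\mathcal{A}$ repeats a phase of $\phi\ge 2$ steps, all registers but the output registers being reset at the start of each phase. In step $0$ every node announces its output register; decided nodes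 only repeat their output. In steps $1,\dots,\phi-2$ the undecided nodes exchange messages with undecided neighbors only, using only their number and the received messages. In step $\phi-1$ an undecided node may write an output value, which may also depend on the multiset of the outputs of its decided neighbors. $\mathtt{Phase}(G,C)$ is the random configuration after one phase started from $C$. $\mathcal{A}$, run on the graphs of $\mathcal{G}$ of degree bound $D$, is $(\nu,\mu(\cdot),\phi,\beta,\sigma_0)$-*eligible* if the following hold, where in each item $G$ ranges over these graphs. 1. Subgraphs of such $G$ belong to $\mathcal{G}$. 2. For each $o$, the set $\mathcal{T}(o)=\{M:\ell_{|M|}(o,M)\}$ is non-empty, and $M\subseteq M'\subseteq M''$ with $M,M''\in\mathcal{T}(o)$ implies $M'\in\mathcal{T}(o)$. 3. The digraph on $\mathcal{O}$ with an arc from $o$ to $o'$ whenever $o'$ lies in some inclusion-minimal element of $\mathcal{T}(o)$ is acyclic and has no directed path of length more than $\nu$. 4. There is a distributed detection procedure with messages of at most $\mu(D)$ bits, with read-only access to the output registers, that in each round returns *false* exactly at the decided uncontent nodes of the current configuration, provided that neither the node nor its neighbors were manipulated in the previous round. 5. With probability $1$, for all such $G$, all $C$ and all $X\subseteq U(C)$: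 $\Gamma(C)\subseteq\Gamma(C')$ and $U(C)\cap D(C')\subseteq\Gamma(C')$, where $C'=\mathtt{Phase}(G-X,C_{G-X})$. 6. $0<\beta<1$, and there are symmetric coefficients $\sigma(M,M')\in\mathbb{Z}_{\ge0}$, non-increasing in each argument, with $\sigma(\emptyset,\emptyset)=\sigma_0$, such that with $\pi(G,C)=\sum_{\{u,v\}\in E(G),\,u,v\in U(C)}\sigma(C[u],C[v])$, for every such $G$ and every strong $C$: $\mathbb{E}\,\pi(G,\mathtt{Phase}(G,C))\le(1-\beta)\,\pi(G,C)$, and $\pi(G,C)=0$ implies that $\mathtt{Phase}(G,C)$ has no undecided node with probability $1$. **Algorithms for edge problems and the adversary.** Each node $v$ has an output register $\mathtt{out}_v(u)\in\mathcal{O}\cup\{\bot\}$ for each neighbor $u$; the edge $\{u,v\}$ has output $o\in\mathcal{O}$ if $\mathtt{out}_v(u)=\mathtt{out}_u(v)=o$, and is undecided otherwise. At the end of a round an adversary may modify any registers (including received messages), the graph (within the family) and the ports; a node is *manipulated* if its registers or its assignment of ports to neighbors are modified, or if it is newly added. An algorithm is *self-stabilizing* if on each finite graph of the family, from every initial global state,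 it reaches with probability $1$ in finite time a legal configuration that it keeps forever. Suppose that at times $t_a^*-1$ and $t_a^*$ the configurations are equal and legal, that no node is manipulated in round $t_a^*-1$, that exactly $k\ge1$ (finitely many) nodes are manipulated during rounds $t_a^*,\dots,t_b^*-1$, where $t_b^*>t_a^*$, and that there are no manipulations from round $t_b^*$ on. The *fully adaptive run time* is at most $T(k)$ if, conditioned on any possible history up to time $t_b^*$, the expected number of rounds after $t_b^*$ until the first time from which on the configuration is legal and constant is at most $T(k)$. **Theorem.** There is an absolute constant $c$ such that the following holds. Let $\mathcal{P}=\langle\mathcal{O},\mathcal{G},\mathcal{L}\rangle$ be a node-LCL, let $\mathcal{H}$ be the family of all graphs $G$ with $L(G)\in\mathcal{G}$, and suppose that all degrees of the graphs in $\mathcal{H}$ are at most $\Delta\ge1$. Let $\mathcal{A}$ be a phase-based algorithm that, run on the graphs of $\mathcal{G}$ of degree bound $2\Delta-2$, is $(\nu,\mu(\cdot),\phi,\beta,\sigma_0)$-eligible, where $\mu\ge1$, and uses messages (announcements included) of at most $\mu_{\mathcal{A}}(2\Delta-2)$ bits. Then the edge-LCL $\mathcal{P}'=\langle\mathcal{O},\mathcal{H},\mathcal{L}\rangle$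 admits a randomized self-stabilizing algorithm that uses messages of at most $$c\,\bigl(\Delta\,(\mu(2\Delta-2)+\mu_{\mathcal{A}}(2\Delta-2))+\log\phi\bigr)$$ bits and whose fully adaptive run time in response to $k$ node manipulations is at most $$c\cdot\tfrac1\beta\,(\nu+1)\,\phi^6\,\log(k+\Delta+\sigma_0).$$ Moreover, every edge both of whose endpoints are at distance at least $\nu+2\phi+1$ from every manipulated node keeps its original output value throughout the execution, with probability $1$. -/

import Mathlib

open MeasureTheory
open scoped ENNReal

/-! ### Graphs, configurations and locally checkable labelings -/

/-- `G` belongs to the class `𝓤_D`: at most countably many nodes, all degrees at most `D`. -/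
def DegreeBounded (D : ℕ) {V : Type} (G : SimpleGraph V) : Prop :=
  Countable V ∧ ∀ v, (G.neighborSet v).encard ≤ D

/-- The triple `⟨O, 𝓖, ℓ⟩`: a family `𝓖` of graphs, each with at most countably many nodes and
bounded degrees, and an LCL over `O`, where `ok o M` is the predicate `ℓ_{|M|}(o, M)`.
The same kind of triple describes a node-LCL and an edge-LCL. -/
structure LCLProblem (O : Type) where
  family : ∀ {V : Type}, SimpleGraph V → Prop
  family_bounded : ∀ {V : Type} (G : SimpleGraph V), family G → ∃ D, DegreeBounded D G
  ok : O → Multiset O → Prop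

/-- The edge-LCL `⟨O, 𝓗, ℓ⟩` with `𝓗 = {G ∈ 𝓤 | L(G) ∈ 𝓖}`. -/
def LCLProblem.edgeProblem {O : Type} (P : LCLProblem O) : LCLProblem O where
  family G := (∃ D, DegreeBounded D G) ∧ P.family G.lineGraph
  family_bounded _ h := h.1
  ok := P.ok

/-- The multiset `C[v]` of the output values of the decided neighbors of `v`
(a configuration is a map to `Option O`, with `none` for the symbol `⊥`). -/
noncomputable def nbrOutputs {O V : Type} (G : SimpleGraph V) (C : V → Option O) (v : V) :
    Multiset O :=
  open Classical in
  if h : (G.neighborSet v).Finite then h.toFinset.val.filterMap C else 0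

/-- `v` is decided and content. -/
def Content {O V : Type} (P : LCLProblem O) (G : SimpleGraph V) (C : V → Option O) (v : V) :
    Prop :=
  ∃ o, C v = some o ∧ P.ok o (nbrOutputs G C v)

/-- `v` is decided and uncontent. -/
def Uncontent {O V : Type} (P : LCLProblem O) (G : SimpleGraph V) (C : V → Option O) (v : V) :
    Prop :=
  ∃ o, C v = some o ∧ ¬ P.ok o (nbrOutputs G C v)

/-- Every decided node is content. -/
def Strong {O V : Type} (P : LCLProblem O) (G : SimpleGraph V) (C : V → Option O) : Prop :=
  ∀ v, C v ≠ none → Content P G C v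

/-! ### Properties of the problem

`D` is the degree bound of the graphs on which the node algorithm is run. -/

/-- A graph of the family whose degrees are bounded by `D`. -/
def LCLProblem.Instance {O : Type} (P : LCLProblem O) (D : ℕ) {V : Type} (G : SimpleGraph V) :
    Prop :=
  P.family G ∧ DegreeBounded D G

def LCLProblem.HereditaryClosure {O : Type} (P : LCLProblem O) (D : ℕ) : Prop :=
  ∀ (V : Type) (G : SimpleGraph V), P.Instance D G → ∀ G' : G.Subgraph, P.family G'.coe

def LCLProblem.CoreCoverage {O : Type} (P : LCLProblem O) : Prop :=
  ∀ o, (∃ M, P.ok o M) ∧ ∀ M M' M'', M ≤ M' → M' ≤ M'' → P.ok o M → P.ok o M'' → P.ok o M'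

/-- The edges of the supportive digraph: `o'` belongs to some core (minimal satisfying multiset)
of `o`. -/
def LCLProblem.Supports {O : Type} (P : LCLProblem O) (o o' : O) : Prop :=
  ∃ M, Minimal (P.ok o) M ∧ o' ∈ M

/-- Every directed walk in the supportive digraph has at most `ν` edges; in particular the digraph
is acyclic. -/
def LCLProblem.BoundedInfluence {O : Type} (P : LCLProblem O) (ν : ℕ) : Prop :=
  ∀ l : List O, l.IsChain P.Supports → l.length ≤ ν + 1

/-! ### Ports and messages -/

/-- A message is a bit string; `Option Message` is used for "a message or nothing". -/
abbrev Message : Type := List Bool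

/-- A port numbering. -/
structure PortNumbering {V : Type} (G : SimpleGraph V) where
  deg : V → ℕ
  port : ∀ v, Fin (deg v) ≃ G.neighborSet v

/-- What `v` receives, port by port, if every node `u` sends `m u i` over its port `i`. -/
def PortNumbering.deliver {V : Type} {G : SimpleGraph V} (p : PortNumbering G)
    (m : ∀ v, Fin (p.deg v) → Option Message) (v : V) (i : Fin (p.deg v)) : Option Message :=
  m (p.port v i).1 ((p.port (p.port v i).1).symm ⟨v, (p.port v i).2.symm⟩)

/-! ### Detection procedures -/

/-- A detection procedure with its own registers. In the local computation of a round a node of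
degree `d` first evaluates `verdict` on its registers, its output register and the messages received
in the previous round; at the end of the local computation it updates its registers and composes
its messages by `step`, reading the (updated) output register. -/
structure DetectionProcedure (O : Type) where
  Reg : Type
  initial : Reg
  step : (d : ℕ) → Reg → Option O → (Fin d → Option Message) → Reg × (Fin d → Option Message)
  verdict : (d : ℕ) → Reg → Option O → (Fin d → Option Message) → Bool

/-- Correctness: after one round without manipulations, started from arbitrary registers `s` and
arbitrary received messages `inb`, the verdict of a node is `false` exactly when it is (decided and)
uncontent under the current configuration `C`. -/
def DetectionProcedure.Detects {O : Type} (T : DetectionProcedure O) (P : LCLProblem O) (D : ℕ) :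
    Prop :=
  ∀ (V : Type) (G : SimpleGraph V), P.Instance D G → ∀ (p : PortNumbering G) (C : V → Option O)
    (s : V → T.Reg) (inb : ∀ v, Fin (p.deg v) → Option Message) (v : V),
    T.verdict (p.deg v) (T.step (p.deg v) (s v) (C v) (inb v)).1 (C v)
      (p.deliver (fun u => (T.step (p.deg u) (s u) (C u) (inb u)).2) v) = false ↔
    Uncontent P G C v

/-- The LCL admits, on graphs of degree bound `D`, a detection procedure with messages of at most
`μ` bits. -/
def LCLProblem.Detectable {O : Type} (P : LCLProblem O) (D μ : ℕ) : Prop :=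
  ∃ T : DetectionProcedure O, T.Detects P D ∧
    ∀ d ≤ D, ∀ s o inb i m, (T.step d s o inb).2 i = some m → m.length ≤ μ

/-! ### Phase-based node algorithms -/

/-- A phase-based node algorithm, given by its phase procedure.

* Step `0` is the announcement step: every node `v` sends `announce out_v` to all its neighbors. A
  decided node repeats this throughout the phase and does nothing else.
* Steps `1, …, φ - 2` are the working stage. In step `j`, an undecided node that has `d` undecided
  neighbors (which it addresses by ports `Fin d`) applies `work j d` to its temporary state, a fresh
  coin and the messages that its undecided neighbors sent in the previous step, which yields the new
  state and the messages to the undecided neighbors.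
* Step `φ - 1` is the decision step: `decision` may moreover use the multiset of the output values
  of the decided neighbors; its value is written into the output register.

The temporary registers are reset to `initial` when a phase starts. `coin` is the law of a single
coin toss; every node tosses an independent coin in every step. -/
structure PhaseAlgorithm (O : Type) where
  phi : ℕ
  two_le_phi : 2 ≤ phi
  State : Type
  initial : State
  coin : PMF ℕ
  announce : Option O → Message
  announce_injective : Function.Injective announce
  work : (j d : ℕ) → State → ℕ → (Fin d → Option Message) → State × (Fin d → Option Message)
  decision : (d : ℕ) → State → ℕ → (Fin d → Option Message) → Multiset O → Option O

namespace PhaseAlgorithm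

variable {O : Type} (A : PhaseAlgorithm O)

/-- On graphs of degree bound `D`, the messages of `A` have at most `b` bits. -/
def MessagesAtMost (D b : ℕ) : Prop :=
  (∀ o, (A.announce o).length ≤ b) ∧
  ∀ j d, 1 ≤ j → j ≤ A.phi - 2 → d ≤ D → ∀ s, ∀ r ∈ A.coin.support, ∀ inb i m,
    (A.work j d s r inb).2 i = some m → m.length ≤ b

/-- The working stage on the graph `H` of the undecided nodes: the state of every node and the
messages it sends after step `j`. The announcements of undecided nodes carry no information for each
other. -/
def working {U : Type} {H : SimpleGraph U} (p : PortNumbering H) (r : U → ℕ → ℕ) :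
    ℕ → ∀ u : U, A.State × (Fin (p.deg u) → Option Message)
  | 0 => fun _ => (A.initial, fun _ => none)
  | j + 1 => fun u =>
      A.work (j + 1) (p.deg u) (working p r j u).1 (r u (j + 1))
        (p.deliver (fun w => (working p r j w).2) u)

/-- The configuration `Phase(G, C)` when node `v` tosses the coin `r v j` in step `j`. The port
numbering is that of the graph induced by the undecided nodes. -/
noncomputable def phase {V : Type} (G : SimpleGraph V) (C : V → Option O)
    (p : PortNumbering (G.induce {v | C v = none})) (r : V × ℕ → ℕ) : V → Option O :=
  open Classical in
  fun v =>
    if h : C v = none then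
      let fin := A.working p (fun u j => r (u.1, j)) (A.phi - 2)
      A.decision (p.deg ⟨v, h⟩) (fin ⟨v, h⟩).1 (r (v, A.phi - 1))
        (p.deliver (fun w => (fin w).2) ⟨v, h⟩) (nbrOutputs G C v)
    else C v

/-- The law of the coin tosses of all nodes in all steps. -/
noncomputable def coins (V : Type) : Measure (V × ℕ → ℕ) :=
  Measure.infinitePi fun _ => A.coin.toMeasure

/-- The restriction of `C` to `G - X` is `fun v : ↥Xᶜ => C v`. -/
def RespectfulDecisions (P : LCLProblem O) (D : ℕ) : Prop :=
  ∀ (V : Type) (G : SimpleGraph V), P.Instance D G →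
    ∀ (C : V → Option O) (X : Set V), (∀ v ∈ X, C v = none) →
    ∀ p : PortNumbering ((G.induce Xᶜ).induce {v : ↥Xᶜ | C v = none}),
    ∀ᵐ r ∂A.coins ↥Xᶜ,
      (∀ v : ↥Xᶜ, Content P G C v →
        Content P (G.induce Xᶜ) (A.phase (G.induce Xᶜ) (fun v => C v) p r) v) ∧
      (∀ v : ↥Xᶜ, C v = none → A.phase (G.induce Xᶜ) (fun v => C v) p r v ≠ none →
        Content P (G.induce Xᶜ) (A.phase (G.induce Xᶜ) (fun v => C v) p r) v)

end PhaseAlgorithm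

/-! ### Locally separable potential functions -/

structure PotentialCoefficients (O : Type) where
  sigma : Multiset O → Multiset O → ℕ
  symm : ∀ M M', sigma M M' = sigma M' M
  anti : ∀ M₁ M₁' M₂ M₂', M₁ ≤ M₁' → M₂ ≤ M₂' → sigma M₁' M₂' ≤ sigma M₁ M₂

/-- The contribution of a pair of nodes to the potential. -/
noncomputable def PotentialCoefficients.pair {O V : Type} (S : PotentialCoefficients O)
    (G : SimpleGraph V) (C : V → Option O) : Sym2 V → ℝ≥0∞ :=
  open Classical in
  Sym2.lift ⟨fun u v => if C u = none ∧ C v = none then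
      (S.sigma (nbrOutputs G C u) (nbrOutputs G C v) : ℝ≥0∞) else 0, by
    intro u v
    simp only [S.symm (nbrOutputs G C u), and_comm (a := C u = none)]⟩

/-- The potential `π(G, C)`, the sum over all edges with two undecided endpoints (possibly `∞` if
there are infinitely many of them). -/
noncomputable def PotentialCoefficients.potential {O V : Type} (S : PotentialCoefficients O)
    (G : SimpleGraph V) (C : V → Option O) : ℝ≥0∞ :=
  ∑' e : G.edgeSet, S.pair G C e

def PhaseAlgorithm.Progress {O : Type} (A : PhaseAlgorithm O) (P : LCLProblem O) (D : ℕ) (β : ℝ)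
    (σ₀ : ℕ) : Prop :=
  0 < β ∧ β < 1 ∧ ∃ S : PotentialCoefficients O, S.sigma 0 0 = σ₀ ∧
    ∀ (V : Type) (G : SimpleGraph V), P.Instance D G → ∀ C : V → Option O, Strong P G C →
      ∀ p : PortNumbering (G.induce {v | C v = none}),
        ∫⁻ r, S.potential G (A.phase G C p r) ∂A.coins V
            ≤ ENNReal.ofReal (1 - β) * S.potential G C ∧
        (S.potential G C = 0 → ∀ᵐ r ∂A.coins V, ∀ v, A.phase G C p r v ≠ none)

/-- `A`, run on the graphs of the family with degree bound `D`, is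
`(ν, μ(·), φ, β, σ₀)`-eligible, where `φ = A.phi`. -/
structure PhaseAlgorithm.Eligible {O : Type} (A : PhaseAlgorithm O) (P : LCLProblem O) (D ν : ℕ)
    (μ : ℕ → ℕ) (β : ℝ) (σ₀ : ℕ) : Prop where
  hereditary : P.HereditaryClosure D
  core : P.CoreCoverage
  influence : P.BoundedInfluence ν
  detectable : P.Detectable D (μ D)
  respectful : A.RespectfulDecisions P D
  progress : A.Progress P D β σ₀

/-! ### Randomized algorithms for edge problems -/

/-- A randomized algorithm for an edge problem in the port numbering model. A node of degree `d` has
registers `Reg d`, one output register per port and one incoming message register per port. In every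
round it applies `step d` to them and to a fresh coin of law `coin`, which yields the new registers,
the new output registers and the messages sent over the ports. -/
structure EdgeAlgorithm (O : Type) where
  Reg : ℕ → Type
  reg_nonempty : ∀ d, Nonempty (Reg d)
  coin : PMF ℕ
  step : (d : ℕ) → Reg d → (Fin d → Option O) → (Fin d → Option Message) → ℕ →
    Reg d × (Fin d → Option O) × (Fin d → Option Message)

/-- In graphs of degree bound `D`, all messages have at most `b` bits. -/
def EdgeAlgorithm.MessagesAtMost {O : Type} (B : EdgeAlgorithm O) (D : ℕ) (b : ℝ) : Prop :=
  ∀ d ≤ D, ∀ s out inb, ∀ r ∈ B.coin.support, ∀ i m,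
    (B.step d s out inb r).2.2 i = some m → (m.length : ℝ) ≤ b

/-- Everything attached to a node: the assignment of its ports to its neighbors and the content of
its registers. -/
structure NodeState {O : Type} (B : EdgeAlgorithm O) (V : Type) where
  deg : ℕ
  nbr : Fin deg → V
  reg : B.Reg deg
  out : Fin deg → Option O
  inbox : Fin deg → Option Message

/-- A network with node names in `V` together with its global state; `none` stands for a node that
is currently not in the graph. -/
abbrev GlobalState {O : Type} (B : EdgeAlgorithm O) (V : Type) : Type :=
  V → Option (NodeState B V)

namespace GlobalState

variable {O V : Type} {B : EdgeAlgorithm O}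

/-- `u` is present and has a port for `v`. -/
def HasPort (S : GlobalState B V) (u v : V) : Prop :=
  ∃ s, S u = some s ∧ ∃ i, s.nbr i = v

/-- The ports of every node correspond bijectively to its neighbors in a simple graph. -/
def WellFormed (S : GlobalState B V) : Prop :=
  ∀ u s, S u = some s → Function.Injective s.nbr ∧
    ∀ i, s.nbr i ≠ u ∧ S.HasPort (s.nbr i) u

/-- The set of the nodes that are present. -/
def verts (S : GlobalState B V) : Set V := {v | S v ≠ none}

/-- The communication graph. -/
def graph (S : GlobalState B V) : SimpleGraph ↥S.verts where
  Adj u v := u ≠ v ∧ S.HasPort u v ∧ S.HasPort v u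
  symm := ⟨fun _ _ h => ⟨h.1.symm, h.2.2, h.2.1⟩⟩
  loopless := ⟨fun _ h => h.1 rfl⟩

/-- The output register `out_u(v)`. -/
noncomputable def outReg (S : GlobalState B V) (u v : V) : Option O :=
  open Classical in
  match S u with
  | none => none
  | some s => if h : ∃ i, s.nbr i = v then s.out h.choose else none

/-- The output of the edge `{u, v}`: the common content of `out_u(v)` and `out_v(u)` if the edge is
port-consistent, and `⊥` otherwise. -/
noncomputable def edgeOut (S : GlobalState B V) : Sym2 V → Option O :=
  open Classical in
  Sym2.lift ⟨fun u v => if S.outReg u v = S.outReg v u then S.outReg u v else none, by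
    intro u v
    by_cases h : S.outReg u v = S.outReg v u
    · simp [h]
    · simp [h, Ne.symm h]⟩

/-- An edge of the communication graph as an unordered pair of node names. -/
def name (S : GlobalState B V) (e : S.graph.edgeSet) : Sym2 V :=
  (e : Sym2 ↥S.verts).map Subtype.val

/-- The edge configuration, as a configuration of the line graph. -/
noncomputable def config (S : GlobalState B V) : S.graph.edgeSet → Option O :=
  fun e => S.edgeOut (S.name e)

/-- All edges are decided and content. -/
def Legal (P : LCLProblem O) (S : GlobalState B V) : Prop :=
  ∀ e, Content P S.graph.lineGraph S.config e

/-- The message that `u` sends to `v` in a round in which `u` tosses the coin `r u`. -/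
noncomputable def msg (S : GlobalState B V) (r : V → ℕ) (u v : V) : Option Message :=
  open Classical in
  match S u with
  | none => none
  | some s =>
    if h : ∃ i, s.nbr i = v then (B.step s.deg s.reg s.out s.inbox (r u)).2.2 h.choose else none

/-- The global state after one round without manipulations. -/
noncomputable def next (S : GlobalState B V) (r : V → ℕ) : GlobalState B V :=
  fun v => (S v).map fun s =>
    { deg := s.deg
      nbr := s.nbr
      reg := (B.step s.deg s.reg s.out s.inbox (r v)).1
      out := (B.step s.deg s.reg s.out s.inbox (r v)).2.1
      inbox := fun i => S.msg r (s.nbr i) v }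

/-- The global state after `n` rounds without manipulations; `w (n, v)` is the coin of `v` in
round `n`. -/
noncomputable def run (S : GlobalState B V) (w : ℕ × V → ℕ) : ℕ → GlobalState B V
  | 0 => S
  | n + 1 => (run S w n).next fun v => w (n, v)

/-- From time `n` on the configuration is legal and does not change. -/
def StableFrom (P : LCLProblem O) (S : GlobalState B V) (w : ℕ × V → ℕ) (n : ℕ) : Prop :=
  (S.run w n).Legal P ∧ ∀ m ≥ n, (S.run w m).edgeOut = (S.run w n).edgeOut

/-- The first positive time from which on the configuration is legal and does not change (`∞` if
there is none). -/
noncomputable def stabilizationTime (P : LCLProblem O) (S : GlobalState B V) (w : ℕ × V → ℕ) :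
    ℝ≥0∞ :=
  ⨅ n : {n : ℕ // 0 < n ∧ S.StableFrom P w n}, (n.1 : ℝ≥0∞)

end GlobalState

namespace EdgeAlgorithm

variable {O : Type} (B : EdgeAlgorithm O)

/-- The law of the coin tosses of all nodes in all rounds. -/
noncomputable def coins (V : Type) : Measure (ℕ × V → ℕ) :=
  Measure.infinitePi fun _ => B.coin.toMeasure

/-- The nodes manipulated in a round in which the coins are `r`, the global state at the beginning
is `S` and the global state at the end, after the manipulations, is `S'`: those nodes of the
resulting graph that are new or whose ports or registers were modified. -/
def manipulated {V : Type} (S S' : GlobalState B V) (r : V → ℕ) : Set V :=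
  {v | S' v ≠ none ∧ S' v ≠ S.next r v}

/-- `S t`, for `ta - 1 ≤ t ≤ tb`, are the global states of a possible execution in the presence of
the adversary: the graph always stays in the family, no node is manipulated in round `ta - 1`, the
configurations at times `ta - 1` and `ta` are equal and legal, and `K` is the set of the nodes
manipulated during the rounds `ta, …, tb - 1`. The coins are arbitrary possible outcomes, so the
adversary may be fully adaptive. -/
structure AdversarialExecution (P : LCLProblem O) {V : Type} (S : ℕ → GlobalState B V)
    (ta tb : ℕ) (K : Set V) : Prop where
  ta_pos : 0 < ta
  ta_lt_tb : ta < tb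
  wellFormed : ∀ t, ta - 1 ≤ t → t ≤ tb → (S t).WellFormed
  family : ∀ t, ta - 1 ≤ t → t ≤ tb → P.family (S t).graph
  legal : (S (ta - 1)).Legal P
  legal' : (S ta).Legal P
  config_eq : (S (ta - 1)).edgeOut = (S ta).edgeOut
  rounds : ∃ r : ℕ → V → ℕ, (∀ t v, r t v ∈ B.coin.support) ∧
    B.manipulated (S (ta - 1)) (S ta) (r (ta - 1)) = ∅ ∧
    K = {v | ∃ t, ta ≤ t ∧ t < tb ∧ v ∈ B.manipulated (S t) (S (t + 1)) (r t)}

/-- On every finite graph of the family and from any initial global state, almost surely a legal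
configuration is reached in finite time and kept forever. -/
def SelfStabilizing (P : LCLProblem O) : Prop :=
  ∀ (V : Type) [Countable V] (S : GlobalState B V), S.verts.Finite → S.WellFormed →
    P.family S.graph → ∀ᵐ w ∂B.coins V, ∃ n, S.StableFrom P w n

/-- The fully adaptive run time in response to `k` node manipulations is at most `T k`: the expected
number of rounds after time `tb` until the configuration is legal and does not change any more is at
most `T k`, whatever happened up to time `tb`. -/
def FullyAdaptiveRunTime (P : LCLProblem O) (T : ℕ → ℝ) : Prop :=
  ∀ (V : Type) [Countable V] (S : ℕ → GlobalState B V) (ta tb : ℕ) (K : Set V),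
    B.AdversarialExecution P S ta tb K → K.Finite → 0 < K.ncard →
    ∫⁻ w, (S tb).stabilizationTime P w ∂B.coins V ≤ ENNReal.ofReal (T K.ncard)

/-- Edges whose distance from every manipulated node is at least `R` keep their original output
value throughout the execution. -/
def InfluenceRadius (P : LCLProblem O) (R : ℕ) : Prop :=
  ∀ (V : Type) [Countable V] (S : ℕ → GlobalState B V) (ta tb : ℕ) (K : Set V),
    B.AdversarialExecution P S ta tb K → K.Finite → 0 < K.ncard →
    ∀ e : (S tb).graph.edgeSet,
      (∀ u ∈ (e : Sym2 ↥(S tb).verts), ∀ m : ↥(S tb).verts, (m : V) ∈ K →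
        (R : ℕ∞) ≤ (S tb).graph.edist u m) →
      (∀ t, ta ≤ t → t ≤ tb →
        (S t).edgeOut ((S tb).name e) = (S ta).edgeOut ((S tb).name e)) ∧
      ∀ᵐ w ∂B.coins V, ∀ n,
        ((S tb).run w n).edgeOut ((S tb).name e) = (S ta).edgeOut ((S tb).name e)

end EdgeAlgorithm

/-!
The edge algorithm simulates `A` on the line graph. A main difficulty is that an edge is not a
processor: its state has to be kept by one of its endpoints, and the endpoint that simulates the
edge cannot directly exchange messages with the edges at the other endpoint.

Symmetry is broken at random. Each node has a cyclic clock of period `6 * φ - 2`, and in each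
period it draws an offset, which determines when it starts a phase, and a bit. An undecided edge
takes part in a phase if its endpoints start their phases in the same round with different bits.
The endpoint with bit `true`, the `tail`, simulates the edge with its state, coins and messages;
the other endpoint, the `head`, forwards messages. All edges simulated by a node have heads with
bit `false`, and a message between adjacent participating edges with distinct tails passes through
their common head. So a step of `A` is simulated in two rounds. As each node knows the output
registers of its neighbors, every edge sees the output values of all adjacent edges; decided edges
that are uncontent clear their registers, except in the round in which decisions are computed
nearby, and no separate detection messages are needed. The messages consist of `O(Δ)` announcements
and messages of `A`.

*Correctness of the simulation* (`Exec.inputOf`, `Exec.cfg_commit`). The participating edges `W`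
change their outputs as in a phase of `A` in which all other undecided edges are idle (`phaseOn`),
and this is a phase of `A` on the line graph without the idle edges (`phase_induce_eq_phaseOn`).
This is where the decisions of `A` have to be respectful on subgraphs, in
`RespectfulDecisions.content_phaseOn`.

*Influence* (`Exec.cfg_eq_of_deep`, `influence`). A content edge becomes uncontent only if an edge
is lost whose output value supports its own. So disturbances spread along walks in the supportive
digraph, which have at most `ν` edges, and at distance `ν + 2 * φ + 1` from the manipulated nodes
nothing ever changes. For the same reason, uncontent edges at late times would give long walks in
this digraph, and the configuration is strong from the time `strongTime` on (`Exec.strong_cfg`).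
The number of edges that can be affected is thus at most `k * (Δ + 1) ^ (ν + 2 * φ + 2)`
(`exists_near_edges`).

*Progress*. From then on output values are never lost. The coins of a phase are independent of the
configuration at its end before the decisions are written, and of the set `W`. So the expected
potential decreases by `β` times the expected potential of the pairs of adjacent edges that decide
together (`lintegral_potential_step`). The three nodes of a pair of adjacent edges start a phase
together, with suitable bits, with probability at least `(8 * φ - 2)⁻³` at some time in a window of
`O(φ)` rounds, whatever happened before: this time can be fixed in advance, in terms of the clocks,
so that there is no conditioning on the coins (`exists_sync`). Consequently the expected potential
shrinks by a constant factor in each window (`expectedPotential_window`), and since the potential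
has integer values, it is likely to vanish after a logarithmic number of windows. Without potential, every edge that takes
part in a phase decides, which again happens in each window with probability at least
`(8 * φ - 2)⁻³` (`measure_undecided_window`). Summing the probabilities that some edge is still undecided
gives the bound on the expected stabilization time (`lintegral_stabilizationTime_le`), which is
brought into closed form in `run_time_le`; the logarithm of the number of affected edges
contributes the factor `ν + φ`.
-/

/-! ### Functions of finitely many coin tosses -/

/-- The value of `f` is determined by finitely many coordinates. -/
def FiniteDep {ι α β : Type*} (f : (ι → α) → β) : Prop :=
  ∃ s : Finset ι, DependsOn f (s : Set ι)

namespace FiniteDep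

variable {ι α β γ : Type*}

theorem const (b : β) : FiniteDep (fun _ : ι → α => b) :=
  ⟨∅, fun _ _ _ => rfl⟩

theorem eval (i : ι) : FiniteDep (fun r : ι → α => r i) :=
  ⟨{i}, fun _ _ h => h i (by simp)⟩

theorem map {f : (ι → α) → β} (hf : FiniteDep f) (g : β → γ) : FiniteDep fun r => g (f r) := by
  obtain ⟨s, hs⟩ := hf
  exact ⟨s, fun x y h => congrArg g (hs h)⟩

theorem pi {κ : Type*} [Finite κ] {β : κ → Type*} {f : ∀ k, (ι → α) → β k}
    (hf : ∀ k, FiniteDep (f k)) : FiniteDep fun r k => f k r := by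
  classical
  have := Fintype.ofFinite κ
  choose s hs using hf
  refine ⟨Finset.univ.biUnion s, fun x y h => funext fun k => hs k fun i hi => h i ?_⟩
  simp only [Finset.coe_biUnion, Set.mem_iUnion]
  exact ⟨k, by simp, hi⟩

theorem prodMk {f : (ι → α) → β} {g : (ι → α) → γ} (hf : FiniteDep f) (hg : FiniteDep g) :
    FiniteDep fun r => (f r, g r) := by
  classical
  obtain ⟨s, hs⟩ := hf
  obtain ⟨t, ht⟩ := hg
  refine ⟨s ∪ t, fun x y h => Prod.ext (hs fun i hi => h i ?_) (ht fun i hi => h i ?_)⟩ <;>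
    simp at hi ⊢ <;> tauto

theorem measurable [MeasurableSpace β] {f : (ι → ℕ) → β} (hf : FiniteDep f) : Measurable f := by
  classical
  obtain ⟨s, hs⟩ := hf
  have h : f = (fun x : s → ℕ => f fun i => if h : i ∈ s then x ⟨i, h⟩ else 0) ∘
      (fun r (i : s) => r i) := by
    funext r
    refine hs fun i hi => ?_
    have hi' : i ∈ s := hi
    simp [hi']
  rw [h]
  exact (measurable_of_countable _).comp (by fun_prop)

/-- An almost sure property of finitely many discrete coin tosses holds for all possible
outcomes. -/
theorem forall_of_ae {p : PMF ℕ} {Q : (ι → ℕ) → Prop} (hQ : FiniteDep Q)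
    (h : ∀ᵐ r ∂Measure.infinitePi (fun _ : ι => p.toMeasure), Q r) (r : ι → ℕ)
    (hr : ∀ i, r i ∈ p.support) : Q r := by
  obtain ⟨s, hs⟩ := hQ
  by_contra hn
  have hsub : (s : Set ι).pi (fun i => {r i}) ⊆ {x | ¬ Q x} := by
    intro x hx hQx
    have : Q x = Q r := hs fun i hi => by simpa using hx i hi
    exact hn (this ▸ hQx)
  have h0 := measure_mono_null hsub (ae_iff.1 h)
  rw [Measure.infinitePi_pi _ (fun i _ => measurableSet_singleton _), Finset.prod_eq_zero_iff] at h0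
  obtain ⟨i, -, hi⟩ := h0
  rw [PMF.toMeasure_apply_singleton _ _ (measurableSet_singleton _)] at hi
  exact (PMF.mem_support_iff _ _).1 (hr i) hi

end FiniteDep

theorem ae_mem_support {ι : Type*} [Countable ι] (p : PMF ℕ) :
    ∀ᵐ r ∂Measure.infinitePi (fun _ : ι => p.toMeasure), ∀ i, r i ∈ p.support := by
  rw [ae_all_iff]
  intro i
  have h := (measurePreserving_eval_infinitePi (fun _ : ι => p.toMeasure) i)
  have h1 : ∀ᵐ x ∂p.toMeasure, x ∈ p.support := by
    rw [ae_iff]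
    have : {a | ¬ a ∈ p.support} = p.supportᶜ := rfl
    rw [this, PMF.toMeasure_apply_eq_zero_iff _ (MeasurableSet.of_discrete)]
    exact disjoint_compl_right
  exact h.quasiMeasurePreserving.ae h1

/-! ### Resampling part of the coins -/

section Resample

variable {ι : Type*}

open Classical in
/-- The coins of `w`, with those indexed by `J` replaced by the coins of `w'`. -/
noncomputable def resample (J : Set ι) (w w' : ι → ℕ) : ι → ℕ :=
  fun i => if i ∈ J then w' i else w i

theorem resample_of_mem {J : Set ι} {i : ι} (h : i ∈ J) (w w' : ι → ℕ) :
    resample J w w' i = w' i := if_pos h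

theorem resample_of_notMem {J : Set ι} {i : ι} (h : i ∉ J) (w w' : ι → ℕ) :
    resample J w w' i = w i := if_neg h

theorem measurable_resample (J : Set ι) :
    Measurable fun x : (ι → ℕ) × (ι → ℕ) => resample J x.1 x.2 := by
  refine measurable_pi_lambda _ fun i => ?_
  by_cases h : i ∈ J
  · simp only [resample_of_mem h]; fun_prop
  · simp only [resample_of_notMem h]; fun_prop

/-- Replacing some of the independent coins by independent copies does not change the distribution.
-/
theorem map_resample (p : PMF ℕ) (J : Set ι) :
    ((Measure.infinitePi fun _ : ι => p.toMeasure).prod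
      (Measure.infinitePi fun _ : ι => p.toMeasure)).map (fun x => resample J x.1 x.2) =
    Measure.infinitePi fun _ : ι => p.toMeasure := by
  classical
  refine Measure.eq_infinitePi _ fun s t ht => ?_
  rw [Measure.map_apply (measurable_resample J)
    (MeasurableSet.pi s.countable_toSet fun i _ => ht i)]
  have : (fun x : (ι → ℕ) × (ι → ℕ) => resample J x.1 x.2) ⁻¹' (s : Set ι).pi t =
      ((s.filter (· ∉ J) : Finset ι) : Set ι).pi t ×ˢ
        ((s.filter (· ∈ J) : Finset ι) : Set ι).pi t := by
    ext x
    simp only [Set.mem_preimage, Set.mem_pi, Finset.mem_coe, Set.mem_prod, Finset.mem_filter]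
    constructor
    · intro h
      exact ⟨fun i hi => resample_of_notMem hi.2 x.1 x.2 ▸ h i hi.1,
        fun i hi => resample_of_mem hi.2 x.1 x.2 ▸ h i hi.1⟩
    · rintro ⟨h1, h2⟩ i hi
      by_cases hJ : i ∈ J
      · rw [resample_of_mem hJ]; exact h2 i ⟨hi, hJ⟩
      · rw [resample_of_notMem hJ]; exact h1 i ⟨hi, hJ⟩
  rw [this, Measure.prod_prod, Measure.infinitePi_pi _ (fun i _ => ht i),
    Measure.infinitePi_pi _ (fun i _ => ht i), mul_comm]
  exact Finset.prod_filter_mul_prod_filter_not s (· ∈ J) (fun i => p.toMeasure (t i))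

theorem lintegral_resample (p : PMF ℕ) (J : Set ι) {f : (ι → ℕ) → ℝ≥0∞} (hf : Measurable f) :
    ∫⁻ w, f w ∂Measure.infinitePi (fun _ : ι => p.toMeasure) =
    ∫⁻ w, ∫⁻ w', f (resample J w w') ∂Measure.infinitePi (fun _ : ι => p.toMeasure)
      ∂Measure.infinitePi (fun _ : ι => p.toMeasure) := by
  conv_lhs => rw [← map_resample p J]
  rw [lintegral_map hf (measurable_resample J),
    lintegral_prod (fun x : (ι → ℕ) × (ι → ℕ) => f (resample J x.1 x.2))
      (hf.comp (measurable_resample J)).aemeasurable]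

/-- A function of the coins outside `J` is independent of an event that only concerns the coins
in `J`. -/
theorem lintegral_mul_indicator_of_dependsOn (p : PMF ℕ) (J : Set ι) {f : (ι → ℕ) → ℝ≥0∞}
    (hf : Measurable f) (hfJ : DependsOn f Jᶜ) {S : Set (ι → ℕ)} (hS : MeasurableSet S)
    (hSJ : DependsOn (· ∈ S) J) :
    ∫⁻ w, f w * S.indicator 1 w ∂Measure.infinitePi (fun _ : ι => p.toMeasure) =
    (∫⁻ w, f w ∂Measure.infinitePi (fun _ : ι => p.toMeasure)) *
      Measure.infinitePi (fun _ : ι => p.toMeasure) S := by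
  have hm : Measurable fun w => f w * S.indicator 1 w :=
    hf.mul (measurable_one.indicator hS)
  rw [lintegral_resample p J hm]
  have : ∀ w w', f (resample J w w') * S.indicator (1 : (ι → ℕ) → ℝ≥0∞) (resample J w w') =
      f w * S.indicator 1 w' := by
    intro w w'
    have h1 : f (resample J w w') = f w := hfJ fun i hi => resample_of_notMem hi w w'
    have h2 : (resample J w w' ∈ S) = (w' ∈ S) := hSJ fun i hi => resample_of_mem hi w w'
    rw [h1]
    by_cases h : w' ∈ S
    · rw [Set.indicator_of_mem h, Set.indicator_of_mem (h2 ▸ h)]; rfl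
    · rw [Set.indicator_of_notMem h, Set.indicator_of_notMem (h2 ▸ h)]
  simp only [this]
  have h3 : ∀ w, ∫⁻ w', f w * S.indicator 1 w' ∂Measure.infinitePi (fun _ : ι => p.toMeasure) =
      f w * Measure.infinitePi (fun _ : ι => p.toMeasure) S := by
    intro w
    rw [lintegral_const_mul _ (measurable_one.indicator hS), lintegral_indicator_one hS]
  simp only [h3]
  rw [lintegral_mul_const _ hf]

end Resample

/-! ### Packing many coins into one -/

section Seed

variable (p : PMF ℕ) (D Z : Type) [Fintype D] [Fintype Z] [Nonempty Z] [MeasurableSpace Z]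
  [MeasurableSingletonClass Z]

/-- The joint law of independent tosses of `p`, one for each element of `D`, and a uniformly random
element of `Z`. -/
noncomputable def seedMeasure : Measure ((D → ℕ) × Z) :=
  (Measure.pi fun _ : D => p.toMeasure).prod (PMF.uniformOfFintype Z).toMeasure

instance : IsProbabilityMeasure (seedMeasure p D Z) := by
  unfold seedMeasure; infer_instance

end Seed

section SeedCoding

variable (p : PMF ℕ) (D Z : Type) [Fintype D] [Encodable D] [Fintype Z]
  [Nonempty Z] [Encodable Z] [MeasurableSpace Z] [MeasurableSingletonClass Z]

/-- A single coin of type `ℕ` that encodes an outcome of `seedMeasure`. -/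
noncomputable def seedCoin : PMF ℕ :=
  ((seedMeasure p D Z).toPMF).map Encodable.encode

variable {D Z}

/-- The coins and the draw that an outcome of `seedCoin` stands for. -/
noncomputable def seedDecode (n : ℕ) : (D → ℕ) × Z :=
  ((Encodable.decode n : Option ((D → ℕ) × Z))).getD (fun _ => 0, Classical.arbitrary Z)

theorem map_seedDecode :
    (seedCoin p D Z).toMeasure.map seedDecode = seedMeasure p D Z := by
  have h : (seedCoin p D Z).toMeasure =
      (seedMeasure p D Z).map Encodable.encode := by
    rw [seedCoin, ← PMF.toMeasure_map _ _ (measurable_of_countable _), Measure.toPMF_toMeasure]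
  rw [h, Measure.map_map (measurable_of_countable _) (measurable_of_countable _)]
  have : (seedDecode ∘ Encodable.encode : (D → ℕ) × Z → (D → ℕ) × Z) = id := by
    funext x; simp [seedDecode]
  rw [this, Measure.map_id]

theorem seedDecode_mem_support {n : ℕ} (hn : n ∈ (seedCoin p D Z).support) (d : D) :
    (seedDecode n : (D → ℕ) × Z).1 d ∈ p.support := by
  rw [seedCoin, PMF.support_map] at hn
  obtain ⟨x, hx, rfl⟩ := hn
  have hx' : (seedMeasure p D Z) {x} ≠ 0 := (PMF.mem_support_iff _ _).1 hx
  have h2 : (seedDecode (Encodable.encode x) : (D → ℕ) × Z) = x := by simp [seedDecode]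
  rw [h2]
  obtain ⟨a, z⟩ := x
  have h3 : ({(a, z)} : Set ((D → ℕ) × Z)) = (Set.univ.pi fun d => {a d}) ×ˢ {z} := by
    rw [Set.univ_pi_singleton, Set.singleton_prod_singleton]
  rw [h3, seedMeasure, Measure.prod_prod, Measure.pi_pi] at hx'
  have h4 := (mul_ne_zero_iff.1 hx').1
  rw [Finset.prod_ne_zero_iff] at h4
  have h5 := h4 d (Finset.mem_univ d)
  rwa [PMF.toMeasure_apply_singleton _ _ (measurableSet_singleton _),
    ← PMF.mem_support_iff] at h5

theorem seedCoin_uniform (z : Z) :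
    (seedCoin p D Z).toMeasure {n | (seedDecode n : (D → ℕ) × Z).2 = z} =
      (Fintype.card Z : ℝ≥0∞)⁻¹ := by
  have h : {n | (seedDecode n : (D → ℕ) × Z).2 = z} =
      seedDecode ⁻¹' (Set.univ ×ˢ {z} : Set ((D → ℕ) × Z)) := by
    ext n; simp
  rw [h, ← Measure.map_apply (measurable_of_countable _) (MeasurableSet.univ.prod
    (measurableSet_singleton z)), map_seedDecode, seedMeasure, Measure.prod_prod,
    PMF.toMeasure_apply_singleton _ _ (measurableSet_singleton _)]
  simp

/-- Reading the coins of a family of slots, without repetition, off independent seeds yields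
independent coins. -/
theorem lintegral_seed {ι E : Type*} {Δ φ : ℕ} {f : E → ι × Fin Δ}
    (hf : Function.Injective f) {g : (E × ℕ → ℕ) → ℝ≥0∞} (hg : Measurable g)
    (hdep : DependsOn g {x | x.2 < φ}) {ρ : (ι → ℕ) → E × ℕ → ℕ}
    (hρ : ∀ w e (j : Fin φ), ρ w (e, (j : ℕ)) =
      (seedDecode (w (f e).1) : (Fin Δ × Fin φ → ℕ) × Z).1 ((f e).2, j)) :
    ∫⁻ w, g (ρ w) ∂Measure.infinitePi (fun _ : ι => (seedCoin p (Fin Δ × Fin φ) Z).toMeasure) =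
    ∫⁻ r, g r ∂Measure.infinitePi (fun _ : E × ℕ => p.toMeasure) := by
  let ext : (E × Fin φ → ℕ) → E × ℕ → ℕ := fun y x => if h : x.2 < φ then y (x.1, ⟨x.2, h⟩) else 0
  have hext : Measurable ext := by
    refine measurable_pi_lambda _ fun x => ?_
    by_cases h : x.2 < φ
    · simp only [ext, h, dif_pos]; fun_prop
    · simp only [ext, h, dif_neg, not_false_iff]; fun_prop
  have hge : ∀ (r : E × ℕ → ℕ) (y : E × Fin φ → ℕ), (∀ e (j : Fin φ), r (e, (j : ℕ)) = y (e, j)) →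
      g r = g (ext y) := by
    intro r y h
    refine hdep fun x hx => ?_
    have hx' : x.2 < φ := hx
    simp only [ext, hx', dif_pos]
    exact h x.1 ⟨x.2, hx'⟩
  have hL : ∀ w, g (ρ w) = g (ext fun x : E × Fin φ =>
      (seedDecode (w (f x.1).1) : (Fin Δ × Fin φ → ℕ) × Z).1 ((f x.1).2, x.2)) :=
    fun w => hge _ (fun x : E × Fin φ =>
      (seedDecode (w (f x.1).1) : (Fin Δ × Fin φ → ℕ) × Z).1 ((f x.1).2, x.2)) (hρ w)
  have hR : ∀ r, g r = g (ext fun x : E × Fin φ => r (x.1, (x.2 : ℕ))) :=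
    fun r => hge _ (fun x : E × Fin φ => r (x.1, (x.2 : ℕ))) fun _ _ => rfl
  rw [lintegral_congr hL, lintegral_congr hR]
  have e1 : (Measure.infinitePi (fun _ : E × ℕ => p.toMeasure)).map
      (fun r (x : E × Fin φ) => r (x.1, (x.2 : ℕ))) =
      Measure.infinitePi (fun _ : E × Fin φ => p.toMeasure) := by
    refine Measure.map_infinitePi_infinitePi_of_inj (f := fun x : E × Fin φ => (x.1, (x.2 : ℕ)))
      (P := fun _ : E × ℕ => p.toMeasure) ?_
    rintro ⟨a, i⟩ ⟨b, j⟩ h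
    simp only [Prod.mk.injEq] at h
    exact Prod.ext h.1 (Fin.ext h.2)
  have e2 : (Measure.infinitePi (fun _ : ι => (seedCoin p (Fin Δ × Fin φ) Z).toMeasure)).map
      (fun w (x : E × Fin φ) =>
        (seedDecode (w (f x.1).1) : (Fin Δ × Fin φ → ℕ) × Z).1 ((f x.1).2, x.2)) =
      Measure.infinitePi (fun _ : E × Fin φ => p.toMeasure) := by
    have a1 : (Measure.infinitePi (fun _ : ι => (seedCoin p (Fin Δ × Fin φ) Z).toMeasure)).map
        (fun w i => (seedDecode (w i) : (Fin Δ × Fin φ → ℕ) × Z).1) =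
        Measure.infinitePi fun _ : ι =>
          Measure.infinitePi fun _ : Fin Δ × Fin φ => p.toMeasure := by
      rw [Measure.infinitePi_map_pi _
        (f := fun _ n => (seedDecode n : (Fin Δ × Fin φ → ℕ) × Z).1)
        (fun _ => measurable_of_countable _)]
      congr
      funext i
      have : (fun n => (seedDecode n : (Fin Δ × Fin φ → ℕ) × Z).1) = Prod.fst ∘ seedDecode := rfl
      rw [this, ← Measure.map_map measurable_fst (measurable_of_countable _), map_seedDecode,
        seedMeasure, Measure.map_fst_prod, Measure.infinitePi_eq_pi]
      simp
    have a2 := Measure.infinitePi_map_curry_symm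
      (fun (_ : ι) (_ : Fin Δ × Fin φ) => p.toMeasure)
    rw [← a1] at a2
    have hinj : Function.Injective
        (fun x : E × Fin φ => (((f x.1).1, ((f x.1).2, x.2)) : ι × (Fin Δ × Fin φ))) := by
      rintro ⟨a, i⟩ ⟨b, j⟩ h
      simp only [Prod.mk.injEq] at h
      exact Prod.ext (hf (Prod.ext h.1 h.2.1)) h.2.2
    have a3 := Measure.map_infinitePi_infinitePi_of_inj
      (P := fun _ : ι × (Fin Δ × Fin φ) => p.toMeasure) hinj
    rw [← a2, Measure.map_map (by fun_prop) (by fun_prop), Measure.map_map (by fun_prop)] at a3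
    · exact a3
    · refine measurable_pi_lambda _ fun i => ?_
      exact (measurable_of_countable
        (fun n => (seedDecode n : (Fin Δ × Fin φ → ℕ) × Z).1)).comp (measurable_pi_apply i)
  have m2 : Measurable (fun (w : ι → ℕ) (x : E × Fin φ) =>
      (seedDecode (w (f x.1).1) : (Fin Δ × Fin φ → ℕ) × Z).1 ((f x.1).2, x.2)) := by
    refine measurable_pi_lambda _ fun x => ?_
    exact (measurable_of_countable (fun n =>
      (seedDecode n : (Fin Δ × Fin φ → ℕ) × Z).1 ((f x.1).2, x.2))).comp
        (measurable_pi_apply (f x.1).1)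
  rw [← lintegral_map (f := fun y => g (ext y)) (hg.comp hext) m2, e2, ← e1,
    lintegral_map (f := fun y => g (ext y)) (hg.comp hext) (by fun_prop)]

end SeedCoding

/-! ### Configurations on induced subgraphs -/

section Configurations

variable {O V : Type}

theorem DegreeBounded.finite_neighborSet {D : ℕ} {G : SimpleGraph V} (h : DegreeBounded D G)
    (v : V) : (G.neighborSet v).Finite :=
  Set.finite_of_encard_le_coe (h.2 v)

theorem nbrOutputs_eq {G : SimpleGraph V} {v : V} (h : (G.neighborSet v).Finite)
    (C : V → Option O) : nbrOutputs G C v = h.toFinset.val.filterMap C := by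
  simp [nbrOutputs, h]

theorem Multiset.filterMap_le_filterMap_of_extends {α β : Type*} {f g : α → Option β}
    (s : Multiset α) (h : ∀ a ∈ s, ∀ b, f a = some b → g a = some b) :
    s.filterMap f ≤ s.filterMap g := by
  induction s using Multiset.induction_on with
  | empty => simp
  | cons a s ih =>
    have ih' := ih fun b hb => h b (Multiset.mem_cons_of_mem hb)
    rcases hf : f a with _ | b
    · rw [Multiset.filterMap_cons_none _ _ hf]
      rcases hg : g a with _ | c
      · rwa [Multiset.filterMap_cons_none _ _ hg]
      · rw [Multiset.filterMap_cons_some _ _ _ hg]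
        exact ih'.trans (Multiset.le_cons_self _ _)
    · rw [Multiset.filterMap_cons_some _ _ _ hf,
        Multiset.filterMap_cons_some _ _ _ (h a (Multiset.mem_cons_self _ _) b hf)]
      exact Multiset.cons_le_cons _ ih'

theorem Multiset.filterMap_congr' {α β : Type*} {f g : α → Option β} (s : Multiset α)
    (h : ∀ a ∈ s, f a = g a) : s.filterMap f = s.filterMap g :=
  le_antisymm (filterMap_le_filterMap_of_extends s fun a ha _ hb => h a ha ▸ hb)
    (filterMap_le_filterMap_of_extends s fun a ha _ hb => (h a ha).symm ▸ hb)

theorem nbrOutputs_mono {G : SimpleGraph V} {C C' : V → Option O} {v : V}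
    (h : ∀ w, G.Adj v w → ∀ o, C w = some o → C' w = some o) :
    nbrOutputs G C v ≤ nbrOutputs G C' v := by
  by_cases hf : (G.neighborSet v).Finite
  · rw [nbrOutputs_eq hf, nbrOutputs_eq hf]
    exact Multiset.filterMap_le_filterMap_of_extends _ fun w hw => h w (by simpa using hw)
  · simp [nbrOutputs, hf]

theorem nbrOutputs_congr {G : SimpleGraph V} {C C' : V → Option O} {v : V}
    (h : ∀ w, G.Adj v w → C w = C' w) : nbrOutputs G C v = nbrOutputs G C' v :=
  le_antisymm (nbrOutputs_mono fun w hw _ ho => h w hw ▸ ho)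
    (nbrOutputs_mono fun w hw _ ho => (h w hw).symm ▸ ho)

/-- Removing undecided nodes does not change the visible output values. -/
theorem nbrOutputs_induce {D : ℕ} {G : SimpleGraph V} (hG : DegreeBounded D G) (S : Set V)
    {C : V → Option O} (v : ↥S) (h : ∀ w, w ∉ S → C w = none) :
    nbrOutputs (G.induce S) (fun w : ↥S => C w) v = nbrOutputs G C v := by
  classical
  have hf := hG.finite_neighborSet v
  have hf' : ((G.induce S).neighborSet v).Finite :=
    Set.Finite.of_finite_image (hf.subset (by rintro _ ⟨w, hw, rfl⟩; exact hw))
      Subtype.val_injective.injOn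
  rw [nbrOutputs_eq hf, nbrOutputs_eq hf']
  have h1 : hf'.toFinset.map (Function.Embedding.subtype _) = hf.toFinset.filter (· ∈ S) := by
    ext w
    simp only [Finset.mem_map, Set.Finite.mem_toFinset, SimpleGraph.mem_neighborSet,
      SimpleGraph.comap_adj, Function.Embedding.subtype_apply, Subtype.exists, exists_and_right,
      exists_eq_right, Finset.mem_filter, SimpleGraph.induce]
    constructor
    · rintro ⟨x, hx⟩; exact ⟨hx, x⟩
    · rintro ⟨hx, x⟩; exact ⟨x, hx⟩
  have h2 : hf'.toFinset.val.filterMap (fun w : ↥S => C w) =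
      (hf'.toFinset.map (Function.Embedding.subtype _)).val.filterMap C := by
    rw [Finset.map_val, Multiset.filterMap_map]; rfl
  rw [h2, h1, Finset.filter_val, Multiset.filterMap_filter]
  refine Multiset.filterMap_congr' _ fun w _ => ?_
  by_cases hw : w ∈ S
  · simp [hw]
  · simp [hw, h w hw]

theorem content_iff {P : LCLProblem O} {G : SimpleGraph V} {C : V → Option O} {v : V} {o : O}
    (h : C v = some o) : Content P G C v ↔ P.ok o (nbrOutputs G C v) := by
  constructor
  · rintro ⟨o', ho', hk⟩
    rw [h] at ho'
    exact Option.some.inj ho' ▸ hk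
  · exact fun hk => ⟨o, h, hk⟩

theorem DegreeBounded.induce {D : ℕ} {G : SimpleGraph V} (hG : DegreeBounded D G) (S : Set V) :
    DegreeBounded D (G.induce S) := by
  have := hG.1
  refine ⟨inferInstance, fun v => ?_⟩
  rw [← Subtype.val_injective.encard_image]
  refine le_trans (Set.encard_le_encard ?_) (hG.2 v)
  rintro _ ⟨w, hw, rfl⟩
  exact hw

theorem LCLProblem.HereditaryClosure.induce {P : LCLProblem O} {D : ℕ}
    (hP : P.HereditaryClosure D) {G : SimpleGraph V} (hG : P.Instance D G) (S : Set V) :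
    P.Instance D (G.induce S) := by
  refine ⟨?_, hG.2.induce S⟩
  rw [SimpleGraph.induce_eq_coe_induce_top]
  exact hP V G hG _

end Configurations

/-! ### Phases in which only some of the undecided nodes take part -/

section Pullback

variable {U U' : Type} {H : SimpleGraph U} {H' : SimpleGraph U'}

/-- Transport of a port numbering along an isomorphism. -/
def PortNumbering.pullback (p : PortNumbering H) (f : H' ≃g H) : PortNumbering H' where
  deg x := p.deg (f x)
  port x := (p.port (f x)).trans
    { toFun := fun y => ⟨f.symm y.1, by
        have h : H.Adj (f x) y.1 := y.2
        have := f.symm.map_adj_iff.2 h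
        simpa using this⟩
      invFun := fun y => ⟨f y.1, f.map_adj_iff.2 y.2⟩
      left_inv := fun y => by simp
      right_inv := fun y => by simp }

/-- The message sent by `w` to its neighbor `v`. -/
def PortNumbering.sent {β : Type*} (p : PortNumbering H) (m : ∀ v, Fin (p.deg v) → β)
    (w v : U) (h : H.Adj w v) : β :=
  m w ((p.port w).symm ⟨v, h⟩)

theorem PortNumbering.deliver_pullback (p : PortNumbering H) (f : H' ≃g H)
    (m : ∀ v, Fin (p.deg v) → Option Message) (x : U') :
    (p.pullback f).deliver (fun y => m (f y)) x = p.deliver m (f x) := by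
  funext i
  have key : ∀ (w : U) (w' : U') (hw : f w' = w) (h : H.Adj w (f x)) (h' : H'.Adj w' x),
      (p.pullback f).sent (fun y => m (f y)) w' x h' = p.sent m w (f x) h := by
    rintro _ w' rfl h h'
    rfl
  exact key (p.port (f x) i).1 (f.symm (p.port (f x) i).1) (by simp) _ _

theorem PhaseAlgorithm.working_pullback {O : Type} (A : PhaseAlgorithm O) (p : PortNumbering H)
    (f : H' ≃g H) (r : U → ℕ → ℕ) (j : ℕ) (x : U') :
    A.working (p.pullback f) (fun y => r (f y)) j x = A.working p r j (f x) := by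
  induction j generalizing x with
  | zero => rfl
  | succ j ih =>
    have h := p.deliver_pullback f (fun w => (A.working p r j w).2) x
    simp only [PhaseAlgorithm.working]
    rw [← h]
    simp only [ih]
    rfl

end Pullback

namespace PhaseAlgorithm

variable {O V : Type} (A : PhaseAlgorithm O)

/-- The configuration after a phase in which only the nodes in `W`, a set of undecided nodes, take
part. -/
noncomputable def phaseOn (G : SimpleGraph V) (C : V → Option O) (W : Set V)
    (p : PortNumbering (G.induce W)) (r : V × ℕ → ℕ) : V → Option O :=
  open Classical in
  fun v =>
    if h : v ∈ W then
      A.decision (p.deg ⟨v, h⟩) (A.working p (fun u j => r (u.1, j)) (A.phi - 2) ⟨v, h⟩).1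
        (r (v, A.phi - 1))
        (p.deliver (fun w => (A.working p (fun u j => r (u.1, j)) (A.phi - 2) w).2) ⟨v, h⟩)
        (nbrOutputs G C v)
    else C v

variable {A} {G : SimpleGraph V} {C : V → Option O} {W : Set V} {p : PortNumbering (G.induce W)}

theorem phaseOn_of_notMem {v : V} (h : v ∉ W) (r : V × ℕ → ℕ) : A.phaseOn G C W p r v = C v :=
  dif_neg h

theorem phaseOn_of_decided (hW : ∀ v ∈ W, C v = none) {v : V} {o : O} (h : C v = some o)
    (r : V × ℕ → ℕ) : A.phaseOn G C W p r v = some o := by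
  rw [phaseOn_of_notMem, h]
  intro hv
  simp [hW v hv] at h

/-- The undecided nodes that do not take part. -/
def idle (C : V → Option O) (W : Set V) : Set V := {v | C v = none ∧ v ∉ W}

/-- The participants of the phase are the undecided nodes of the graph without the idle nodes. -/
def participantsIso (G : SimpleGraph V) (hW : ∀ v ∈ W, C v = none) :
    ((G.induce (idle C W)ᶜ).induce {v : ↥(idle C W)ᶜ | C v = none}) ≃g G.induce W where
  toFun x := ⟨x.1.1, by
    by_contra h
    exact x.1.2 ⟨x.2, h⟩⟩
  invFun x := ⟨⟨x.1, fun h => h.2 x.2⟩, hW x.1 x.2⟩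
  left_inv _ := rfl
  right_inv _ := rfl
  map_rel_iff' := Iff.rfl

/-- A phase restricted to the participants `W` is a phase of `A` on the graph without the idle
undecided nodes. Thus the requirements on `A`, which concern phases on subgraphs, apply to it. -/
theorem phase_induce_eq_phaseOn {D : ℕ} (hG : DegreeBounded D G) (hW : ∀ v ∈ W, C v = none)
    (r : V × ℕ → ℕ) (v : ↥(idle C W)ᶜ) :
    A.phase (G.induce (idle C W)ᶜ) (fun v => C v) (p.pullback (participantsIso G hW))
      (fun x => r (x.1, x.2)) v = A.phaseOn G C W p r v := by
  by_cases h : C v = none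
  · have hv : v.1 ∈ W := by
      by_contra h'
      exact v.2 ⟨h, h'⟩
    have hd := p.deliver_pullback (participantsIso G hW)
      (fun w => (A.working p (fun u j => r (u.1, j)) (A.phi - 2) w).2) ⟨v, h⟩
    have hw := A.working_pullback p (participantsIso G hW) (fun u j => r (u.1, j)) (A.phi - 2)
    have hn : nbrOutputs (G.induce (idle C W)ᶜ) (fun v => C v) v = nbrOutputs G C v :=
      nbrOutputs_induce hG _ v fun w hw => by
        have : w ∈ idle C W := by simpa using hw
        exact this.1
    simp only [phase, phaseOn, h, hv, dif_pos]
    rw [hn]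
    have hw' : ∀ x, A.working (p.pullback (participantsIso G hW)) (fun u j => r (u.1.1, j))
        (A.phi - 2) x = A.working p (fun u j => r (u.1, j)) (A.phi - 2)
          (participantsIso G hW x) := hw
    simp only [hw']
    exact congrArg₂ (fun (a : Fin (p.deg ⟨v.1, hv⟩) → Option Message) (b : Multiset O) =>
      A.decision _ (A.working p (fun u j => r (u.1, j)) (A.phi - 2) ⟨v.1, hv⟩).1
        (r (v, A.phi - 1)) a b) hd rfl
  · have hv : v.1 ∉ W := fun h' => h (hW _ h')
    simp only [phase, phaseOn, h, hv, dif_neg, not_false_iff]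

/-! #### Dependence on the coins -/

theorem finiteDep_working (j : ℕ) (u : ↥W) :
    FiniteDep fun r : V × ℕ → ℕ => A.working p (fun u j => r (u.1, j)) j u := by
  induction j generalizing u with
  | zero => exact FiniteDep.const _
  | succ j ih =>
    have h1 : FiniteDep fun r : V × ℕ → ℕ =>
        p.deliver (fun w => (A.working p (fun u j => r (u.1, j)) j w).2) u :=
      FiniteDep.pi (f := fun i r => p.deliver
        (fun w => (A.working p (fun u j => r (u.1, j)) j w).2) u i)
        fun i => (ih (p.port u i).1).map fun x => x.2 ((p.port (p.port u i).1).symm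
          ⟨u, (p.port u i).2.symm⟩)
    exact (((ih u).prodMk h1).prodMk (FiniteDep.eval (u.1, j + 1))).map fun x =>
      A.work (j + 1) (p.deg u) x.1.1.1 x.2 x.1.2

theorem finiteDep_phaseOn (v : V) : FiniteDep fun r => A.phaseOn G C W p r v := by
  by_cases h : v ∈ W
  · simp only [phaseOn, h, dif_pos]
    have h1 : FiniteDep fun r : V × ℕ → ℕ => p.deliver
        (fun w => (A.working p (fun u j => r (u.1, j)) (A.phi - 2) w).2) ⟨v, h⟩ :=
      FiniteDep.pi (f := fun i r => p.deliver
        (fun w => (A.working p (fun u j => r (u.1, j)) (A.phi - 2) w).2) ⟨v, h⟩ i)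
        fun i => (finiteDep_working (A.phi - 2) (p.port ⟨v, h⟩ i).1).map fun x =>
          x.2 ((p.port (p.port ⟨v, h⟩ i).1).symm ⟨⟨v, h⟩, (p.port ⟨v, h⟩ i).2.symm⟩)
    exact (((finiteDep_working (A.phi - 2) ⟨v, h⟩).prodMk h1).prodMk
      (FiniteDep.eval (v, A.phi - 1))).map fun x =>
        A.decision (p.deg ⟨v, h⟩) x.1.1.1 x.2 x.1.2 (nbrOutputs G C v)
  · simp only [phaseOn, h, dif_neg, not_false_iff]
    exact FiniteDep.const _

theorem working_congr {r r' : V × ℕ → ℕ} {j : ℕ}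
    (h : ∀ x : V × ℕ, x.2 ≤ j → r x = r' x) (u : ↥W) :
    A.working p (fun u j => r (u.1, j)) j u = A.working p (fun u j => r' (u.1, j)) j u := by
  induction j generalizing u with
  | zero => rfl
  | succ j ih =>
    have ih' := ih fun x hx => h x (by omega)
    simp only [working, ih', h (u.1, j + 1) le_rfl]

theorem dependsOn_phaseOn : DependsOn (A.phaseOn G C W p) {x | x.2 < A.phi} := by
  intro r r' h
  have h2 := A.two_le_phi
  funext v
  have hw := working_congr (A := A) (p := p) (r := r) (r' := r') (j := A.phi - 2)
    fun x hx => h x (by show x.2 < A.phi; omega)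
  have hl : r (v, A.phi - 1) = r' (v, A.phi - 1) := h _ (by show A.phi - 1 < A.phi; omega)
  by_cases hv : v ∈ W
  · simp only [phaseOn, hv, dif_pos, hw, hl]
  · simp only [phaseOn, hv, dif_neg, not_false_iff]

end PhaseAlgorithm

theorem FiniteDep.nbrOutputs {O V ι : Type} {D : ℕ} {G : SimpleGraph V} (hG : DegreeBounded D G)
    {C : (ι → ℕ) → V → Option O} (hC : ∀ v, FiniteDep fun r => C r v) (v : V) :
    FiniteDep fun r => nbrOutputs G (C r) v := by
  have hf := hG.finite_neighborSet v
  have := hf.to_subtype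
  have h1 : FiniteDep fun r (w : ↥(G.neighborSet v)) => C r w := FiniteDep.pi fun w => hC w.1
  obtain ⟨s, hs⟩ := h1
  refine ⟨s, fun x y h => nbrOutputs_congr fun w hw => ?_⟩
  exact congrFun (hs h) ⟨w, hw⟩

theorem FiniteDep.content {O V ι : Type} {D : ℕ} {G : SimpleGraph V} (hG : DegreeBounded D G)
    {C : (ι → ℕ) → V → Option O} (hC : ∀ v, FiniteDep fun r => C r v) (P : LCLProblem O) (v : V) :
    FiniteDep fun r => Content P G (C r) v :=
  ((hC v).prodMk (FiniteDep.nbrOutputs hG hC v)).map fun x => ∃ o, x.1 = some o ∧ P.ok o x.2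

namespace PhaseAlgorithm

variable {O V : Type} {A : PhaseAlgorithm O} {P : LCLProblem O} {D : ℕ}
  {G : SimpleGraph V} {C : V → Option O} {W : Set V} {p : PortNumbering (G.induce W)}

theorem map_coins_induce (A : PhaseAlgorithm O) (S : Set V) :
    (A.coins V).map (fun r (x : ↥S × ℕ) => r (x.1, x.2)) = A.coins ↥S := by
  refine Measure.map_infinitePi_infinitePi_of_inj
    (f := fun x : ↥S × ℕ => ((x.1 : V), x.2)) (P := fun _ : V × ℕ => A.coin.toMeasure) ?_
  rintro ⟨a, i⟩ ⟨b, j⟩ h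
  simp only [Prod.mk.injEq] at h
  exact Prod.ext (Subtype.ext h.1) h.2

theorem content_phaseOn_iff (hG : DegreeBounded D G) (hW : ∀ v ∈ W, C v = none) (r : V × ℕ → ℕ)
    (v : ↥(idle C W)ᶜ) :
    Content P (G.induce (idle C W)ᶜ) (A.phase (G.induce (idle C W)ᶜ) (fun v => C v)
      (p.pullback (participantsIso G hW)) (fun x => r (x.1, x.2))) v ↔
    Content P G (A.phaseOn G C W p r) v := by
  have h : A.phase (G.induce (idle C W)ᶜ) (fun v => C v)
      (p.pullback (participantsIso G hW)) (fun x => r (x.1, x.2)) =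
      fun v : ↥(idle C W)ᶜ => A.phaseOn G C W p r v :=
    funext fun v => phase_induce_eq_phaseOn hG hW r v
  rw [h]
  unfold _root_.Content
  rw [nbrOutputs_induce hG]
  intro w hw
  have : w ∈ idle C W := by simpa using hw
  rw [phaseOn_of_notMem this.2, this.1]

/-- Respectful decisions, for every possible outcome of the coins. -/
theorem RespectfulDecisions.content_phaseOn (hA : A.RespectfulDecisions P D)
    (hG : P.Instance D G) (hW : ∀ v ∈ W, C v = none) {r : V × ℕ → ℕ}
    (hr : ∀ x, r x ∈ A.coin.support) (v : V)
    (hv : Content P G C v ∨ (v ∈ W ∧ A.phaseOn G C W p r v ≠ none)) :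
    Content P G (A.phaseOn G C W p r) v := by
  have hae := hA V G hG C (idle C W) (fun v hv => hv.1) (p.pullback (participantsIso G hW))
  rw [← map_coins_induce A (idle C W)ᶜ] at hae
  have hae' := ae_of_ae_map (Measurable.aemeasurable (by fun_prop)) hae
  have hvX : v ∈ (idle C W)ᶜ := by
    rintro ⟨h1, h2⟩
    rcases hv with ⟨o, ho, -⟩ | hv
    · simp [h1] at ho
    · exact h2 hv.1
  have hdep : ∀ v, FiniteDep fun r => A.phaseOn G C W p r v := fun v => finiteDep_phaseOn v
  have hQ : FiniteDep fun r : V × ℕ → ℕ =>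
      ((Content P G C v ∨ (v ∈ W ∧ A.phaseOn G C W p r v ≠ none)) →
        Content P G (A.phaseOn G C W p r) v) :=
    ((hdep v).prodMk (FiniteDep.content hG.2 hdep P v)).map fun x =>
      ((Content P G C v ∨ (v ∈ W ∧ x.1 ≠ none)) → x.2)
  refine hQ.forall_of_ae (p := A.coin) ?_ r hr hv
  filter_upwards [hae'] with r hr hv
  have hiff := content_phaseOn_iff (P := P) (A := A) (p := p) hG.2 hW r ⟨v, hvX⟩
  rw [← hiff]
  rcases hv with hv | hv
  · exact hr.1 ⟨v, hvX⟩ hv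
  · refine hr.2 ⟨v, hvX⟩ (hW v hv.1) ?_
    rw [phase_induce_eq_phaseOn hG.2 hW r ⟨v, hvX⟩]
    exact hv.2

end PhaseAlgorithm

/-! ### Progress of a phase with few participants -/

namespace PotentialCoefficients

variable {O V : Type} (S : PotentialCoefficients O) {G : SimpleGraph V} {C C' : V → Option O}

open Classical in
theorem pair_mk (G : SimpleGraph V) (C : V → Option O) (u v : V) :
    S.pair G C s(u, v) = if C u = none ∧ C v = none then
      (S.sigma (nbrOutputs G C u) (nbrOutputs G C v) : ℝ≥0∞) else 0 := by
  simp [pair]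

theorem pair_eq_zero (S : PotentialCoefficients O) {e : Sym2 V} {v : V} (hv : v ∈ e)
    (h : C v ≠ none) : S.pair G C e = 0 := by
  classical
  induction e with
  | h a b =>
    rw [pair_mk]
    rw [Sym2.mem_iff] at hv
    rcases hv with rfl | rfl <;> simp [h]

/-- Pairs only lose potential when more nodes become decided. -/
theorem pair_anti (h : ∀ v o, C v = some o → C' v = some o) (e : Sym2 V) :
    S.pair G C' e ≤ S.pair G C e := by
  classical
  induction e with
  | h a b =>
    rw [pair_mk, pair_mk]
    by_cases h' : C' a = none ∧ C' b = none
    · have hn : ∀ v, C' v = none → C v = none := by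
        intro v hv
        rcases hc : C v with _ | o
        · rfl
        · rw [h v o hc] at hv; cases hv
      rw [if_pos h', if_pos ⟨hn a h'.1, hn b h'.2⟩]
      exact_mod_cast S.anti _ _ _ _ (nbrOutputs_mono fun w _ => h w)
        (nbrOutputs_mono fun w _ => h w)
    · rw [if_neg h']; exact zero_le

theorem potential_anti (h : ∀ v o, C v = some o → C' v = some o) :
    S.potential G C' ≤ S.potential G C :=
  ENNReal.tsum_le_tsum fun e => S.pair_anti h e

theorem pair_induce {D : ℕ} (hG : DegreeBounded D G) {X : Set V} (h : ∀ w, w ∉ X → C w = none)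
    (e : Sym2 ↥X) :
    S.pair (G.induce X) (fun v => C v) e = S.pair G C (e.map Subtype.val) := by
  classical
  induction e with
  | h a b =>
    rw [Sym2.map_mk, pair_mk, pair_mk, nbrOutputs_induce hG _ _ h, nbrOutputs_induce hG _ _ h]

open Classical in
/-- The part of the potential that is due to pairs of nodes in `W`. -/
noncomputable def potentialOn (G : SimpleGraph V) (C : V → Option O) (W : Set V) : ℝ≥0∞ :=
  ∑' e : G.edgeSet, if ∀ v ∈ (e : Sym2 V), v ∈ W then S.pair G C e else 0

theorem _root_.FiniteDep.pair {ι : Type} {D : ℕ} (hG : DegreeBounded D G)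
    {C : (ι → ℕ) → V → Option O} (hC : ∀ v, FiniteDep fun r => C r v) (e : Sym2 V) :
    FiniteDep fun r => S.pair G (C r) e := by
  classical
  induction e with
  | h a b =>
    simp only [pair_mk]
    exact ((((hC a).prodMk (FiniteDep.nbrOutputs hG hC a)).prodMk (hC b)).prodMk
      (FiniteDep.nbrOutputs hG hC b)).map fun x =>
        if x.1.1.1 = none ∧ x.1.2 = none then (S.sigma x.1.1.2 x.2 : ℝ≥0∞) else 0

theorem measurable_potential {ι : Type} {D : ℕ} (hG : DegreeBounded D G)
    {C : (ι → ℕ) → V → Option O} (hC : ∀ v, FiniteDep fun r => C r v) :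
    Measurable fun r => S.potential G (C r) := by
  have := hG.1
  have : Countable G.edgeSet := by
    have : Countable (Sym2 V) := by unfold Sym2; infer_instance
    infer_instance
  exact Measurable.tsum fun e => (FiniteDep.pair S hG hC e).measurable

end PotentialCoefficients

section InducedEdges

variable {V : Type} {G : SimpleGraph V}

/-- The edges of an induced subgraph as edges of the graph. -/
def inducedEdge (X : Set V) (e : (G.induce X).edgeSet) : G.edgeSet :=
  ⟨(e : Sym2 ↥X).map Subtype.val, by
    obtain ⟨e, he⟩ := e
    induction e with
    | h a b => exact he⟩

theorem inducedEdge_injective (X : Set V) :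
    Function.Injective (inducedEdge (G := G) X) := by
  intro e f h
  exact Subtype.ext (Sym2.map.injective Subtype.val_injective (congrArg Subtype.val h))

theorem exists_inducedEdge {X : Set V} {e : G.edgeSet} (h : ∀ v ∈ (e : Sym2 V), v ∈ X) :
    ∃ e', inducedEdge X e' = e := by
  obtain ⟨e, he⟩ := e
  induction e with
  | h a b =>
    exact ⟨⟨s(⟨a, h a (by simp)⟩, ⟨b, h b (by simp)⟩), he⟩, rfl⟩

end InducedEdges

namespace PhaseAlgorithm

variable {O V : Type} {A : PhaseAlgorithm O} {P : LCLProblem O} {D σ₀ : ℕ} {β : ℝ}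
  {G : SimpleGraph V} {C : V → Option O} {W : Set V} {p : PortNumbering (G.induce W)}

theorem phase_eq_phaseOn (p : PortNumbering (G.induce {v | C v = none})) (r : V × ℕ → ℕ) :
    A.phase G C p r = A.phaseOn G C {v | C v = none} p r := by
  funext v
  by_cases h : C v = none
  · have h' : v ∈ {v | C v = none} := h
    simp only [phase, phaseOn, h, h', dif_pos]
  · have h' : v ∉ {v | C v = none} := h
    simp only [phase, phaseOn, h, h', dif_neg, not_false_iff]

open Classical in
/-- The pairs of undecided nodes that do not both participate have at most their old contribution
to the potential, as `sigma` is non-increasing; the others are accounted for by a full phase on the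
graph without the idle nodes. -/
theorem potential_phaseOn_le (S : PotentialCoefficients O) (hG : DegreeBounded D G)
    (hW : ∀ v ∈ W, C v = none) (r : V × ℕ → ℕ) :
    S.potential G (A.phaseOn G C W p r) ≤
      (∑' e : G.edgeSet, if ∀ v ∈ (e : Sym2 V), v ∈ W then 0 else S.pair G C e) +
      S.potential (G.induce (idle C W)ᶜ) (A.phase (G.induce (idle C W)ᶜ) (fun v => C v)
        (p.pullback (participantsIso G hW)) (fun x => r (x.1, x.2))) := by
  set F : G.edgeSet → ℝ≥0∞ := fun e =>
    if ∀ v ∈ (e : Sym2 V), v ∈ W then S.pair G (A.phaseOn G C W p r) e else 0 with hF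
  have h1 : S.potential G (A.phaseOn G C W p r) ≤
      ∑' e : G.edgeSet, ((if ∀ v ∈ (e : Sym2 V), v ∈ W then 0 else S.pair G C e) + F e) := by
    refine ENNReal.tsum_le_tsum fun e => ?_
    by_cases he : ∀ v ∈ (e : Sym2 V), v ∈ W
    · simp only [hF]
      rw [if_pos he, if_pos he, zero_add]
    · simp only [hF, if_neg he, add_zero]
      exact S.pair_anti (fun _ _ h => phaseOn_of_decided hW h r) (e : Sym2 V)
  refine h1.trans ?_
  rw [ENNReal.tsum_add]
  gcongr
  have h2 : A.phase (G.induce (idle C W)ᶜ) (fun v => C v)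
      (p.pullback (participantsIso G hW)) (fun x => r (x.1, x.2)) =
      fun v : ↥(idle C W)ᶜ => A.phaseOn G C W p r v :=
    funext fun v => phase_induce_eq_phaseOn hG hW r v
  rw [h2, PotentialCoefficients.potential]
  have hsupp : Function.support F ⊆ Set.range (inducedEdge (idle C W)ᶜ) := by
    intro e he
    have he' : ∀ v ∈ (e : Sym2 V), v ∈ W := by
      by_contra hn
      exact he (by simp only [hF]; rw [if_neg hn])
    exact exists_inducedEdge fun v hv hvi => hvi.2 (he' v hv)
  rw [← Function.Injective.tsum_eq (inducedEdge_injective _) hsupp]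
  refine ENNReal.tsum_le_tsum fun e => ?_
  rw [S.pair_induce hG]
  · simp only [hF]
    split_ifs
    · exact le_rfl
    · exact zero_le
  · intro w hw
    have : w ∈ idle C W := by simpa using hw
    rw [phaseOn_of_notMem this.2, this.1]

theorem potential_induce_le (S : PotentialCoefficients O) (hG : DegreeBounded D G) :
    S.potential (G.induce (idle C W)ᶜ) (fun v => C v) ≤ S.potentialOn G C W := by
  classical
  refine le_trans (ENNReal.tsum_le_tsum fun e => ?_)
    (ENNReal.tsum_comp_le_tsum_of_injective (inducedEdge_injective (idle C W)ᶜ) _)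
  rw [S.pair_induce hG]
  · change S.pair G C (inducedEdge (idle C W)ᶜ e : Sym2 V) ≤ _
    split_ifs with h
    · exact le_rfl
    · push Not at h
      obtain ⟨v, hv, hvW⟩ := h
      rw [S.pair_eq_zero hv]
      intro hn
      have hm : v ∈ ((e : Sym2 ↥(idle C W)ᶜ).map Subtype.val) := hv
      rw [Sym2.mem_map] at hm
      obtain ⟨a, -, rfl⟩ := hm
      exact a.2 ⟨hn, hvW⟩
  · intro w hw
    have : w ∈ idle C W := by simpa using hw
    exact this.1

theorem strong_induce (hG : DegreeBounded D G) (hC : Strong P G C) :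
    Strong P (G.induce (idle C W)ᶜ) (fun v => C v) := by
  intro v hv
  obtain ⟨o, ho, hk⟩ := hC v hv
  refine ⟨o, ho, ?_⟩
  rwa [nbrOutputs_induce hG]
  intro w hw
  have : w ∈ idle C W := by simpa using hw
  exact this.1

/-- The progress guarantee of a phase, spelled out for some coefficients. -/
def ProgressWith (A : PhaseAlgorithm O) (P : LCLProblem O) (D : ℕ) (β : ℝ)
    (S : PotentialCoefficients O) : Prop :=
  ∀ (V : Type) (G : SimpleGraph V), P.Instance D G → ∀ C : V → Option O, Strong P G C →
    ∀ p : PortNumbering (G.induce {v | C v = none}),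
      ∫⁻ r, S.potential G (A.phase G C p r) ∂A.coins V
          ≤ ENNReal.ofReal (1 - β) * S.potential G C ∧
      (S.potential G C = 0 → ∀ᵐ r ∂A.coins V, ∀ v, A.phase G C p r v ≠ none)

/-- If only the nodes in `W` take part in a phase, then the pairs in `W` lose the fraction `β` of
their potential in expectation. -/
theorem ProgressWith.lintegral_potential_phaseOn {S : PotentialCoefficients O}
    (hS : A.ProgressWith P D β S) (h0 : 0 < β) (h1 : β < 1) (hP : P.HereditaryClosure D)
    (hG : P.Instance D G) (hC : Strong P G C) (hW : ∀ v ∈ W, C v = none) :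
    ∫⁻ r, S.potential G (A.phaseOn G C W p r) ∂A.coins V +
      ENNReal.ofReal β * S.potentialOn G C W ≤ S.potential G C := by
  classical
  have hI := hP.induce hG (idle C W)ᶜ
  set R : ℝ≥0∞ := ∑' e : G.edgeSet, if ∀ v ∈ (e : Sym2 V), v ∈ W then 0 else S.pair G C e with hR
  have hsum : R + S.potentialOn G C W = S.potential G C := by
    rw [hR, PotentialCoefficients.potentialOn, ← ENNReal.tsum_add]
    refine tsum_congr fun e => ?_
    split_ifs <;> simp
  set g : (↥(idle C W)ᶜ × ℕ → ℕ) → ℝ≥0∞ := fun r => S.potential (G.induce (idle C W)ᶜ)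
    (A.phase (G.induce (idle C W)ᶜ) (fun v => C v) (p.pullback (participantsIso G hW)) r) with hg
  have hgm : Measurable g := by
    refine S.measurable_potential hI.2 (fun v => ?_)
    have h := finiteDep_phaseOn (A := A) (G := G.induce (idle C W)ᶜ)
      (C := fun v : ↥(idle C W)ᶜ => C v) (W := {v | C v = none})
      (p := p.pullback (participantsIso G hW)) v
    simpa only [phase_eq_phaseOn] using h
  have hb : ENNReal.ofReal (1 - β) + ENNReal.ofReal β = 1 := by
    rw [← ENNReal.ofReal_add (by linarith) h0.le]; simp
  calc ∫⁻ r, S.potential G (A.phaseOn G C W p r) ∂A.coins V +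
        ENNReal.ofReal β * S.potentialOn G C W
      ≤ ∫⁻ r, (R + g (fun x => r (x.1, x.2))) ∂A.coins V +
        ENNReal.ofReal β * S.potentialOn G C W := by
        gcongr with r
        exact potential_phaseOn_le S hG.2 hW r
    _ = R + ∫⁻ r, g r ∂A.coins ↥(idle C W)ᶜ + ENNReal.ofReal β * S.potentialOn G C W := by
        rw [← map_coins_induce A (idle C W)ᶜ, lintegral_map hgm (by fun_prop), lintegral_add_left
          measurable_const]
        have : IsProbabilityMeasure (A.coins V) := by unfold coins; infer_instance
        simp
    _ ≤ R + ENNReal.ofReal (1 - β) * S.potentialOn G C W +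
          ENNReal.ofReal β * S.potentialOn G C W := by
        gcongr
        refine ((hS _ _ hI _ (strong_induce hG.2 hC) _).1).trans ?_
        gcongr
        exact potential_induce_le S hG.2
    _ = S.potential G C := by
        rw [add_assoc, ← add_mul, hb, one_mul, hsum]

/-- Without potential every participant decides, whatever the coins. -/
theorem ProgressWith.phaseOn_ne_none {S : PotentialCoefficients O}
    (hS : A.ProgressWith P D β S) (hP : P.HereditaryClosure D)
    (hG : P.Instance D G) (hC : Strong P G C) (hW : ∀ v ∈ W, C v = none)
    (h0 : S.potential G C = 0) {r : V × ℕ → ℕ} (hr : ∀ x, r x ∈ A.coin.support) {v : V}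
    (hv : v ∈ W) : A.phaseOn G C W p r v ≠ none := by
  have hI := hP.induce hG (idle C W)ᶜ
  have hz : S.potential (G.induce (idle C W)ᶜ) (fun v => C v) = 0 := by
    refine le_antisymm ((potential_induce_le S hG.2).trans (le_trans ?_ h0.le)) zero_le
    classical
    refine ENNReal.tsum_le_tsum fun e => ?_
    split_ifs
    · exact le_rfl
    · exact zero_le
  have hae := (hS _ _ hI _ (strong_induce hG.2 hC) (p.pullback (participantsIso G hW))).2 hz
  rw [← map_coins_induce A (idle C W)ᶜ] at hae
  have hae' := ae_of_ae_map (Measurable.aemeasurable (by fun_prop)) hae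
  have hQ : FiniteDep fun r : V × ℕ → ℕ => A.phaseOn G C W p r v ≠ none :=
    (finiteDep_phaseOn v).map (· ≠ none)
  refine hQ.forall_of_ae (p := A.coin) ?_ r hr
  filter_upwards [hae'] with r hr
  have h := hr ⟨v, fun h => h.2 hv⟩
  rwa [phase_induce_eq_phaseOn hG.2 hW r ⟨v, fun h => h.2 hv⟩] at h

/-- Only the coins of the steps of the phase matter. -/
theorem exists_phaseOn_eq {r : V × ℕ → ℕ} (hr : ∀ v, ∀ j < A.phi, r (v, j) ∈ A.coin.support) :
    ∃ r', (∀ x, r' x ∈ A.coin.support) ∧ A.phaseOn G C W p r' = A.phaseOn G C W p r := by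
  classical
  obtain ⟨a, ha⟩ := A.coin.support_nonempty
  refine ⟨fun x => if x.2 < A.phi then r x else a, fun x => ?_, dependsOn_phaseOn fun x hx => ?_⟩
  · dsimp only
    split_ifs with h
    · exact hr x.1 x.2 h
    · exact ha
  · exact if_pos hx

end PhaseAlgorithm

/-! ### What a node tells its neighbors -/

/-- What a node tells a neighbor about its state: its degree, the port of the neighbor, its output
registers, the ports that take part in its phase, whether it is about to start a phase, whether it
is about to take the decisions of a phase, its role in the phase, its tentative decision for the
common edge and a list of messages of simulated edges. -/
structure Summary (O : Type) where
  deg : ℕ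
  idx : Fin deg
  outs : Fin deg → Option O
  part : Fin deg → Bool
  start : Bool
  hold : Bool
  bit : Bool
  dec : Option O
  box : List (Option Message)

instance {O : Type} : Inhabited (Summary O) :=
  ⟨⟨1, 0, fun _ => none, fun _ => false, false, false, false, none, []⟩⟩

section Encoding

/-- A self-delimiting code for "a message or nothing". -/
def encodeItem : Option Message → Message
  | none => [false, false]
  | some m => m.flatMap (fun b => [true, b]) ++ [false, true]

theorem encodeItem_append_inj {x y : Option Message} {s t : Message}
    (h : encodeItem x ++ s = encodeItem y ++ t) : x = y ∧ s = t := by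
  have key : ∀ (m m' : Message), encodeItem (some m) ++ s = encodeItem (some m') ++ t →
      m = m' ∧ s = t := by
    intro m
    induction m with
    | nil =>
      rintro (_ | ⟨b, m'⟩) h
      · simpa [encodeItem] using h
      · simp [encodeItem] at h
    | cons a m ih =>
      rintro (_ | ⟨b, m'⟩) h
      · simp [encodeItem] at h
      · simp only [encodeItem, List.flatMap_cons, List.cons_append, List.nil_append,
          List.cons.injEq, true_and] at h
        have := ih m' h.2
        exact ⟨by rw [h.1, this.1], this.2⟩
  rcases x with _ | x <;> rcases y with _ | y
  · simpa [encodeItem] using h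
  · rcases y with _ | ⟨b, y⟩ <;> simp [encodeItem] at h
  · rcases x with _ | ⟨b, x⟩ <;> simp [encodeItem] at h
  · have := key x y h
    exact ⟨by rw [this.1], this.2⟩

theorem length_encodeItem (x : Option Message) (b : ℕ) (h : ∀ m, x = some m → m.length ≤ b) :
    (encodeItem x).length ≤ 2 * b + 2 := by
  rcases x with _ | m
  · simp [encodeItem]
  · have := h m rfl
    simp [encodeItem]
    omega

/-- A self-delimiting code for lists: the codes of the items are self-delimiting. -/
def encodeList (l : List (Option Message)) : Message := l.flatMap encodeItem

theorem encodeList_injective : Function.Injective encodeList := by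
  intro l
  induction l with
  | nil =>
    rintro (_ | ⟨y, l'⟩) h
    · rfl
    · rcases y with _ | ⟨_ | ⟨b, y⟩⟩ <;> simp [encodeList, encodeItem] at h
  | cons x l ih =>
    rintro (_ | ⟨y, l'⟩) h
    · rcases x with _ | ⟨_ | ⟨b, x⟩⟩ <;> simp [encodeList, encodeItem] at h
    · simp only [encodeList, List.flatMap_cons] at h
      have h' := encodeItem_append_inj h
      rw [h'.1, ih h'.2]

theorem length_encodeList_append (l l' : List (Option Message)) :
    (encodeList (l ++ l')).length = (encodeList l).length + (encodeList l').length := by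
  simp [encodeList]

theorem length_encodeList_le (l : List (Option Message)) (b : ℕ)
    (h : ∀ x ∈ l, ∀ m, x = some m → m.length ≤ b) :
    (encodeList l).length ≤ l.length * (2 * b + 2) := by
  induction l with
  | nil => simp [encodeList]
  | cons x l ih =>
    have h1 := length_encodeItem x b (h x (by simp))
    have h2 := ih fun y hy => h y (by simp [hy])
    simp only [encodeList, List.flatMap_cons, List.length_append, List.length_cons] at h2 ⊢
    rw [Nat.add_mul, one_mul]
    omega

end Encoding

namespace Summary

variable {O : Type} (A : PhaseAlgorithm O)

/-- The header of the encoding of a summary; it determines the degree. -/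
def header (S : Summary O) : List (Option Message) :=
  [some (List.replicate S.deg true), some (List.replicate S.idx true),
    some [S.start, S.hold, S.bit], some (A.announce S.dec), some (List.ofFn S.part)]

/-- The message that conveys a summary. -/
def encode (S : Summary O) : Message :=
  encodeList (S.header A ++ ((List.ofFn S.outs).map fun o => some (A.announce o)) ++ S.box)

theorem encode_injective : Function.Injective (encode A) := by
  rintro ⟨d, i, os, pt, s, h, b, c, bx⟩ ⟨d', i', os', pt', s', h', b', c', bx'⟩ he
  have he := encodeList_injective he
  simp only [header, List.cons_append, List.nil_append, List.cons.injEq, Option.some.injEq] at he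
  obtain ⟨h1, h2, h3, h4, h5, h6⟩ := he
  have hd : d = d' := by simpa using congrArg List.length h1
  subst hd
  have hi : i = i' := Fin.ext (by simpa using congrArg List.length h2)
  have hc := A.announce_injective h4
  have hp := List.ofFn_injective h5
  have ho := List.append_inj h6 (by simp)
  have hos : os = os' := List.ofFn_injective <| List.map_injective_iff.2
    (fun a b hab => A.announce_injective (Option.some.inj hab)) ho.1
  simp at h3
  simp [hi, hc, hp, hos, ho.2, h3]

open Classical in
/-- The summary that a received message stands for. -/
noncomputable def decode (m : Option Message) : Summary O :=
  if h : ∃ S : Summary O, m = some (S.encode A) then h.choose else default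

theorem decode_encode (S : Summary O) : decode A (some (S.encode A)) = S := by
  have h : ∃ S' : Summary O, some (S.encode A) = some (S'.encode A) := ⟨S, rfl⟩
  rw [decode, dif_pos h]
  exact (encode_injective A (Option.some.inj h.choose_spec)).symm

/-- The degree and the port are told in unary and there are at most `Δ` items of at most `b` bits
in the list `box`, so that the length of a summary is linear in `Δ` times `b + 1`. -/
theorem length_encode_le {S : Summary O} {Δ b : ℕ} (hΔ : 0 < Δ) (hd : S.deg ≤ Δ)
    (hA : ∀ o, (A.announce o).length ≤ b) (hl : S.box.length ≤ Δ)
    (hb : ∀ x ∈ S.box, ∀ m, x = some m → m.length ≤ b) :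
    (S.encode A).length ≤ 26 * (Δ * (1 + b)) := by
  have hi := S.idx.2
  have h1 : (encodeList (S.header A)).length ≤ 6 * Δ + 2 * b + 16 := by
    have h3 := length_encodeItem (some (A.announce S.dec)) b (by rintro m ⟨⟩; exact hA _)
    have h4 := length_encodeItem (some (List.replicate S.deg true)) Δ (by rintro m ⟨⟩; simpa)
    have h5 := length_encodeItem (some (List.replicate S.idx true)) Δ
      (by rintro m ⟨⟩; simp; omega)
    have h6 := length_encodeItem (some (List.ofFn S.part)) Δ (by rintro m ⟨⟩; simpa)
    have h7 := length_encodeItem (some [S.start, S.hold, S.bit]) 3 (by rintro m ⟨⟩; simp)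
    simp only [header, encodeList, List.flatMap_cons, List.length_append, List.flatMap_nil,
      List.length_nil]
    omega
  have h2 := length_encodeList_le ((List.ofFn S.outs).map fun o => some (A.announce o)) b (by
    simp only [List.mem_map]
    rintro _ ⟨o, -, rfl⟩ m ⟨⟩
    exact hA o)
  have h3 := length_encodeList_le S.box b hb
  simp only [List.length_map, List.length_ofFn] at h2
  rw [encode, length_encodeList_append, length_encodeList_append]
  have h4 : S.deg * (2 * b + 2) ≤ Δ * (2 * b + 2) := Nat.mul_le_mul_right _ hd
  have h5 : S.box.length * (2 * b + 2) ≤ Δ * (2 * b + 2) := Nat.mul_le_mul_right _ hl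
  nlinarith

end Summary

/-! ### The neighbors of a simulated edge -/

/-- The participating edges that are adjacent to a given edge: those at its first endpoint, where
the edge has port `i`, and those at its second endpoint, where it has port `i'`. -/
abbrev Slots {d d' : ℕ} (a : Fin d → Prop) (i : Fin d) (a' : Fin d' → Prop) (i' : Fin d') : Type :=
  {q : Fin d // a q ∧ q ≠ i} ⊕ {q : Fin d' // a' q ∧ q ≠ i'}

section Slots

variable {d d' : ℕ} (a : Fin d → Prop) (i : Fin d) (a' : Fin d' → Prop) (i' : Fin d')

noncomputable instance : Fintype (Slots a i a' i') := by
  classical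
  exact inferInstanceAs (Fintype (_ ⊕ _))

/-- The degree of a simulated edge in the line graph of the participating edges. -/
noncomputable def slotCard : ℕ := Fintype.card (Slots a i a' i')

/-- The ports of a simulated edge. -/
noncomputable def slotEquiv : Slots a i a' i' ≃ Fin (slotCard a i a' i') :=
  Fintype.equivFin _

/-- The messages that a simulated edge receives, given the last messages of the adjacent edges at
its first and second endpoint. -/
noncomputable def slotInbox (x : Fin d → Option Message) (y : Fin d' → Option Message) :
    Fin (slotCard a i a' i') → Option Message := fun k =>
  match (slotEquiv a i a' i').symm k with
  | Sum.inl q => x q.1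
  | Sum.inr q => y q.1

open Classical in
/-- The messages for the adjacent edges at the first endpoint, by their ports. -/
noncomputable def slotOutFst (m : Fin (slotCard a i a' i') → Option Message) (q : Fin d) :
    Option Message :=
  if h : a q ∧ q ≠ i then m (slotEquiv a i a' i' (Sum.inl ⟨q, h⟩)) else none

open Classical in
/-- The messages for the adjacent edges at the second endpoint, by their ports. -/
noncomputable def slotOutSnd (m : Fin (slotCard a i a' i') → Option Message) (q : Fin d') :
    Option Message :=
  if h : a' q ∧ q ≠ i' then m (slotEquiv a i a' i' (Sum.inr ⟨q, h⟩)) else none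

variable {O : Type} (A : PhaseAlgorithm O)

/-- A working step of a simulated edge: its new state and its messages for the adjacent edges at
its first and second endpoint. -/
noncomputable def simWork (j : ℕ) (st : A.State) (c : ℕ) (x : Fin d → Option Message)
    (y : Fin d' → Option Message) :
    A.State × (Fin d → Option Message) × (Fin d' → Option Message) :=
  ((A.work j (slotCard a i a' i') st c (slotInbox a i a' i' x y)).1,
    slotOutFst a i a' i' (A.work j (slotCard a i a' i') st c (slotInbox a i a' i' x y)).2,
    slotOutSnd a i a' i' (A.work j (slotCard a i a' i') st c (slotInbox a i a' i' x y)).2)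

/-- The decision of a simulated edge. -/
noncomputable def simDecision (st : A.State) (c : ℕ) (x : Fin d → Option Message)
    (y : Fin d' → Option Message) (M : Multiset O) : Option O :=
  A.decision (slotCard a i a' i') st c (slotInbox a i a' i' x y) M

end Slots

/-! ### The algorithm for the edge problem -/

/-- The registers of a node of degree `d`, besides its output registers. The counter `ctr` runs
cyclically; in each cycle the node starts one phase, when the counter exceeds the random offset
`off` by one. If `bit` is `true` in this phase, then the node simulates its participating edges
(the ports in `part`), and otherwise it forwards messages between them. `st i` is the state of the
edge at port `i`, `loc i q` is its last message to the edge at port `q`, `box i` is the list of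
messages for the other endpoint, and `dec i` is its tentative output. `seed` holds the coins for
the whole phase. -/
structure EdgeRegs {O : Type} (A : PhaseAlgorithm O) (d : ℕ) where
  ctr : Fin (6 * A.phi - 3 + 1)
  off : Fin (4 * A.phi - 2 + 1)
  bit : Bool
  seed : ℕ
  part : Fin d → Bool
  st : Fin d → A.State
  loc : Fin d → Fin d → Option Message
  box : Fin d → List (Option Message)
  dec : Fin d → Option O

/-- What a node draws in a cycle besides the coins of the simulated algorithm. -/
abbrev Draw (φ : ℕ) : Type := Fin (4 * φ - 2 + 1) × Bool

section

variable {O : Type} (A : PhaseAlgorithm O) (P : LCLProblem O) (Δ b : ℕ)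

/-- The offset and the role that a coin stands for. -/
noncomputable def coinDraw (n : ℕ) : Draw A.phi :=
  (seedDecode n : (Fin Δ × Fin A.phi → ℕ) × Draw A.phi).2

/-- The coin of the edge at port `i` in step `j` of the phase. -/
noncomputable def coinAt (n i j : ℕ) : ℕ :=
  if h : i < Δ ∧ j < A.phi then
    (seedDecode n : (Fin Δ × Fin A.phi → ℕ) × Draw A.phi).1 (⟨i, h.1⟩, ⟨j, h.2⟩)
  else 0

namespace EdgeRegs

variable {A} {d : ℕ} (s : EdgeRegs A d) (out : Fin d → Option O) (rc : Fin d → Summary O)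

/-- The progress in the current phase: `1` when a phase starts, `2 * j` when step `j` of the phase
is simulated and `2 * φ - 1` when the decisions are written. -/
def stage : ℕ := s.ctr - s.off

/-- The output values at both endpoints of the edge at port `i`, other than its own. -/
noncomputable def adjacentOutputs (i : Fin d) : Multiset O :=
  ((Finset.univ.erase i).val.filterMap out) +
    ((Finset.univ.erase (rc i).idx).val.filterMap (rc i).outs)

open Classical in
/-- The output register for the edge at port `i` after a round. Registers in disagreement are
cleared. A decided edge that is uncontent loses its output value, except in the round in which one
of its endpoints computes the decisions of a phase: this protection makes these decisions respect
the output values that are present when the decisions are written. An undecided participating edge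
adopts its tentative decision, known to the simulating endpoint, at the end of the phase. -/
noncomputable def newOut (i : Fin d) : Option O :=
  if out i ≠ (rc i).outs (rc i).idx then none
  else match out i with
    | some o =>
      if s.stage = 2 * A.phi - 2 ∨ (rc i).hold = true ∨ P.ok o (adjacentOutputs out rc i) then
        some o
      else none
    | none =>
      if s.stage = 2 * A.phi - 1 ∧ s.part i = true then
        (if s.bit = true then s.dec i else (rc i).dec)
      else none

open Classical in
/-- Whether the edge at port `i` takes part in the phase: it has to be undecided, and its endpoints
have to start their phases in the same round, in different roles. -/
noncomputable def newPart (i : Fin d) : Bool :=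
  if out i = none ∧ (rc i).outs (rc i).idx = none then
    if s.stage = 1 then (rc i).start && (s.bit != (rc i).bit) else s.part i
  else false

/-- The state of the edge at port `i` before the current working step. -/
def curState (i : Fin d) : A.State := if s.stage = 2 then A.initial else s.st i

/-- The last message of the edge at port `q` to the edge at port `i`. -/
def curLoc (i q : Fin d) : Option Message := if s.stage = 2 then none else s.loc q i

/-- The last message of the edge at port `q` of the other endpoint to the common edge, as told in
the summary `S`. -/
def curBox (S : Summary O) (q : Fin S.deg) : Option Message :=
  if s.stage = 2 then none else S.box.getD q none

/-- The simulated working step of the edge at port `i`, if the other endpoint has the summary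
`S`. -/
noncomputable def work (S : Summary O) (i : Fin d) :
    A.State × (Fin d → Option Message) × (Fin S.deg → Option Message) :=
  simWork (fun q => s.part q = true) i (fun q => S.part q = true) S.idx A (s.stage / 2)
    (s.curState i) (coinAt A Δ s.seed i (s.stage / 2)) (s.curLoc i) (s.curBox S)

/-- The simulated decision of the edge at port `i`. -/
noncomputable def decision (S : Summary O) (i : Fin d) (M : Multiset O) : Option O :=
  simDecision (fun q => s.part q = true) i (fun q => S.part q = true) S.idx A
    (s.curState i) (coinAt A Δ s.seed i (A.phi - 1)) (s.curLoc i) (s.curBox S) M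

open Classical in
/-- The registers after a round with coin `n`. -/
noncomputable def next (n : ℕ) : EdgeRegs A d where
  ctr := ⟨(s.ctr + 1) % (6 * A.phi - 3 + 1), Nat.mod_lt _ (Nat.succ_pos _)⟩
  off := if s.ctr = 0 then (coinDraw A Δ n).1 else s.off
  bit := if s.ctr = 0 then (coinDraw A Δ n).2 else s.bit
  seed := if s.stage = 1 then n else s.seed
  part := s.newPart out rc
  st := fun i => if s.bit = true ∧ s.stage % 2 = 0 then (s.work Δ (rc i) i).1 else s.st i
  loc := fun i => if s.bit = true ∧ s.stage % 2 = 0 then (s.work Δ (rc i) i).2.1 else s.loc i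
  box := fun i =>
    if s.bit = true then
      if s.stage % 2 = 0 then List.ofFn (s.work Δ (rc i) i).2.2 else s.box i
    else List.ofFn fun q : Fin d => (rc q).box.getD i none
  dec := fun i =>
    if s.bit = true ∧ s.stage % 2 = 0 then s.decision Δ (rc i) i (adjacentOutputs out rc i)
    else s.dec i

/-- Messages of more than `b` bits are suppressed. -/
def clip (b : ℕ) (m : Option Message) : Option Message := m.filter fun x => Nat.ble x.length b

/-- What the node tells the neighbor at port `i`. The list of messages is truncated to `Δ` items of
at most `b` bits, which is a restriction only in states that result from manipulations. -/
def summary (i : Fin d) : Summary O where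
  deg := d
  idx := i
  outs := out
  part := s.part
  start := Nat.beq s.stage 1
  hold := Nat.beq s.stage (2 * A.phi - 2)
  bit := s.bit
  dec := s.dec i
  box := ((s.box i).take Δ).map (clip b)

end EdgeRegs

/-- The algorithm for the edge problem on graphs of degree bound `Δ` that simulates the phases of
`A`, whose messages have at most `b` bits. -/
noncomputable def edgeAlgorithm : EdgeAlgorithm O where
  Reg := EdgeRegs A
  reg_nonempty _ := ⟨⟨0, 0, false, 0, fun _ => false, fun _ => A.initial, fun _ _ => none,
    fun _ => [], fun _ => none⟩⟩
  coin := seedCoin A.coin (Fin Δ × Fin A.phi) (Draw A.phi)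
  step _ s out inb n :=
    let rc := fun i => Summary.decode A (inb i)
    (s.next Δ out rc n, s.newOut P out rc,
      fun i => some (((s.next Δ out rc n).summary Δ b (s.newOut P out rc) i).encode A))

/-- The bound holds in all states, also in those that result from manipulations, since the list of
messages of simulated edges is truncated. -/
theorem edgeAlgorithm_messagesAtMost (hΔ : 0 < Δ) (hA : ∀ o, (A.announce o).length ≤ b) :
    (edgeAlgorithm A P Δ b).MessagesAtMost Δ (26 * (Δ * (1 + b)) : ℕ) := by
  intro _ hd s out inb r _ i m hm
  simp only [edgeAlgorithm, Option.some.injEq] at hm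
  subst hm
  rw [Nat.cast_le]
  refine Summary.length_encode_le A hΔ hd hA ?_ ?_
  · simp [EdgeRegs.summary]
  · intro x hx m hm
    simp only [EdgeRegs.summary, List.mem_map] at hx
    obtain ⟨y, -, rfl⟩ := hx
    simp only [EdgeRegs.clip, Option.filter_eq_some_iff] at hm
    exact Nat.le_of_ble_eq_true hm.2

end

/-! ### Ports of the line graph -/

namespace PortNumbering

variable {V : Type} {G : SimpleGraph V} (p : PortNumbering G)

/-- The port of `u` for its neighbor `v`. -/
def ix (u v : V) (h : G.Adj u v) : Fin (p.deg u) := (p.port u).symm ⟨v, h⟩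

/-- The neighbor of `u` at port `q`. -/
def nbr (u : V) (q : Fin (p.deg u)) : V := (p.port u q).1

theorem adj_nbr (u : V) (q : Fin (p.deg u)) : G.Adj u (p.nbr u q) := (p.port u q).2

@[simp] theorem nbr_ix (u v : V) (h : G.Adj u v) : p.nbr u (p.ix u v h) = v := by
  simp [nbr, ix]

theorem ix_of_eq {u v : V} {q : Fin (p.deg u)} (h : G.Adj u v) (hq : p.nbr u q = v) :
    p.ix u v h = q := by
  subst hq
  simp [nbr, ix]

@[simp] theorem ix_nbr (u : V) (q : Fin (p.deg u)) (h : G.Adj u (p.nbr u q)) :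
    p.ix u (p.nbr u q) h = q := p.ix_of_eq h rfl

theorem nbr_injective (u : V) : Function.Injective (p.nbr u) :=
  Subtype.val_injective.comp (p.port u).injective

theorem ix_inj {u v w : V} {h : G.Adj u v} {h' : G.Adj u w} (he : p.ix u v h = p.ix u w h') :
    v = w := by
  have := congrArg (p.nbr u) he
  simpa using this

theorem deg_le {D : ℕ} (hG : DegreeBounded D G) (u : V) : p.deg u ≤ D := by
  have h1 := hG.2 u
  have h2 : (G.neighborSet u).encard = p.deg u := by
    rw [← ENat.card_coe_set_eq, ← ENat.card_congr (p.port u)]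
    simp
  rw [h2] at h1
  exact_mod_cast h1

end PortNumbering

section LineGraph

variable {V : Type} {G : SimpleGraph V} (p : PortNumbering G)

/-- The edge `{u, v}` as a node of the line graph. -/
def lineNode (u v : V) (h : G.Adj u v) : G.edgeSet := ⟨s(u, v), h⟩

theorem lineNode_comm (u v : V) (h : G.Adj u v) : lineNode u v h = lineNode v u h.symm :=
  Subtype.ext Sym2.eq_swap

theorem lineNode_inj_right {u v w : V} {h : G.Adj u v} {h' : G.Adj u w}
    (he : lineNode u v h = lineNode u w h') : v = w := by
  have := congrArg Subtype.val he
  simp only [lineNode, Sym2.eq_iff, true_and] at this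
  rcases this with h1 | ⟨h1, h2⟩
  · exact h1
  · exact h2.trans h1

theorem exists_lineNode (e : G.edgeSet) : ∃ u v h, e = lineNode u v h := by
  obtain ⟨e, he⟩ := e
  induction e with
  | h a b => exact ⟨a, b, he, rfl⟩

theorem lineGraph_adj_right {u v w : V} (h : G.Adj u v) (h' : G.Adj u w) (hne : v ≠ w) :
    G.lineGraph.Adj (lineNode u v h) (lineNode u w h') := by
  rw [SimpleGraph.lineGraph_adj_iff_exists]
  exact ⟨fun he => hne (lineNode_inj_right he), u, by simp [lineNode], by simp [lineNode]⟩

theorem lineGraph_adj_lineNode {u v : V} {h : G.Adj u v} {f : G.edgeSet}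
    (hf : G.lineGraph.Adj (lineNode u v h) f) :
    (∃ w h', w ≠ v ∧ f = lineNode u w h') ∨ (∃ w h', w ≠ u ∧ f = lineNode v w h') := by
  rw [SimpleGraph.lineGraph_adj_iff_exists] at hf
  obtain ⟨hne, x, hx, hxf⟩ := hf
  obtain ⟨f, hf'⟩ := f
  obtain ⟨w, rfl⟩ := hxf
  simp only [lineNode, Sym2.mem_iff] at hx
  rcases hx with rfl | rfl
  · exact Or.inl ⟨w, hf', fun hw => hne (by subst hw; rfl), rfl⟩
  · exact Or.inr ⟨w, hf', fun hw => hne (by subst hw; exact lineNode_comm _ _ h), rfl⟩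

/-- No edge other than `{u, v}` itself is at both endpoints. -/
theorem lineNode_ne_lineNode {u v w x : V} {h : G.Adj u v} {h₁ : G.Adj u w} {h₂ : G.Adj v x}
    (hx : x ≠ u) : lineNode u w h₁ ≠ lineNode v x h₂ := by
  intro he
  have := congrArg Subtype.val he
  simp only [lineNode, Sym2.eq_iff] at this
  rcases this with ⟨h1, -⟩ | ⟨h1, -⟩
  · exact h.ne h1
  · exact hx h1.symm

/-- The output values that an edge sees in the line graph are those in the output registers of its
two endpoints for their other edges, each adjacent edge being counted once. -/
theorem nbrOutputs_lineGraph {O : Type} {u v : V} (h : G.Adj u v) (C : G.edgeSet → Option O) :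
    nbrOutputs G.lineGraph C (lineNode u v h) =
      ((Finset.univ.erase (p.ix u v h)).val.filterMap
        fun q => C (lineNode u (p.nbr u q) (p.adj_nbr u q))) +
      ((Finset.univ.erase (p.ix v u h.symm)).val.filterMap
        fun q => C (lineNode v (p.nbr v q) (p.adj_nbr v q))) := by
  classical
  let F (u : V) : Fin (p.deg u) ↪ G.edgeSet :=
    ⟨fun q => lineNode u (p.nbr u q) (p.adj_nbr u q),
      fun a b hab => p.nbr_injective u (lineNode_inj_right hab)⟩
  have hdisj : Disjoint ((Finset.univ.erase (p.ix u v h)).map (F u))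
      ((Finset.univ.erase (p.ix v u h.symm)).map (F v)) := by
    rw [Finset.disjoint_left]
    intro f hf hf'
    simp only [Finset.mem_map, Finset.mem_erase, Finset.mem_univ, and_true] at hf hf'
    obtain ⟨a, ha, rfl⟩ := hf
    obtain ⟨b, hb, hab⟩ := hf'
    refine lineNode_ne_lineNode (h := h) (fun hw => hb ?_) hab.symm
    exact (p.ix_of_eq h.symm hw).symm
  have hset : G.lineGraph.neighborSet (lineNode u v h) =
      ((((Finset.univ.erase (p.ix u v h)).map (F u)).disjUnion
        ((Finset.univ.erase (p.ix v u h.symm)).map (F v)) hdisj : Finset G.edgeSet) :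
          Set G.edgeSet) := by
    ext f
    simp only [SimpleGraph.mem_neighborSet, Finset.coe_disjUnion, Set.mem_union, Finset.mem_coe,
      Finset.mem_map, Finset.mem_erase, Finset.mem_univ, and_true]
    constructor
    · intro hf
      rcases lineGraph_adj_lineNode hf with ⟨w, h', hw, rfl⟩ | ⟨w, h', hw, rfl⟩
      · refine Or.inl ⟨p.ix u w h', fun he => hw (p.ix_inj he), Subtype.ext ?_⟩
        simp [F, lineNode]
      · refine Or.inr ⟨p.ix v w h', fun he => hw (p.ix_inj he), Subtype.ext ?_⟩
        simp [F, lineNode]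
    · rintro (⟨q, hq, rfl⟩ | ⟨q, hq, rfl⟩)
      · exact lineGraph_adj_right _ _ fun he => hq (p.ix_of_eq h he.symm).symm
      · rw [lineNode_comm]
        exact lineGraph_adj_right _ _ fun he => hq (p.ix_of_eq h.symm he.symm).symm
  have hfin : (G.lineGraph.neighborSet (lineNode u v h)).Finite := by
    rw [hset]; exact Finset.finite_toSet _
  have hto : hfin.toFinset = ((Finset.univ.erase (p.ix u v h)).map (F u)).disjUnion
        ((Finset.univ.erase (p.ix v u h.symm)).map (F v)) hdisj := by
    ext f
    rw [Set.Finite.mem_toFinset, hset, Finset.mem_coe]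
  rw [nbrOutputs_eq hfin, hto, Finset.disjUnion_val, Multiset.filterMap_add, Finset.map_val,
    Finset.map_val, Multiset.filterMap_map, Multiset.filterMap_map]
  rfl

/-! ### Orientations of the edges by bits -/

/-- The edge `e` leads from a node with bit `true` to a node with bit `false`. -/
def Splits (β : V → Bool) (e : G.edgeSet) : Prop :=
  ∃ u v h, e = lineNode u v h ∧ β u = true ∧ β v = false

theorem exists_orientation (β : V → Bool) (e : G.edgeSet) :
    ∃ x : V × V, ∃ h : G.Adj x.1 x.2, e = lineNode x.1 x.2 h ∧
      (Splits β e → β x.1 = true ∧ β x.2 = false) := by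
  by_cases hs : Splits β e
  · obtain ⟨u, v, h, he, h1, h2⟩ := hs
    exact ⟨(u, v), h, he, fun _ => ⟨h1, h2⟩⟩
  · obtain ⟨u, v, h, he⟩ := exists_lineNode e
    exact ⟨(u, v), h, he, fun h' => absurd h' hs⟩

/-- The endpoint of `e` that simulates `e`: the one with bit `true` if the bits differ. -/
noncomputable def tail (β : V → Bool) (e : G.edgeSet) : V := (exists_orientation β e).choose.1

/-- The endpoint of `e` that forwards messages to and from `e`. -/
noncomputable def head (β : V → Bool) (e : G.edgeSet) : V := (exists_orientation β e).choose.2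

variable {β : V → Bool}

theorem adj_tail_head (β : V → Bool) (e : G.edgeSet) : G.Adj (tail β e) (head β e) :=
  (exists_orientation β e).choose_spec.choose

theorem eq_tail_head (β : V → Bool) (e : G.edgeSet) :
    e = lineNode (tail β e) (head β e) (adj_tail_head β e) :=
  (exists_orientation β e).choose_spec.choose_spec.1

theorem Splits.bit_tail {e : G.edgeSet} (h : Splits β e) : β (tail β e) = true :=
  ((exists_orientation β e).choose_spec.choose_spec.2 h).1

theorem Splits.bit_head {e : G.edgeSet} (h : Splits β e) : β (head β e) = false :=
  ((exists_orientation β e).choose_spec.choose_spec.2 h).2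

theorem Splits.tail_lineNode {u v : V} {h : G.Adj u v} (hu : β u = true) (hv : β v = false) :
    tail β (lineNode u v h) = u ∧ head β (lineNode u v h) = v := by
  have hs : Splits β (lineNode u v h) := ⟨u, v, h, rfl, hu, hv⟩
  have he := congrArg Subtype.val (eq_tail_head β (lineNode u v h))
  have h1 := hs.bit_tail
  simp only [lineNode, Sym2.eq_iff] at he
  rcases he with ⟨h2, h3⟩ | ⟨h2, h3⟩
  · exact ⟨h2.symm, h3.symm⟩
  · simp only [lineNode] at h1
    rw [← h3, hv] at h1
    cases h1

/-- The edge at port `q` of `u`, as a node of the line graph. -/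
def portEdge (u : V) (q : Fin (p.deg u)) : G.edgeSet := lineNode u (p.nbr u q) (p.adj_nbr u q)

theorem portEdge_ix (u v : V) (h : G.Adj u v) : portEdge p u (p.ix u v h) = lineNode u v h :=
  Subtype.ext (by simp [portEdge, lineNode])

/-- The slots of a participating edge are its participating neighbors in the line graph. -/
noncomputable def slotNeighbors (W : Set G.edgeSet) (u v : V) (h : G.Adj u v)
    (hW : lineNode u v h ∈ W) :
    Slots (fun q => portEdge p u q ∈ W) (p.ix u v h)
      (fun q => portEdge p v q ∈ W) (p.ix v u h.symm) ≃
    (G.lineGraph.induce W).neighborSet ⟨lineNode u v h, hW⟩ := by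
  refine Equiv.ofBijective (Sum.elim
    (fun q => ⟨⟨portEdge p u q.1, q.2.1⟩, ?_⟩)
    (fun q => ⟨⟨portEdge p v q.1, q.2.1⟩, ?_⟩)) ⟨?_, ?_⟩
  · exact lineGraph_adj_right _ _ fun he => q.2.2 (p.ix_of_eq h he.symm).symm
  · change G.lineGraph.Adj (lineNode u v h) _
    rw [lineNode_comm]
    exact lineGraph_adj_right _ _ fun he => q.2.2 (p.ix_of_eq h.symm he.symm).symm
  · rintro (⟨a, ha⟩ | ⟨a, ha⟩) (⟨b, hb⟩ | ⟨b, hb⟩) hab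
    · replace hab := congrArg (fun z => z.1.1) hab
      have := p.nbr_injective u (lineNode_inj_right hab)
      subst this; rfl
    · replace hab := congrArg (fun z => z.1.1) hab
      exact absurd hab (lineNode_ne_lineNode (h := h)
        (fun he => hb.2 (p.ix_of_eq h.symm he).symm))
    · replace hab := congrArg (fun z => z.1.1) hab
      exact absurd hab.symm (lineNode_ne_lineNode (h := h)
        (fun he => ha.2 (p.ix_of_eq h.symm he).symm))
    · replace hab := congrArg (fun z => z.1.1) hab
      have := p.nbr_injective v (lineNode_inj_right hab)
      subst this; rfl
  · rintro ⟨⟨f, hf⟩, hadj⟩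
    have hadj' : G.lineGraph.Adj (lineNode u v h) f := hadj
    rcases lineGraph_adj_lineNode hadj' with ⟨w, h', hw, rfl⟩ | ⟨w, h', hw, rfl⟩
    · refine ⟨Sum.inl ⟨p.ix u w h', ?_, fun he => hw (p.ix_inj he)⟩, ?_⟩
      · beta_reduce
        rwa [portEdge_ix]
      · exact Subtype.ext (Subtype.ext (portEdge_ix p _ _ h'))
    · refine ⟨Sum.inr ⟨p.ix v w h', ?_, fun he => hw (p.ix_inj he)⟩, ?_⟩
      · beta_reduce
        rwa [portEdge_ix]
      · exact Subtype.ext (Subtype.ext (portEdge_ix p _ _ h'))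

/-- The port numbering, on the participating edges, that the simulation uses. -/
noncomputable abbrev linePorts (β : V → Bool) (W : Set G.edgeSet) :
    PortNumbering (G.lineGraph.induce W) where
  deg e := slotCard
    (fun q => portEdge p (tail β e.1) q ∈ W)
    (p.ix (tail β e.1) (head β e.1) (adj_tail_head β e.1))
    (fun q => portEdge p (head β e.1) q ∈ W)
    (p.ix (head β e.1) (tail β e.1) (adj_tail_head β e.1).symm)
  port e := (slotEquiv _ _ _ _).symm.trans <|
    (slotNeighbors p W (tail β e.1) (head β e.1) (adj_tail_head β e.1)
      (eq_tail_head β e.1 ▸ e.2)).trans <|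
    Equiv.setCongr (congrArg _ (Subtype.ext (eq_tail_head β e.1).symm))

theorem slotCard_le {d d' : ℕ} (a : Fin d → Prop) (i : Fin d) (a' : Fin d' → Prop)
    (i' : Fin d') {Δ : ℕ} (hd : d ≤ Δ) (hd' : d' ≤ Δ) : slotCard a i a' i' ≤ 2 * Δ - 2 := by
  classical
  have key : ∀ (n : ℕ) (b : Fin n → Prop) (k : Fin n),
      Fintype.card {q : Fin n // b q ∧ q ≠ k} ≤ n - 1 := by
    intro n b k
    calc Fintype.card {q : Fin n // b q ∧ q ≠ k} ≤ Fintype.card {q : Fin n // q ≠ k} :=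
          Fintype.card_subtype_mono _ _ fun q hq => hq.2
      _ = n - 1 := by simp [Fintype.card_subtype_compl]
  have h1 := key d a i
  have h2 := key d' a' i'
  have h3 : slotCard a i a' i' = Fintype.card {q : Fin d // a q ∧ q ≠ i} +
      Fintype.card {q : Fin d' // a' q ∧ q ≠ i'} := by
    rw [← Fintype.card_sum]
    exact Fintype.card_congr (Equiv.refl _)
  have := i.2
  have := i'.2
  omega

end LineGraph

/-! ### Simulated edges and the phase of the line graph -/

section Simulation

variable {V O : Type} {G : SimpleGraph V} (p : PortNumbering G) (A : PhaseAlgorithm O)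
  (β : V → Bool) (W : Set G.edgeSet) (ρ : G.edgeSet × ℕ → ℕ)

variable {W} in
theorem linePorts_inl (e : ↥W) {q : Fin (p.deg (tail β e.1))}
    (hq : portEdge p _ q ∈ W ∧ q ≠ p.ix (tail β e.1) (head β e.1) (adj_tail_head β e.1)) :
    (((linePorts p β W).port e (slotEquiv (fun q => portEdge p (tail β e.1) q ∈ W)
      (p.ix (tail β e.1) (head β e.1) (adj_tail_head β e.1))
      (fun q => portEdge p (head β e.1) q ∈ W)
      (p.ix (head β e.1) (tail β e.1) (adj_tail_head β e.1).symm) (Sum.inl ⟨q, hq⟩))).1).1 =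
      portEdge p _ q := by
  change ((slotNeighbors p W (tail β e.1) (head β e.1) (adj_tail_head β e.1)
    (eq_tail_head β e.1 ▸ e.2) ((slotEquiv _ _ _ _).symm (slotEquiv _ _ _ _ _))).1).1 = _
  rw [Equiv.symm_apply_apply]
  rfl

variable {W} in
theorem linePorts_inr (e : ↥W) {q : Fin (p.deg (head β e.1))}
    (hq : portEdge p _ q ∈ W ∧ q ≠ p.ix (head β e.1) (tail β e.1) (adj_tail_head β e.1).symm) :
    (((linePorts p β W).port e (slotEquiv (fun q => portEdge p (tail β e.1) q ∈ W)
      (p.ix (tail β e.1) (head β e.1) (adj_tail_head β e.1))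
      (fun q => portEdge p (head β e.1) q ∈ W)
      (p.ix (head β e.1) (tail β e.1) (adj_tail_head β e.1).symm) (Sum.inr ⟨q, hq⟩))).1).1 =
      portEdge p _ q := by
  change ((slotNeighbors p W (tail β e.1) (head β e.1) (adj_tail_head β e.1)
    (eq_tail_head β e.1 ▸ e.2) ((slotEquiv _ _ _ _).symm (slotEquiv _ _ _ _ _))).1).1 = _
  rw [Equiv.symm_apply_apply]
  rfl

/-- The state of the participating edge `e` and its messages after step `j`. -/
noncomputable def simState (j : ℕ) (e : ↥W) :
    A.State × (Fin ((linePorts p β W).deg e) → Option Message) :=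
  A.working (linePorts p β W) (fun u j => ρ (u.1, j)) j e

open Classical in
/-- The message of the participating edge `e` to the participating edge `f` in step `j`. -/
noncomputable def simMsg (j : ℕ) (e f : G.edgeSet) : Option Message :=
  if h : ∃ (he : e ∈ W) (hf : f ∈ W), (G.lineGraph.induce W).Adj ⟨e, he⟩ ⟨f, hf⟩ then
    (linePorts p β W).sent (fun x => (simState p A β W ρ j x).2) ⟨e, h.choose⟩
      ⟨f, h.choose_spec.choose⟩ h.choose_spec.choose_spec
  else none

variable {W}

theorem simMsg_eq (j : ℕ) {e f : ↥W} (h : (G.lineGraph.induce W).Adj e f) :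
    simMsg p A β W ρ j e.1 f.1 =
      (linePorts p β W).sent (fun x => (simState p A β W ρ j x).2) e f h :=
  dif_pos ⟨e.2, f.2, h⟩

theorem simMsg_zero (e f : G.edgeSet) : simMsg p A β W ρ 0 e f = none := by
  unfold simMsg
  split_ifs
  · rfl
  · rfl

theorem adj_portEdge_tail (e : ↥W) {q : Fin (p.deg (tail β e.1))}
    (hq : q ≠ p.ix (tail β e.1) (head β e.1) (adj_tail_head β e.1)) :
    G.lineGraph.Adj e.1 (portEdge p _ q) := by
  conv_lhs => rw [eq_tail_head β e.1]
  exact lineGraph_adj_right _ _ fun he => hq (p.ix_of_eq _ he.symm).symm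

theorem adj_portEdge_head (e : ↥W) {q : Fin (p.deg (head β e.1))}
    (hq : q ≠ p.ix (head β e.1) (tail β e.1) (adj_tail_head β e.1).symm) :
    G.lineGraph.Adj e.1 (portEdge p _ q) := by
  conv_lhs => rw [eq_tail_head β e.1, lineNode_comm]
  exact lineGraph_adj_right _ _ fun he => hq (p.ix_of_eq _ he.symm).symm

theorem slotOutFst_simState (j : ℕ) (e : ↥W) (q : Fin (p.deg (tail β e.1)))
    (hq : portEdge p _ q ∈ W)
    (hne : q ≠ p.ix (tail β e.1) (head β e.1) (adj_tail_head β e.1)) :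
    slotOutFst (fun q => portEdge p (tail β e.1) q ∈ W)
      (p.ix (tail β e.1) (head β e.1) (adj_tail_head β e.1))
      (fun q => portEdge p (head β e.1) q ∈ W)
      (p.ix (head β e.1) (tail β e.1) (adj_tail_head β e.1).symm)
      (simState p A β W ρ j e).2 q =
      simMsg p A β W ρ j e.1 (portEdge p _ q) := by
  rw [simMsg_eq p A β ρ j (e := e) (f := ⟨portEdge p _ q, hq⟩) (adj_portEdge_tail p β e hne)]
  rw [slotOutFst, dif_pos ⟨hq, hne⟩]
  unfold PortNumbering.sent
  refine congrArg (simState p A β W ρ j e).2 ?_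
  refine (((linePorts p β W).port e).eq_symm_apply).2 ?_
  exact Subtype.ext (Subtype.ext (linePorts_inl p β e ⟨hq, hne⟩))

theorem slotOutSnd_simState (j : ℕ) (e : ↥W) (q : Fin (p.deg (head β e.1)))
    (hq : portEdge p _ q ∈ W)
    (hne : q ≠ p.ix (head β e.1) (tail β e.1) (adj_tail_head β e.1).symm) :
    slotOutSnd (fun q => portEdge p (tail β e.1) q ∈ W)
      (p.ix (tail β e.1) (head β e.1) (adj_tail_head β e.1))
      (fun q => portEdge p (head β e.1) q ∈ W)
      (p.ix (head β e.1) (tail β e.1) (adj_tail_head β e.1).symm)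
      (simState p A β W ρ j e).2 q =
      simMsg p A β W ρ j e.1 (portEdge p _ q) := by
  rw [simMsg_eq p A β ρ j (e := e) (f := ⟨portEdge p _ q, hq⟩) (adj_portEdge_head p β e hne)]
  rw [slotOutSnd, dif_pos ⟨hq, hne⟩]
  unfold PortNumbering.sent
  refine congrArg (simState p A β W ρ j e).2 ?_
  refine (((linePorts p β W).port e).eq_symm_apply).2 ?_
  exact Subtype.ext (Subtype.ext (linePorts_inr p β e ⟨hq, hne⟩))

section Inbox

variable {β ρ} {j : ℕ} {e : ↥W} {x : Fin (p.deg (tail β e.1)) → Option Message}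
  {y : Fin (p.deg (head β e.1)) → Option Message}

/-- If the endpoints of `e` know the last messages from the adjacent participating edges to `e`,
then the simulated edge receives what it would receive in the line graph. -/
theorem slotInbox_eq_deliver
    (hx : ∀ q, portEdge p _ q ∈ W →
      q ≠ p.ix (tail β e.1) (head β e.1) (adj_tail_head β e.1) →
      x q = simMsg p A β W ρ j (portEdge p _ q) e)
    (hy : ∀ q, portEdge p _ q ∈ W →
      q ≠ p.ix (head β e.1) (tail β e.1) (adj_tail_head β e.1).symm →
      y q = simMsg p A β W ρ j (portEdge p _ q) e) :
    slotInbox (fun q => portEdge p (tail β e.1) q ∈ W)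
      (p.ix (tail β e.1) (head β e.1) (adj_tail_head β e.1))
      (fun q => portEdge p (head β e.1) q ∈ W)
      (p.ix (head β e.1) (tail β e.1) (adj_tail_head β e.1).symm) x y =
    (linePorts p β W).deliver (fun w => (simState p A β W ρ j w).2) e := by
  funext k
  have key : (linePorts p β W).deliver (fun w => (simState p A β W ρ j w).2) e k =
      simMsg p A β W ρ j ((linePorts p β W).port e k).1.1 e.1 :=
    (simMsg_eq p A β ρ j ((linePorts p β W).port e k).2.symm).symm
  rw [key]
  obtain ⟨s, rfl⟩ := (slotEquiv (fun q => portEdge p (tail β e.1) q ∈ W)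
      (p.ix (tail β e.1) (head β e.1) (adj_tail_head β e.1))
      (fun q => portEdge p (head β e.1) q ∈ W)
      (p.ix (head β e.1) (tail β e.1) (adj_tail_head β e.1).symm)).surjective k
  rcases s with ⟨q, hq⟩ | ⟨q, hq⟩
  · rw [linePorts_inl p β e hq, ← hx q hq.1 hq.2]
    unfold slotInbox
    rw [Equiv.symm_apply_apply]
  · rw [linePorts_inr p β e hq, ← hy q hq.1 hq.2]
    unfold slotInbox
    rw [Equiv.symm_apply_apply]

/-- A correctly informed simulated working step agrees with the working step of `A` in the line
graph. -/
theorem simWork_eq_simState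
    (hx : ∀ q, portEdge p _ q ∈ W →
      q ≠ p.ix (tail β e.1) (head β e.1) (adj_tail_head β e.1) →
      x q = simMsg p A β W ρ j (portEdge p _ q) e)
    (hy : ∀ q, portEdge p _ q ∈ W →
      q ≠ p.ix (head β e.1) (tail β e.1) (adj_tail_head β e.1).symm →
      y q = simMsg p A β W ρ j (portEdge p _ q) e) :
    simWork (fun q => portEdge p (tail β e.1) q ∈ W)
      (p.ix (tail β e.1) (head β e.1) (adj_tail_head β e.1))
      (fun q => portEdge p (head β e.1) q ∈ W)
      (p.ix (head β e.1) (tail β e.1) (adj_tail_head β e.1).symm) A (j + 1)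
      (simState p A β W ρ j e).1 (ρ (e.1, j + 1)) x y =
    ((simState p A β W ρ (j + 1) e).1,
      slotOutFst (fun q => portEdge p (tail β e.1) q ∈ W)
      (p.ix (tail β e.1) (head β e.1) (adj_tail_head β e.1))
      (fun q => portEdge p (head β e.1) q ∈ W)
      (p.ix (head β e.1) (tail β e.1) (adj_tail_head β e.1).symm) (simState p A β W ρ (j + 1) e).2,
      slotOutSnd (fun q => portEdge p (tail β e.1) q ∈ W)
      (p.ix (tail β e.1) (head β e.1) (adj_tail_head β e.1))
      (fun q => portEdge p (head β e.1) q ∈ W)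
      (p.ix (head β e.1) (tail β e.1) (adj_tail_head β e.1).symm)
      (simState p A β W ρ (j + 1) e).2) := by
  rw [simWork, slotInbox_eq_deliver p A hx hy]
  rfl

/-- A correctly informed simulated decision agrees with the decision of `A` in the line graph. -/
theorem simDecision_eq_phaseOn
    (hx : ∀ q, portEdge p _ q ∈ W →
      q ≠ p.ix (tail β e.1) (head β e.1) (adj_tail_head β e.1) →
      x q = simMsg p A β W ρ (A.phi - 2) (portEdge p _ q) e)
    (hy : ∀ q, portEdge p _ q ∈ W →
      q ≠ p.ix (head β e.1) (tail β e.1) (adj_tail_head β e.1).symm →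
      y q = simMsg p A β W ρ (A.phi - 2) (portEdge p _ q) e) (C : G.edgeSet → Option O) :
    simDecision (fun q => portEdge p (tail β e.1) q ∈ W)
      (p.ix (tail β e.1) (head β e.1) (adj_tail_head β e.1))
      (fun q => portEdge p (head β e.1) q ∈ W)
      (p.ix (head β e.1) (tail β e.1) (adj_tail_head β e.1).symm) A
      (simState p A β W ρ (A.phi - 2) e).1 (ρ (e.1, A.phi - 1)) x y
      (nbrOutputs G.lineGraph C e) =
    A.phaseOn G.lineGraph C W (linePorts p β W) ρ e := by
  rw [simDecision, slotInbox_eq_deliver p A hx hy, PhaseAlgorithm.phaseOn, dif_pos e.2]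
  rfl

end Inbox

/-- Simulated messages are as short as those of the simulated algorithm. -/
theorem length_simMsg_le {Δ b j : ℕ} (hG : DegreeBounded Δ G) (hA : A.MessagesAtMost (2 * Δ - 2) b)
    (hj : j ≤ A.phi - 2) (hρ : ∀ e ∈ W, ∀ j < A.phi, ρ (e, j) ∈ A.coin.support)
    {e f : G.edgeSet} {m : Message} (hm : simMsg p A β W ρ j e f = some m) : m.length ≤ b := by
  have h2 := A.two_le_phi
  unfold simMsg at hm
  split_ifs at hm with h
  rcases j with _ | j
  · cases hm
  · refine hA.2 (j + 1) _ (by omega) hj ?_ _ _ ?_ _ _ m hm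
    · exact slotCard_le (fun q => portEdge p (tail β e) q ∈ W)
        (p.ix (tail β e) (head β e) (adj_tail_head β e))
        (fun q => portEdge p (head β e) q ∈ W)
        (p.ix (head β e) (tail β e) (adj_tail_head β e).symm) (p.deg_le hG _) (p.deg_le hG _)
    · exact hρ _ h.choose (j + 1) (by omega)

end Simulation

/-! ### Executions of the algorithm away from the manipulated nodes -/

/-- The registers of the nodes in an execution on the graph `G`; only the nodes in `good` are known
to follow the algorithm. From time `1` on, neighboring good nodes know the state of each other. The
coin of `v` in round `n` is `r n v`. -/
structure Exec {V O : Type} (A : PhaseAlgorithm O) (P : LCLProblem O) (Δ b : ℕ)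
    (G : SimpleGraph V) (p : PortNumbering G) (good : Set V) (r : ℕ → V → ℕ) where
  reg : ℕ → ∀ v, EdgeRegs A (p.deg v)
  out : ℕ → ∀ v, Fin (p.deg v) → Option O
  rc : ℕ → ∀ v, Fin (p.deg v) → Summary O
  reg_succ : ∀ n, ∀ v ∈ good, reg (n + 1) v = (reg n v).next Δ (out n v) (rc n v) (r n v)
  out_succ : ∀ n, ∀ v ∈ good, out (n + 1) v = (reg n v).newOut P (out n v) (rc n v)
  rc_eq : ∀ n, 1 ≤ n → ∀ u v (h : G.Adj u v), u ∈ good → v ∈ good →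
    rc n u (p.ix u v h) = (reg n v).summary Δ b (out n v) (p.ix v u h.symm)

namespace Exec

variable {V O : Type} {A : PhaseAlgorithm O} {P : LCLProblem O} {Δ b : ℕ}
  {G : SimpleGraph V} {p : PortNumbering G} {good : Set V} {r : ℕ → V → ℕ}
  (X : Exec A P Δ b G p good r)

/-- The progress of `v` in its current phase, at time `n`. -/
def stage (n : ℕ) (v : V) : ℕ := (X.reg n v).stage

/-- The role of `v` at time `n`: whether it simulates its edges. -/
def bit (n : ℕ) (v : V) : Bool := (X.reg n v).bit

/-- The output register of `u` for its neighbor `v`. -/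
def val (n : ℕ) (u v : V) (h : G.Adj u v) : Option O := X.out n u (p.ix u v h)

/-- `u` takes part with its edge to `v` in its current phase. -/
def part (n : ℕ) (u v : V) (h : G.Adj u v) : Bool := (X.reg n u).part (p.ix u v h)

/-- The edge `{u, v}` is protected because a decision is about to be taken. -/
def Held (n : ℕ) (u v : V) : Prop := X.stage n u = 2 * A.phi - 2 ∨ X.stage n v = 2 * A.phi - 2

/-- The output values that are visible next to the edge `{u, v}`. -/
def outputs (n : ℕ) (u v : V) (h : G.Adj u v) : Multiset O :=
  ((Finset.univ.erase (p.ix u v h)).val.filterMap (X.out n u)) +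
    ((Finset.univ.erase (p.ix v u h.symm)).val.filterMap (X.out n v))

variable {X} {n : ℕ} {u v : V} {h : G.Adj u v}

theorem adjacentOutputs_eq (hn : 1 ≤ n) (hu : u ∈ good) (hv : v ∈ good) (h : G.Adj u v) :
    EdgeRegs.adjacentOutputs (X.out n u) (X.rc n u) (p.ix u v h) = X.outputs n u v h := by
  unfold EdgeRegs.adjacentOutputs
  rw [X.rc_eq n hn u v h hu hv]
  rfl

theorem outputs_comm : X.outputs n u v h = X.outputs n v u h.symm := add_comm _ _

open Classical in
/-- The rule for the output registers of an edge between good nodes, in terms of the registers of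
both endpoints. -/
theorem val_succ (hn : 1 ≤ n) (hu : u ∈ good) (hv : v ∈ good) :
    X.val (n + 1) u v h = if X.val n u v h ≠ X.val n v u h.symm then none else
      match X.val n u v h with
      | some o => if X.Held n u v ∨ P.ok o (X.outputs n u v h) then some o else none
      | none => if X.stage n u = 2 * A.phi - 1 ∧ X.part n u v h = true then
          (if X.bit n u = true then (X.reg n u).dec (p.ix u v h)
            else (X.reg n v).dec (p.ix v u h.symm)) else none := by
  rw [val, X.out_succ n u hu, EdgeRegs.newOut, adjacentOutputs_eq hn hu hv,
    X.rc_eq n hn u v h hu hv]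
  have h1 : (((X.reg n v).summary Δ b (X.out n v) (p.ix v u h.symm)).outs
      ((X.reg n v).summary Δ b (X.out n v) (p.ix v u h.symm)).idx) = X.val n v u h.symm := rfl
  have h2 : (((X.reg n v).summary Δ b (X.out n v) (p.ix v u h.symm)).hold = true) =
      (X.stage n v = 2 * A.phi - 2) := by
    simp [EdgeRegs.summary, stage]
  have h3 : X.out n u (p.ix u v h) = X.val n u v h := rfl
  rw [h1, h3]
  by_cases he : X.val n u v h ≠ X.val n v u h.symm
  · rw [if_pos he, if_pos he]
  · rw [if_neg he, if_neg he]
    rcases X.val n u v h with _ | o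
    · rfl
    · by_cases hh : X.Held n u v ∨ P.ok o (X.outputs n u v h)
      · refine Eq.trans (if_pos ?_) (if_pos hh).symm
        rw [h2, ← or_assoc]
        exact hh
      · refine Eq.trans (if_neg ?_) (if_neg hh).symm
        rw [h2, ← or_assoc]
        exact hh

/-- An undecided edge takes part from the round in which both endpoints are in stage `1`, in
different roles, and as long as it stays undecided. -/
theorem part_succ (hn : 1 ≤ n) (hu : u ∈ good) (hv : v ∈ good) :
    X.part (n + 1) u v h = true ↔ X.val n u v h = none ∧ X.val n v u h.symm = none ∧
      if X.stage n u = 1 then X.stage n v = 1 ∧ X.bit n u ≠ X.bit n v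
      else X.part n u v h = true := by
  classical
  rw [part, X.reg_succ n u hu]
  change EdgeRegs.newPart _ _ _ _ = true ↔ _
  rw [EdgeRegs.newPart, X.rc_eq n hn u v h hu hv]
  have h1 : (((X.reg n v).summary Δ b (X.out n v) (p.ix v u h.symm)).outs
      ((X.reg n v).summary Δ b (X.out n v) (p.ix v u h.symm)).idx) = X.val n v u h.symm := rfl
  have h2 : ((X.reg n v).summary Δ b (X.out n v) (p.ix v u h.symm)).start = true ↔
      X.stage n v = 1 := by
    simp [EdgeRegs.summary, stage]
  have h3 : ((X.reg n v).summary Δ b (X.out n v) (p.ix v u h.symm)).bit = X.bit n v := rfl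
  rw [h1, h3]
  change (if X.val n u v h = none ∧ _ then (if X.stage n u = 1 then
    _ && (X.bit n u != X.bit n v) else X.part n u v h) else false) = true ↔ _
  by_cases hc : X.val n u v h = none ∧ X.val n v u h.symm = none
  · refine (iff_of_eq (congrArg (· = true) (if_pos hc))).trans ?_
    by_cases hs : X.stage n u = 1
    · simp only [hs, if_true, Bool.and_eq_true, h2, bne_iff_ne, hc.1, hc.2, true_and]
    · simp only [hs, if_false, hc.1, hc.2, true_and]
  · refine (iff_of_eq (congrArg (· = true) (if_neg hc))).trans ?_
    simp only [Bool.false_eq_true, false_iff]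
    tauto

/-! ### The clock of a node -/

theorem stage_succ (hv : v ∈ good) (h1 : 1 ≤ X.stage n v) (h2 : X.stage n v < 2 * A.phi - 1) :
    X.stage (n + 1) v = X.stage n v + 1 ∧ X.bit (n + 1) v = X.bit n v := by
  have h0 := A.two_le_phi
  unfold stage bit EdgeRegs.stage at *
  rw [X.reg_succ n v hv]
  set s := X.reg n v
  have hc := s.ctr.2
  have ho := s.off.2
  have hz : s.ctr ≠ 0 := by
    intro hz
    rw [hz] at h1
    simp at h1
  simp only [EdgeRegs.next, if_neg hz]
  rw [Nat.mod_eq_of_lt (by omega)]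
  exact ⟨by omega, trivial⟩

theorem stage_of_succ (hv : v ∈ good) {k : ℕ} (h1 : X.stage (n + 1) v = k + 2) :
    X.stage n v = k + 1 := by
  unfold stage EdgeRegs.stage at *
  rw [X.reg_succ n v hv] at h1
  set s := X.reg n v
  have hc := s.ctr.2
  have hz : s.ctr ≠ 0 := by
    intro hz
    simp only [EdgeRegs.next, hz, if_true] at h1
    have : 1 % (6 * A.phi - 3 + 1) ≤ 1 := Nat.mod_le _ _
    simp only [Fin.val_zero, zero_add] at h1
    omega
  simp only [EdgeRegs.next, if_neg hz] at h1
  by_cases hlt : (s.ctr : ℕ) + 1 < 6 * A.phi - 3 + 1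
  · rw [Nat.mod_eq_of_lt hlt] at h1
    omega
  · have : (s.ctr : ℕ) + 1 = 6 * A.phi - 3 + 1 := by omega
    rw [this, Nat.mod_self] at h1
    omega

theorem stage_add_bit (hv : v ∈ good) (h1 : X.stage n v = 1) {m : ℕ} (hm : m ≤ 2 * A.phi - 2) :
    X.stage (n + m) v = m + 1 ∧ X.bit (n + m) v = X.bit n v := by
  have h0 := A.two_le_phi
  induction m with
  | zero => exact ⟨h1, rfl⟩
  | succ m ih =>
    have ih := ih (by omega)
    have := stage_succ (X := X) (n := n + m) hv (by omega) (by omega)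
    rw [← add_assoc]
    exact ⟨by rw [this.1, ih.1], this.2.trans ih.2⟩

theorem stage_sub (hv : v ∈ good) {m k : ℕ} (h1 : X.stage (n + m) v = k + m + 1) :
    X.stage n v = k + 1 := by
  induction m with
  | zero => exact h1
  | succ m ih =>
    exact ih (stage_of_succ (n := n + m) (k := k + m) hv (by rw [add_assoc, h1]; omega))

/-- The coins drawn at the start of a phase are kept until its end. -/
theorem seed_add (hv : v ∈ good) (h1 : X.stage n v = 1) {m : ℕ} (hm : m + 1 ≤ 2 * A.phi - 2) :
    (X.reg (n + m + 1) v).seed = r n v := by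
  classical
  induction m with
  | zero =>
    rw [add_zero, X.reg_succ n v hv]
    have : (X.reg n v).stage = 1 := h1
    simp [EdgeRegs.next, this]
  | succ m ih =>
    have := (stage_add_bit hv h1 (m := m + 1) (by omega)).1
    have h2 : ¬ (X.reg (n + (m + 1)) v).stage = 1 := by
      change ¬ X.stage _ _ = 1
      omega
    rw [X.reg_succ _ v hv]
    simp only [EdgeRegs.next, h2, if_false]
    exact ih (by omega)

/-! ### Participating edges -/

variable (X) in
/-- The edge `{u, v}` starts to take part in a phase at time `n`. -/
def Starts (n : ℕ) (u v : V) (h : G.Adj u v) : Prop :=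
  u ∈ good ∧ v ∈ good ∧ X.stage n u = 1 ∧ X.stage n v = 1 ∧ X.bit n u ≠ X.bit n v ∧
    X.val n u v h = none ∧ X.val n v u h.symm = none

theorem Starts.symm (hs : X.Starts n u v h) : X.Starts n v u h.symm :=
  ⟨hs.2.1, hs.1, hs.2.2.2.1, hs.2.2.1, hs.2.2.2.2.1.symm, hs.2.2.2.2.2.2, hs.2.2.2.2.2.1⟩

variable (X) in
/-- The edges that take part in the phase that starts at time `n`. -/
def startEdges (n : ℕ) : Set G.edgeSet := {e | ∃ u v h, e = lineNode u v h ∧ X.Starts n u v h}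

theorem lineNode_eq_lineNode {u v u' v' : V} {h : G.Adj u v} {h' : G.Adj u' v'}
    (he : lineNode u v h = lineNode u' v' h') : u = u' ∧ v = v' ∨ u = v' ∧ v = u' := by
  have := congrArg Subtype.val he
  simpa [lineNode] using this

theorem mem_startEdges : lineNode u v h ∈ X.startEdges n ↔ X.Starts n u v h := by
  constructor
  · rintro ⟨u', v', h', he, hs⟩
    rcases lineNode_eq_lineNode he with ⟨rfl, rfl⟩ | ⟨rfl, rfl⟩
    · exact hs
    · exact hs.symm
  · exact fun hs => ⟨u, v, h, rfl, hs⟩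

theorem splits_of_mem {e : G.edgeSet} (he : e ∈ X.startEdges n) : Splits (X.bit n) e := by
  obtain ⟨u, v, h, rfl, hs⟩ := he
  have hb := hs.2.2.2.2.1
  rcases hu : X.bit n u <;> rcases hv : X.bit n v
  · simp [hu, hv] at hb
  · exact ⟨v, u, h.symm, lineNode_comm _ _ _, hv, hu⟩
  · exact ⟨u, v, h, rfl, hu, hv⟩
  · simp [hu, hv] at hb

theorem val_succ_of_none (hn : 1 ≤ n) (hu : u ∈ good) (hv : v ∈ good)
    (h1 : X.val n u v h = none) (hs : X.stage n u ≠ 2 * A.phi - 1) :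
    X.val (n + 1) u v h = none := by
  rw [val_succ hn hu hv, h1]
  split_ifs <;> simp_all

theorem val_add_of_starts (hn : 1 ≤ n) (hs : X.Starts n u v h) {m : ℕ} (hm : m ≤ 2 * A.phi - 2) :
    X.val (n + m) u v h = none := by
  induction m with
  | zero => exact hs.2.2.2.2.2.1
  | succ m ih =>
    have h1 := (stage_add_bit hs.1 hs.2.2.1 (m := m) (by omega)).1
    exact val_succ_of_none (n := n + m) (by omega) hs.1 hs.2.1 (ih (by omega)) (by omega)

/-- The participants of a phase do not change before the decisions are written: undecided edges
stay undecided in the meantime. -/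
theorem part_add (hn : 1 ≤ n) (hu : u ∈ good) (hv : v ∈ good) (h1 : X.stage n u = 1) {m : ℕ}
    (hm : m + 1 ≤ 2 * A.phi - 2) : X.part (n + m + 1) u v h = true ↔ X.Starts n u v h := by
  induction m with
  | zero =>
    rw [add_zero, part_succ hn hu hv, if_pos h1]
    unfold Starts
    tauto
  | succ m ih =>
    have h2 := (stage_add_bit hu h1 (m := m + 1) (by omega)).1
    rw [part_succ (by omega) hu hv, if_neg (by omega)]
    rw [← add_assoc, ih (by omega)]
    constructor
    · exact fun h => h.2.2
    · intro hs
      exact ⟨val_add_of_starts hn hs (m := m + 1) (by omega),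
        val_add_of_starts hn hs.symm (m := m + 1) (by omega), hs⟩

variable (X) in
/-- From time `c` on, every commitment of an output value for an edge between good nodes results
from a phase that started at a positive time. -/
def CommitsFrom (c : ℕ) : Prop :=
  1 ≤ c ∧ ∀ n, c ≤ n → ∀ u v (h : G.Adj u v), u ∈ good → v ∈ good →
    X.val n u v h = none → X.val n v u h.symm = none → X.stage n u = 2 * A.phi - 1 →
    X.part n u v h = true → 2 * A.phi - 1 ≤ n

theorem commitsFrom_two_mul_phi : X.CommitsFrom (2 * A.phi - 1) :=
  ⟨by have := A.two_le_phi; omega, fun _ h _ _ _ _ _ _ _ _ _ => h⟩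

/-- If all edges between good nodes are decided at time `1`, then no commitment results from the
initial values of the registers. -/
theorem commitsFrom_one (h1 : ∀ u v (h : G.Adj u v), u ∈ good → v ∈ good → X.val 1 u v h ≠ none) :
    X.CommitsFrom 1 := by
  have h0 := A.two_le_phi
  refine ⟨le_rfl, fun n hn u v h hu hv hval _ hs hp => ?_⟩
  by_contra hlt
  have key : ∀ m k, 1 ≤ m → X.stage m u = k + 1 → m ≤ k + 1 → X.part m u v h = true →
      X.val m u v h ≠ none := by
    intro m
    induction m with
    | zero => intro k h; omega
    | succ m ih =>
      intro k _ hk hmk hp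
      rcases Nat.eq_zero_or_pos m with rfl | hm
      · exact h1 u v h hu hv
      · rw [part_succ hm hu hv] at hp
        obtain ⟨k, rfl⟩ : ∃ k', k = k' + 1 := ⟨k - 1, by omega⟩
        have hk' := stage_of_succ (n := m) (k := k) hu hk
        by_cases hk0 : k = 0
        · subst hk0
          obtain rfl : m = 1 := by omega
          exact absurd hp.1 (h1 u v h hu hv)
        · rw [if_neg (by omega)] at hp
          exact absurd hp.1 (ih k hm hk' (by omega) hp.2.2)
  exact key n (2 * A.phi - 2) hn (by omega) (by omega) hp hval

variable (X) in
/-- The edges between good nodes are port-consistent at time `n`. -/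
def Consistent (n : ℕ) : Prop :=
  ∀ u v (h : G.Adj u v), u ∈ good → v ∈ good → X.val n u v h = X.val n v u h.symm

/-- When an edge writes a decision, this is the end of a phase that it started with both endpoints
in stage `1`. -/
theorem starts_of_commit {c : ℕ} (hc : X.CommitsFrom c) (hn : c ≤ n) (hu : u ∈ good)
    (hv : v ∈ good) (h1 : X.val n u v h = none) (h2 : X.val n v u h.symm = none)
    (hs : X.stage n u = 2 * A.phi - 1) (hp : X.part n u v h = true) :
    ∃ n₀, 1 ≤ n₀ ∧ n = n₀ + (2 * A.phi - 2) ∧ X.Starts n₀ u v h := by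
  have h0 := A.two_le_phi
  have hle := hc.2 n hn u v h hu hv h1 h2 hs hp
  obtain ⟨n₀, rfl⟩ : ∃ n₀, n = n₀ + (2 * A.phi - 2) := ⟨n - (2 * A.phi - 2), by omega⟩
  refine ⟨n₀, by omega, rfl, ?_⟩
  have hst : X.stage n₀ u = 1 := stage_sub (m := 2 * A.phi - 2) (k := 0) hu (by omega)
  rw [← part_add (by omega) hu hv hst (m := 2 * A.phi - 3) (by omega)]
  rwa [show n₀ + (2 * A.phi - 3) + 1 = n₀ + (2 * A.phi - 2) by omega]

theorem Starts.commit {n₀ : ℕ} (hn : 1 ≤ n₀) (hs : X.Starts n₀ u v h) :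
    X.stage (n₀ + (2 * A.phi - 2)) u = 2 * A.phi - 1 ∧
    X.part (n₀ + (2 * A.phi - 2)) u v h = true ∧
    X.bit (n₀ + (2 * A.phi - 2)) u = X.bit n₀ u := by
  have h0 := A.two_le_phi
  have h1 := stage_add_bit hs.1 hs.2.2.1 (m := 2 * A.phi - 2) le_rfl
  refine ⟨by omega, ?_, h1.2⟩
  have := (part_add hn hs.1 hs.2.1 hs.2.2.1 (h := h) (m := 2 * A.phi - 3) (by omega)).2 hs
  rwa [show n₀ + (2 * A.phi - 3) + 1 = n₀ + (2 * A.phi - 2) by omega] at this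

/-- The output value to which the participating edge `{u, v}` commits. -/
theorem Starts.val_commit {n₀ : ℕ} (hn : 1 ≤ n₀) (hs : X.Starts n₀ u v h)
    (hb : X.bit n₀ u = true) :
    X.val (n₀ + (2 * A.phi - 2) + 1) u v h =
      (X.reg (n₀ + (2 * A.phi - 2)) u).dec (p.ix u v h) ∧
    X.val (n₀ + (2 * A.phi - 2) + 1) v u h.symm =
      (X.reg (n₀ + (2 * A.phi - 2)) u).dec (p.ix u v h) := by
  have h1 := val_add_of_starts hn hs le_rfl
  have h2 := val_add_of_starts hn hs.symm le_rfl
  have h3 := hs.commit hn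
  have h4 := hs.symm.commit hn
  have hb' : X.bit n₀ v = false := by
    have := hs.2.2.2.2.1
    rw [hb] at this
    simpa using this.symm
  constructor
  · rw [val_succ (by omega) hs.1 hs.2.1, h1, h2]
    simp [h3.1, h3.2, hb]
  · rw [val_succ (by omega) hs.2.1 hs.1, h1, h2]
    simp [h4.1, h4.2, hb']

/-- Edges between good nodes have equal output registers at both endpoints: only the end of a phase
writes a new value, and it does so at both endpoints in the same round. -/
theorem consistent_succ {c : ℕ} (hc : X.CommitsFrom c) (hn : c ≤ n) : X.Consistent (n + 1) := by
  classical
  have hn1 : 1 ≤ n := hc.1.trans hn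
  have key : ∀ u v (h : G.Adj u v), u ∈ good → v ∈ good → X.val n u v h = none →
      X.val n v u h.symm = none → X.val (n + 1) u v h ≠ none →
      X.val (n + 1) u v h = X.val (n + 1) v u h.symm := by
    intro u v h hu hv h1 h2 hne
    have hval := val_succ (X := X) (h := h) hn1 hu hv
    rw [h1, h2] at hval
    simp only [ne_eq, not_true_eq_false, if_false] at hval
    by_cases hcom : X.stage n u = 2 * A.phi - 1 ∧ X.part n u v h = true
    · obtain ⟨n₀, hn₀, rfl, hs⟩ := starts_of_commit hc hn hu hv h1 h2 hcom.1 hcom.2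
      rcases hb : X.bit n₀ u
      · have hb' : X.bit n₀ v = true := by
          have := hs.2.2.2.2.1
          rw [hb] at this
          simpa using this.symm
        have := hs.symm.val_commit hn₀ hb'
        rw [this.1, this.2]
      · have := hs.val_commit hn₀ hb
        rw [this.1, this.2]
    · rw [if_neg hcom] at hval
      exact absurd hval hne
  intro u v h hu hv
  by_cases he : X.val n u v h = X.val n v u h.symm
  · rcases ho : X.val n u v h with _ | o
    · by_cases h3 : X.val (n + 1) u v h = none
      · by_cases h4 : X.val (n + 1) v u h.symm = none
        · rw [h3, h4]
        · exact (key v u h.symm hv hu (he ▸ ho) ho h4).symm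
      · exact key u v h hu hv ho (he ▸ ho) h3
    · rw [val_succ hn1 hu hv, val_succ hn1 hv hu, ← he, ho, outputs_comm (u := v)]
      exact if_congr Iff.rfl rfl (if_congr (or_congr_left or_comm) rfl rfl)
  · rw [val_succ hn1 hu hv, val_succ hn1 hv hu, if_pos he, if_pos (Ne.symm he)]

/-! ### The edge configuration -/

open Classical in
variable (X) in
/-- The configuration of the line graph; edges with an endpoint that is not good count as
undecided. -/
noncomputable def cfg (n : ℕ) (e : G.edgeSet) : Option O :=
  if h : ∃ (u v : V) (h : G.Adj u v), e = lineNode u v h ∧ u ∈ good ∧ v ∈ good ∧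
      X.val n u v h = X.val n v u h.symm then
    X.val n h.choose h.choose_spec.choose h.choose_spec.choose_spec.choose else none

theorem cfg_eq_val (hu : u ∈ good) (hv : v ∈ good) (he : X.val n u v h = X.val n v u h.symm) :
    X.cfg n (lineNode u v h) = X.val n u v h := by
  have hex : ∃ (u' v' : V) (h' : G.Adj u' v'), lineNode u v h = lineNode u' v' h' ∧ u' ∈ good ∧
      v' ∈ good ∧ X.val n u' v' h' = X.val n v' u' h'.symm := ⟨u, v, h, rfl, hu, hv, he⟩
  obtain ⟨u', v', h', he', heq⟩ : ∃ u' v' h', lineNode u v h = lineNode u' v' h' ∧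
      X.cfg n (lineNode u v h) = X.val n u' v' h' := by
    rw [cfg, dif_pos hex]
    exact ⟨_, _, _, hex.choose_spec.choose_spec.choose_spec.1, rfl⟩
  rw [heq]
  rcases lineNode_eq_lineNode he' with ⟨rfl, rfl⟩ | ⟨rfl, rfl⟩
  · rfl
  · exact he.symm

theorem cfg_eq_some {o : O} (ho : X.cfg n (lineNode u v h) = some o) :
    u ∈ good ∧ v ∈ good ∧ X.val n u v h = some o ∧ X.val n v u h.symm = some o := by
  by_cases hex : ∃ (u' v' : V) (h' : G.Adj u' v'), lineNode u v h = lineNode u' v' h' ∧ u' ∈ good ∧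
      v' ∈ good ∧ X.val n u' v' h' = X.val n v' u' h'.symm
  · obtain ⟨u', v', h', he, hu, hv, heq⟩ := hex
    rw [he, cfg_eq_val hu hv heq] at ho
    rcases lineNode_eq_lineNode he with ⟨rfl, rfl⟩ | ⟨rfl, rfl⟩
    · exact ⟨hu, hv, ho, heq ▸ ho⟩
    · exact ⟨hv, hu, heq ▸ ho, ho⟩
  · rw [cfg, dif_neg hex] at ho
    cases ho

theorem Consistent.cfg (hc : X.Consistent n) (hu : u ∈ good) (hv : v ∈ good) (h : G.Adj u v) :
    X.cfg n (lineNode u v h) = X.val n u v h := cfg_eq_val hu hv (hc u v h hu hv)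

/-- The visible output values are those of the adjacent edges, if all neighbors are good. -/
theorem outputs_eq_nbrOutputs (hc : X.Consistent n) (hu : u ∈ good) (hv : v ∈ good)
    (hu' : ∀ w, G.Adj u w → w ∈ good) (hv' : ∀ w, G.Adj v w → w ∈ good) (h : G.Adj u v) :
    X.outputs n u v h = nbrOutputs G.lineGraph (X.cfg n) (lineNode u v h) := by
  rw [nbrOutputs_lineGraph p h, outputs]
  congr 1
  · refine Multiset.filterMap_congr' _ fun q _ => ?_
    rw [hc.cfg hu (hu' _ (p.adj_nbr u q)), val, p.ix_nbr]
  · refine Multiset.filterMap_congr' _ fun q _ => ?_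
    rw [hc.cfg hv (hv' _ (p.adj_nbr v q)), val, p.ix_nbr]

end Exec

/-! ### Correctness of the simulation -/

namespace EdgeRegs

theorem clip_of_length_le {b : ℕ} {m : Option Message} (h : ∀ x, m = some x → x.length ≤ b) :
    clip b m = m := by
  rcases m with _ | x
  · rfl
  · simp [clip, Nat.ble_eq, h x rfl]

theorem getD_map_clip_take {Δ b q : ℕ} (l : List (Option Message)) (hq : q < Δ) :
    ((l.take Δ).map (clip b)).getD q none = clip b (l.getD q none) := by
  simp only [List.getD_eq_getElem?_getD, List.getElem?_map, List.getElem?_take, hq, if_true]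
  rcases l[q]? with _ | x <;> rfl

theorem getD_ofFn {n : ℕ} (f : Fin n → Option Message) (q : Fin n) :
    (List.ofFn f).getD q none = f q := by
  simp [List.getD_eq_getElem?_getD]

end EdgeRegs

theorem coinAt_mem_support {O : Type} {A : PhaseAlgorithm O} {Δ n i j : ℕ}
    (hn : n ∈ (seedCoin A.coin (Fin Δ × Fin A.phi) (Draw A.phi)).support) (hi : i < Δ)
    (hj : j < A.phi) : coinAt A Δ n i j ∈ A.coin.support := by
  rw [coinAt, dif_pos ⟨hi, hj⟩]
  exact seedDecode_mem_support A.coin hn _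

namespace Exec

variable {V O : Type} {A : PhaseAlgorithm O} {P : LCLProblem O} {Δ b : ℕ}
  {G : SimpleGraph V} {p : PortNumbering G} {good : Set V} {r : ℕ → V → ℕ}
  {X : Exec A P Δ b G p good r} {n₀ : ℕ}

variable (X) in
/-- The coins of the simulated edges in the phase that starts at time `n₀`. -/
noncomputable def simCoins (n₀ : ℕ) (x : G.edgeSet × ℕ) : ℕ :=
  coinAt A Δ (r n₀ (tail (X.bit n₀) x.1))
    (p.ix (tail (X.bit n₀) x.1) (head (X.bit n₀) x.1) (adj_tail_head _ _)) x.2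

variable (X) in
/-- The message of `e` to `f` in step `j` of the phase that starts at time `n₀`. -/
noncomputable def phaseMsg (n₀ j : ℕ) (e f : G.edgeSet) : Option Message :=
  simMsg p A (X.bit n₀) (X.startEdges n₀) (X.simCoins n₀) j e f

variable (X) in
/-- The state and the outgoing messages of the participating edge `e` after step `j` of the phase
started at time `n₀`, as prescribed by `A` on the line graph. -/
noncomputable def phaseState (n₀ j : ℕ) (e : ↥(X.startEdges n₀)) :=
  simState p A (X.bit n₀) (X.startEdges n₀) (X.simCoins n₀) j e

theorem starts_tail_head {e : G.edgeSet} (he : e ∈ X.startEdges n₀) :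
    X.Starts n₀ (tail (X.bit n₀) e) (head (X.bit n₀) e) (adj_tail_head _ _) := by
  rw [← mem_startEdges]
  exact eq_tail_head (X.bit n₀) e ▸ he

theorem part_eq_mem (hn : 1 ≤ n₀) {u : V} (hu : u ∈ good) (hu' : ∀ w, G.Adj u w → w ∈ good)
    (h1 : X.stage n₀ u = 1) {m : ℕ} (hm : m + 1 ≤ 2 * A.phi - 2) :
    (fun q => (X.reg (n₀ + m + 1) u).part q = true) =
      fun q => portEdge p u q ∈ X.startEdges n₀ := by
  funext q
  have := part_add (X := X) hn hu (hu' _ (p.adj_nbr u q)) (h := p.adj_nbr u q) h1 hm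
  rw [part, p.ix_nbr] at this
  rw [this, portEdge, mem_startEdges]

variable (X) in
/-- Before the working step `j + 1` the simulating node of `e` and the other endpoint hold the state
of `e` and the messages for `e` of the previous step. -/
def InputOf (n₀ j : ℕ) (e : ↥(X.startEdges n₀)) : Prop :=
  ∀ x y (h : G.Adj x y), tail (X.bit n₀) e.1 = x → head (X.bit n₀) e.1 = y →
    (X.reg (n₀ + 2 * j + 1) x).curState (p.ix x y h) = (X.phaseState n₀ j e).1 ∧
    (∀ q, portEdge p x q ∈ X.startEdges n₀ → q ≠ p.ix x y h →
      (X.reg (n₀ + 2 * j + 1) x).curLoc (p.ix x y h) q = X.phaseMsg n₀ j (portEdge p x q) e) ∧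
    ∀ q : Fin (p.deg y), portEdge p y q ∈ X.startEdges n₀ → q ≠ p.ix y x h.symm →
      (X.reg (n₀ + 2 * j + 1) x).curBox ((X.reg (n₀ + 2 * j + 1) y).summary Δ b
        (X.out (n₀ + 2 * j + 1) y) (p.ix y x h.symm)) q = X.phaseMsg n₀ j (portEdge p y q) e

variable (X) in
/-- After the working step `j + 1` the simulating node of `e` holds the new state of `e` and the
messages that `e` sends. -/
def OutputOf (n₀ j : ℕ) (e : ↥(X.startEdges n₀)) : Prop :=
  ∀ x y (h : G.Adj x y), tail (X.bit n₀) e.1 = x → head (X.bit n₀) e.1 = y →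
    (X.reg (n₀ + 2 * j + 3) x).st (p.ix x y h) = (X.phaseState n₀ (j + 1) e).1 ∧
    (∀ q, portEdge p x q ∈ X.startEdges n₀ → q ≠ p.ix x y h →
      (X.reg (n₀ + 2 * j + 3) x).loc (p.ix x y h) q =
        X.phaseMsg n₀ (j + 1) e (portEdge p x q)) ∧
    ∀ q : Fin (p.deg y), portEdge p y q ∈ X.startEdges n₀ → q ≠ p.ix y x h.symm →
      ((X.reg (n₀ + 2 * j + 2) x).box (p.ix x y h)).getD q none =
        X.phaseMsg n₀ (j + 1) e (portEdge p y q)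

theorem inputOf_zero (e : ↥(X.startEdges n₀)) : X.InputOf n₀ 0 e := by
  intro x y h hx hy
  have hs := starts_tail_head e.2
  have h0 := A.two_le_phi
  have hst : (X.reg (n₀ + 2 * 0 + 1) x).stage = 2 := by
    rw [← hx]
    exact (stage_add_bit hs.1 hs.2.2.1 (m := 1) (by omega)).1
  refine ⟨?_, fun q _ _ => ?_, fun q _ _ => ?_⟩
  · rw [EdgeRegs.curState, if_pos hst]
    rfl
  · rw [EdgeRegs.curLoc, if_pos hst, phaseMsg, simMsg_zero]
  · unfold EdgeRegs.curBox
    rw [if_pos hst, phaseMsg, simMsg_zero]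

/-- If the step `j + 1` of the edge `e` starts from correct information, then it is simulated
correctly. -/
theorem InputOf.outputOf {j : ℕ} {e : ↥(X.startEdges n₀)} (hI : X.InputOf n₀ j e) (hn : 1 ≤ n₀)
    (hj : j < A.phi - 2)
    (ht : ∀ w, G.Adj (tail (X.bit n₀) e.1) w → w ∈ good)
    (hh : ∀ w, G.Adj (head (X.bit n₀) e.1) w → w ∈ good) : X.OutputOf n₀ j e := by
  rintro x y h rfl rfl
  obtain ⟨h1, h2, h3⟩ := hI _ _ h rfl rfl
  have hs := starts_tail_head e.2
  have hb := (splits_of_mem e.2).bit_tail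
  set u := tail (X.bit n₀) e.1
  set v := head (X.bit n₀) e.1
  set t := n₀ + 2 * j + 1 with ht_def
  have hstb := stage_add_bit hs.1 hs.2.2.1 (m := 2 * j + 1) (by omega)
  have hstb' := stage_add_bit hs.1 hs.2.2.1 (m := 2 * j + 2) (by omega)
  have hst : (X.reg t u).stage = 2 * j + 2 := hstb.1
  have hbt : (X.reg t u).bit = true := hstb.2.trans hb
  have hst' : (X.reg (t + 1) u).stage = 2 * j + 3 := hstb'.1
  have hbt' : (X.reg (t + 1) u).bit = true := hstb'.2.trans hb
  have hwork : (X.reg t u).work Δ ((X.reg t v).summary Δ b (X.out t v) (p.ix v u h.symm))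
      (p.ix u v h) =
      ((X.phaseState n₀ (j + 1) e).1,
        slotOutFst (fun q => portEdge p u q ∈ X.startEdges n₀) (p.ix u v h)
          (fun q => portEdge p v q ∈ X.startEdges n₀) (p.ix v u h.symm)
          (X.phaseState n₀ (j + 1) e).2,
        slotOutSnd (fun q => portEdge p u q ∈ X.startEdges n₀) (p.ix u v h)
          (fun q => portEdge p v q ∈ X.startEdges n₀) (p.ix v u h.symm)
          (X.phaseState n₀ (j + 1) e).2) := by
    refine Eq.trans ?_ (simWork_eq_simState p A (x := (X.reg t u).curLoc (p.ix u v h))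
      (y := (X.reg t u).curBox ((X.reg t v).summary Δ b (X.out t v) (p.ix v u h.symm))) h2 h3)
    have hc : X.simCoins n₀ (e.1, j + 1) =
        coinAt A Δ (X.reg t u).seed (p.ix u v h) ((X.reg t u).stage / 2) := by
      have := seed_add hs.1 hs.2.2.1 (m := 2 * j) (by omega)
      have this' : (X.reg t u).seed = r n₀ u := this
      rw [this', hst, show (2 * j + 2) / 2 = j + 1 by omega]
      rfl
    change simWork (fun q => (X.reg t u).part q = true) (p.ix u v h)
      (fun q => (X.reg t v).part q = true) (p.ix v u h.symm) A ((X.reg t u).stage / 2)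
      ((X.reg t u).curState (p.ix u v h)) _ _ _ = _
    rw [part_eq_mem hn hs.1 ht hs.2.2.1 (by omega), part_eq_mem hn hs.2.1 hh hs.2.2.2.1 (by omega),
      h1, hc, hst, show (2 * j + 2) / 2 = j + 1 by omega]
    rfl
  have hr := X.reg_succ t u hs.1
  have hrc := X.rc_eq t (by omega) u v h hs.1 hs.2.1
  have hr' := X.reg_succ (t + 1) u hs.1
  have hst1 : (X.reg (t + 1) u).st (p.ix u v h) = (X.phaseState n₀ (j + 1) e).1 := by
    rw [hr]
    simp only [EdgeRegs.next, hbt, hst, true_and]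
    rw [if_pos (by omega), hrc, hwork]
  have hloc1 : (X.reg (t + 1) u).loc (p.ix u v h) =
      slotOutFst (fun q => portEdge p u q ∈ X.startEdges n₀) (p.ix u v h)
          (fun q => portEdge p v q ∈ X.startEdges n₀) (p.ix v u h.symm)
          (X.phaseState n₀ (j + 1) e).2 := by
    rw [hr]
    simp only [EdgeRegs.next, hbt, hst, true_and]
    rw [if_pos (by omega), hrc, hwork]
  have hbox1 : (X.reg (t + 1) u).box (p.ix u v h) =
      List.ofFn (slotOutSnd (fun q => portEdge p u q ∈ X.startEdges n₀) (p.ix u v h)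
          (fun q => portEdge p v q ∈ X.startEdges n₀) (p.ix v u h.symm)
          (X.phaseState n₀ (j + 1) e).2) := by
    rw [hr]
    simp only [EdgeRegs.next, hbt, hst, if_true]
    rw [if_pos (by omega), hrc]
    exact congrArg List.ofFn (congrArg (fun z => z.2.2) hwork)
  refine ⟨?_, fun q hq hne => ?_, fun q hq hne => ?_⟩
  · change (X.reg (t + 1 + 1) u).st _ = _
    rw [hr']
    simp only [EdgeRegs.next, hbt', hst', true_and]
    rw [if_neg (by omega), hst1]
  · change (X.reg (t + 1 + 1) u).loc _ _ = _
    rw [hr']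
    simp only [EdgeRegs.next, hbt', hst', true_and]
    rw [if_neg (by omega), hloc1]
    exact slotOutFst_simState p A _ _ (j + 1) e q hq hne
  · change ((X.reg (t + 1) u).box _).getD _ _ = _
    rw [hbox1, EdgeRegs.getD_ofFn]
    exact slotOutSnd_simState p A _ _ (j + 1) e q hq hne

variable (X) in
theorem simCoins_mem_support (hG : DegreeBounded Δ G)
    (hr : ∀ n v, r n v ∈ (seedCoin A.coin (Fin Δ × Fin A.phi) (Draw A.phi)).support)
    (n₀ : ℕ) (e : G.edgeSet) {j : ℕ} (hj : j < A.phi) :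
    X.simCoins n₀ (e, j) ∈ A.coin.support :=
  coinAt_mem_support (hr _ _) (lt_of_lt_of_le (Fin.is_lt _) (p.deg_le hG _)) hj

theorem tail_eq {u v : V} {h : G.Adj u v} (hs : X.Starts n₀ u v h) (hb : X.bit n₀ u = true) :
    tail (X.bit n₀) (lineNode u v h) = u ∧ head (X.bit n₀) (lineNode u v h) = v := by
  refine Splits.tail_lineNode hb ?_
  have := hs.2.2.2.2.1
  rw [hb] at this
  simpa using this.symm

/-- The messages for `e` reach the places where they are needed for the next working step. Those
from edges at the tail of `e` are computed by the tail itself. Those from an edge at the head of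
`e` are computed by the tail of that edge, told to the head in one round and forwarded to the tail
of `e` in the next. Truncation is harmless, as the messages of `A` have at most `b` bits. -/
theorem InputOf.succ {j : ℕ} {e : ↥(X.startEdges n₀)} (hn : 1 ≤ n₀) (hj : j + 1 ≤ A.phi - 2)
    (hG : DegreeBounded Δ G) (hA : A.MessagesAtMost (2 * Δ - 2) b)
    (hr : ∀ n v, r n v ∈ (seedCoin A.coin (Fin Δ × Fin A.phi) (Draw A.phi)).support)
    (h0 : X.OutputOf n₀ j e)
    (hO : ∀ f : ↥(X.startEdges n₀), G.lineGraph.Adj e.1 f.1 → X.OutputOf n₀ j f) :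
    X.InputOf n₀ (j + 1) e := by
  rintro x y h rfl rfl
  have hs := starts_tail_head e.2
  have hb := (splits_of_mem e.2).bit_tail
  have hb' := (splits_of_mem e.2).bit_head
  set u := tail (X.bit n₀) e.1 with hu_def
  set v := head (X.bit n₀) e.1 with hv_def
  have hst : (X.reg (n₀ + 2 * (j + 1) + 1) u).stage = 2 * j + 4 :=
    (stage_add_bit hs.1 hs.2.2.1 (m := 2 * (j + 1) + 1) (by omega)).1
  have hne2 : ¬ (X.reg (n₀ + 2 * (j + 1) + 1) u).stage = 2 := by omega
  have hlen : ∀ f g m, X.phaseMsg n₀ (j + 1) f g = some m → m.length ≤ b := fun f g m hm =>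
    length_simMsg_le p A _ _ hG hA hj
      (fun e _ j hj => X.simCoins_mem_support hG hr n₀ e hj) hm
  have he : lineNode u v h = e.1 := (eq_tail_head (X.bit n₀) e.1).symm
  refine ⟨?_, fun q hq hne => ?_, fun q hq hne => ?_⟩
  · rw [EdgeRegs.curState, if_neg hne2]
    exact (h0 _ _ h rfl rfl).1
  · rw [EdgeRegs.curLoc, if_neg hne2]
    have hsq := mem_startEdges.1 hq
    have htq := tail_eq hsq hb
    have := (hO ⟨_, hq⟩ (adj_portEdge_tail p _ e hne) u _ (p.adj_nbr u q) htq.1 htq.2).2.1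
      (p.ix u v h) (by rw [portEdge_ix, he]; exact e.2) (by rw [p.ix_nbr]; exact hne.symm)
    rw [p.ix_nbr, portEdge_ix, he] at this
    exact this
  · unfold EdgeRegs.curBox
    rw [if_neg hne2]
    have hsq := mem_startEdges.1 hq
    have hsq' := hsq.symm
    set w := p.nbr v q with hw
    have hbw : X.bit n₀ w = true := by
      have := hsq.2.2.2.2.1
      rw [hb'] at this
      simpa using this.symm
    have hmem : lineNode w v (p.adj_nbr v q).symm ∈ X.startEdges n₀ := mem_startEdges.2 hsq'
    have htq := tail_eq hsq' hbw
    have hadj : G.lineGraph.Adj e.1 (lineNode w v (p.adj_nbr v q).symm) := by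
      rw [lineNode_comm]
      exact adj_portEdge_head p _ e hne
    have hout := (hO ⟨_, hmem⟩ hadj w v (p.adj_nbr v q).symm htq.1 htq.2).2.2
      (p.ix v u h.symm) (by rw [portEdge_ix, lineNode_comm, he]; exact e.2)
      (by rw [p.ix_nbr]; exact hne.symm)
    rw [portEdge_ix, lineNode_comm v u, he] at hout
    replace hout := hout.trans (congrArg (fun f => X.phaseMsg n₀ (j + 1) f e.1)
      (lineNode_comm w v (p.adj_nbr v q).symm))
    have hq2 : (q : ℕ) < Δ := lt_of_lt_of_le q.2 (p.deg_le hG _)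
    have hi2 : (p.ix v u h.symm : ℕ) < Δ := lt_of_lt_of_le (Fin.is_lt _) (p.deg_le hG _)
    change List.getD (((X.reg (n₀ + 2 * j + 2 + 1) v).box _ |>.take Δ).map
      (EdgeRegs.clip b)) q none = _
    have hbv : (X.reg (n₀ + 2 * j + 2) v).bit = false :=
      (stage_add_bit hs.2.1 hs.2.2.2.1 (m := 2 * j + 2) (by omega)).2.trans hb'
    rw [EdgeRegs.getD_map_clip_take _ hq2, X.reg_succ _ v hs.2.1]
    simp only [EdgeRegs.next, hbv, Bool.false_eq_true, if_false]
    rw [EdgeRegs.getD_ofFn]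
    have hrc := X.rc_eq (n₀ + 2 * j + 2) (by omega) v w (p.adj_nbr v q) hs.2.1 hsq'.1
    rw [p.ix_nbr] at hrc
    rw [hrc]
    change EdgeRegs.clip b (List.getD (List.map _ (List.take Δ
      ((X.reg (n₀ + 2 * j + 2) w).box _))) _ none) = _
    rw [EdgeRegs.getD_map_clip_take _ hi2, hout]
    rw [EdgeRegs.clip_of_length_le (hlen _ _), EdgeRegs.clip_of_length_le (hlen _ _)]
    rfl

/-- The simulation is correct at distance from the nodes that are not good; each working step
extends the dependence by one unit of the rank `k`. -/
theorem inputOf {k : V → ℕ} (hk0 : ∀ v, 0 < k v → v ∈ good)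
    (hk1 : ∀ u v, G.Adj u v → k u ≤ k v + 1) (hn : 1 ≤ n₀) (hG : DegreeBounded Δ G)
    (hA : A.MessagesAtMost (2 * Δ - 2) b)
    (hr : ∀ n v, r n v ∈ (seedCoin A.coin (Fin Δ × Fin A.phi) (Draw A.phi)).support) (j : ℕ) :
    ∀ e : ↥(X.startEdges n₀), j ≤ A.phi - 2 →
    j + 2 ≤ k (tail (X.bit n₀) e.1) → j + 2 ≤ k (head (X.bit n₀) e.1) → X.InputOf n₀ j e := by
  have hnb : ∀ x, 2 ≤ k x → ∀ w, G.Adj x w → w ∈ good := fun x hx w hw =>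
    hk0 _ (by have := hk1 x w hw; omega)
  induction j with
  | zero => exact fun e _ _ _ => inputOf_zero e
  | succ j ih =>
    intro e hj ht hh
    refine InputOf.succ hn hj hG hA hr
      ((ih e (by omega) (by omega) (by omega)).outputOf hn (by omega) (hnb _ (by omega))
        (hnb _ (by omega))) ?_
    intro f hf
    have hkf : ∀ x y (h : G.Adj x y), f.1 = lineNode x y h → j + 2 ≤ k x → j + 2 ≤ k y →
        j + 2 ≤ k (tail (X.bit n₀) f.1) ∧ j + 2 ≤ k (head (X.bit n₀) f.1) := by
      intro x y h he hx hy
      have h1 := (eq_tail_head (X.bit n₀) f.1).symm.trans he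
      rcases lineNode_eq_lineNode h1 with ⟨h2, h3⟩ | ⟨h2, h3⟩
      · exact ⟨by rw [h2]; exact hx, by rw [h3]; exact hy⟩
      · exact ⟨by rw [h2]; exact hy, by rw [h3]; exact hx⟩
    have hkf' : j + 2 ≤ k (tail (X.bit n₀) f.1) ∧ j + 2 ≤ k (head (X.bit n₀) f.1) := by
      have hf' : G.lineGraph.Adj (lineNode _ _ (adj_tail_head (X.bit n₀) e.1)) f.1 := by
        rw [← eq_tail_head]
        exact hf
      rcases lineGraph_adj_lineNode hf' with ⟨w, h', -, he⟩ | ⟨w, h', -, he⟩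
      · exact hkf _ _ h' he (by omega) (by have := hk1 _ _ h'; omega)
      · exact hkf _ _ h' he (by omega) (by have := hk1 _ _ h'; omega)
    exact (ih f (by omega) hkf'.1 hkf'.2).outputOf hn (by omega) (hnb _ (by omega))
      (hnb _ (by omega))

end Exec

/-! ### The dynamics of the edge configuration -/

namespace Exec

variable {V O : Type} {A : PhaseAlgorithm O} {P : LCLProblem O} {Δ b : ℕ}
  {G : SimpleGraph V} {p : PortNumbering G} {good : Set V} {r : ℕ → V → ℕ}
  {X : Exec A P Δ b G p good r} {n n₀ : ℕ} {u v : V} {h : G.Adj u v}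

/-- The decision of a participating edge whose input before the last working step is correct. -/
theorem InputOf.dec {e : ↥(X.startEdges n₀)} (hI : X.InputOf n₀ (A.phi - 2) e) (hn : 1 ≤ n₀)
    (ht : ∀ w, G.Adj (tail (X.bit n₀) e.1) w → w ∈ good)
    (hh : ∀ w, G.Adj (head (X.bit n₀) e.1) w → w ∈ good)
    (hc : X.Consistent (n₀ + 2 * (A.phi - 2) + 1)) {C : G.edgeSet → Option O}
    (hC : nbrOutputs G.lineGraph (X.cfg (n₀ + 2 * (A.phi - 2) + 1)) e.1 =
      nbrOutputs G.lineGraph C e.1) :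
    (X.reg (n₀ + (2 * A.phi - 2)) (tail (X.bit n₀) e.1)).dec
      (p.ix (tail (X.bit n₀) e.1) (head (X.bit n₀) e.1) (adj_tail_head _ _)) =
    A.phaseOn G.lineGraph C (X.startEdges n₀) (linePorts p (X.bit n₀) (X.startEdges n₀))
      (X.simCoins n₀) e := by
  obtain ⟨h1, h2, h3⟩ := hI _ _ (adj_tail_head _ _) rfl rfl
  have h0 := A.two_le_phi
  have hs := starts_tail_head e.2
  have hb := (splits_of_mem e.2).bit_tail
  have hM := outputs_eq_nbrOutputs (X := X) hc hs.1 hs.2.1 ht hh (adj_tail_head (X.bit n₀) e.1)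
  rw [← eq_tail_head, hC] at hM
  set u := tail (X.bit n₀) e.1
  set v := head (X.bit n₀) e.1
  have h : G.Adj u v := adj_tail_head _ _
  set t := n₀ + 2 * (A.phi - 2) + 1 with ht_def
  have hstb := stage_add_bit hs.1 hs.2.2.1 (m := 2 * (A.phi - 2) + 1) (by omega)
  have hst : (X.reg t u).stage = 2 * (A.phi - 2) + 2 := hstb.1
  have hbt : (X.reg t u).bit = true := hstb.2.trans hb
  have hrc := X.rc_eq t (by omega) u v h hs.1 hs.2.1
  rw [show n₀ + (2 * A.phi - 2) = t + 1 by omega, X.reg_succ t u hs.1]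
  simp only [EdgeRegs.next, hbt, hst, true_and]
  rw [if_pos (by omega), adjacentOutputs_eq (by omega) hs.1 hs.2.1 h, hrc, hM]
  refine Eq.trans ?_ (simDecision_eq_phaseOn p A (x := (X.reg t u).curLoc (p.ix u v h))
    (y := (X.reg t u).curBox ((X.reg t v).summary Δ b (X.out t v) (p.ix v u h.symm))) h2 h3 C)
  have hcoin : X.simCoins n₀ (e.1, A.phi - 1) =
      coinAt A Δ (X.reg t u).seed (p.ix u v h) (A.phi - 1) := by
    have := seed_add hs.1 hs.2.2.1 (m := 2 * (A.phi - 2)) (by omega)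
    have this' : (X.reg t u).seed = r n₀ u := this
    rw [this']
    rfl
  change simDecision (fun q => (X.reg t u).part q = true) (p.ix u v h)
    (fun q => (X.reg t v).part q = true) (p.ix v u h.symm) A
    ((X.reg t u).curState (p.ix u v h)) _ _ _ _ = _
  rw [part_eq_mem hn hs.1 ht hs.2.2.1 (by omega), part_eq_mem hn hs.2.1 hh hs.2.2.2.1 (by omega),
    h1, hcoin]
  rfl

/-- An output value is only lost by an edge that is uncontent and not protected. -/
theorem cfg_succ_of_some {o : O} (hn : 1 ≤ n) (hc' : X.Consistent (n + 1))
    (ho : X.cfg n (lineNode u v h) = some o) :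
    X.cfg (n + 1) (lineNode u v h) = some o ∨ X.cfg (n + 1) (lineNode u v h) = none ∧
      ¬ X.Held n u v ∧ ¬ P.ok o (X.outputs n u v h) := by
  classical
  obtain ⟨hu, hv, h1, h2⟩ := cfg_eq_some ho
  rw [hc'.cfg hu hv, val_succ hn hu hv, h1, h2]
  simp only [ne_eq, not_true_eq_false, if_false]
  by_cases hh : X.Held n u v ∨ P.ok o (X.outputs n u v h)
  · exact Or.inl (if_pos hh)
  · exact Or.inr ⟨if_neg hh, not_or.1 hh⟩

theorem cfg_succ_eq_none {o : O} (hn : 1 ≤ n) (hc' : X.Consistent (n + 1))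
    (ho : X.cfg n (lineNode u v h) = some o) (hh : ¬ X.Held n u v)
    (hok : ¬ P.ok o (X.outputs n u v h)) : X.cfg (n + 1) (lineNode u v h) = none := by
  classical
  obtain ⟨hu, hv, h1, h2⟩ := cfg_eq_some ho
  rw [hc'.cfg hu hv, val_succ hn hu hv, h1, h2]
  simp only [ne_eq, not_true_eq_false, if_false]
  exact if_neg (not_or.2 ⟨hh, hok⟩)

/-- An edge becomes decided only at the end of a phase that it started. -/
theorem cfg_succ_of_none {c : ℕ} (hc : X.CommitsFrom c) (hn : c ≤ n) (hn' : X.Consistent n)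
    (h0 : X.cfg n (lineNode u v h) = none) (h1 : X.cfg (n + 1) (lineNode u v h) ≠ none) :
    ∃ n₀, 1 ≤ n₀ ∧ n = n₀ + (2 * A.phi - 2) ∧ X.Starts n₀ u v h := by
  obtain ⟨o, ho⟩ := Option.ne_none_iff_exists'.1 h1
  obtain ⟨hu, hv, h2, h3⟩ := cfg_eq_some ho
  rw [hn'.cfg hu hv] at h0
  have h0' := (hn' u v h hu hv).symm.trans h0
  have hval := val_succ (X := X) (h := h) (hc.1.trans hn) hu hv
  rw [h0, h0'] at hval
  simp only [ne_eq, not_true_eq_false, if_false] at hval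
  by_cases hcom : X.stage n u = 2 * A.phi - 1 ∧ X.part n u v h = true
  · exact starts_of_commit hc hn hu hv h0 h0' hcom.1 hcom.2
  · rw [if_neg hcom, h2] at hval
    cases hval

theorem cfg_of_starts (hn : 1 ≤ n₀) (hs : X.Starts n₀ u v h) {m : ℕ} (hm : m ≤ 2 * A.phi - 2) :
    X.cfg (n₀ + m) (lineNode u v h) = none := by
  have h1 := val_add_of_starts hn hs hm
  rw [cfg_eq_val hs.1 hs.2.1 (h1.trans (val_add_of_starts hn hs.symm hm).symm), h1]

/-- The edges next to a participating edge keep their output values in the round in which the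
decision is computed. -/
theorem cfg_eq_of_decision {c : ℕ} (hc : X.CommitsFrom c) (hn : 1 ≤ n) (hcn : c ≤ n)
    (h1 : X.Consistent n) (hs : X.stage n u = 2 * A.phi - 2) :
    X.cfg (n + 1) (lineNode u v h) = X.cfg n (lineNode u v h) := by
  have h0 := A.two_le_phi
  have h2 := consistent_succ hc hcn
  rcases ho : X.cfg n (lineNode u v h) with _ | o
  · by_contra hne
    obtain ⟨n₀, hn₀, rfl, hst⟩ := cfg_succ_of_none hc hcn h1 ho hne
    have := (hst.commit hn₀).1
    omega
  · rcases cfg_succ_of_some hn h2 ho with h3 | h3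
    · exact h3
    · exact absurd (Or.inl hs) h3.2.1

/-- The effect of a phase of the simulated algorithm. -/
theorem cfg_commit {k : V → ℕ} (hk0 : ∀ v, 0 < k v → v ∈ good)
    (hk1 : ∀ u v, G.Adj u v → k u ≤ k v + 1) (hn : 1 ≤ n₀) (hG : DegreeBounded Δ G)
    (hA : A.MessagesAtMost (2 * Δ - 2) b)
    (hr : ∀ n v, r n v ∈ (seedCoin A.coin (Fin Δ × Fin A.phi) (Draw A.phi)).support)
    {c : ℕ} (hc : X.CommitsFrom c) (hcn : c ≤ n₀ + 2 * (A.phi - 2) + 1)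
    (hcon : X.Consistent (n₀ + 2 * (A.phi - 2) + 1)) {e : G.edgeSet} (he : e ∈ X.startEdges n₀)
    (hke : ∀ u v h, e = lineNode u v h → A.phi ≤ k u) :
    X.cfg (n₀ + (2 * A.phi - 2) + 1) e =
      A.phaseOn G.lineGraph (X.cfg (n₀ + (2 * A.phi - 2))) (X.startEdges n₀)
        (linePorts p (X.bit n₀) (X.startEdges n₀)) (X.simCoins n₀) e := by
  have h0 := A.two_le_phi
  have hs := starts_tail_head he
  have hb := (splits_of_mem he).bit_tail
  have ht := hke _ _ _ (eq_tail_head (X.bit n₀) e)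
  have hh := hke _ _ _ ((eq_tail_head (X.bit n₀) e).trans (lineNode_comm _ _ _))
  have hnb : ∀ x, 2 ≤ k x → ∀ w, G.Adj x w → w ∈ good := fun x hx w hw =>
    hk0 _ (by have := hk1 x w hw; omega)
  have hI := inputOf (X := X) hk0 hk1 hn hG hA hr (A.phi - 2) ⟨e, he⟩ le_rfl
    (by change _ ≤ k (tail (X.bit n₀) e); omega) (by change _ ≤ k (head (X.bit n₀) e); omega)
  have hv := hs.val_commit hn hb
  have hst : X.stage (n₀ + 2 * (A.phi - 2) + 1) (tail (X.bit n₀) e) = 2 * A.phi - 2 := by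
    have := (stage_add_bit hs.1 hs.2.2.1 (m := 2 * (A.phi - 2) + 1) (by omega)).1
    rw [add_assoc, this]
    omega
  have hst' : X.stage (n₀ + 2 * (A.phi - 2) + 1) (head (X.bit n₀) e) = 2 * A.phi - 2 := by
    have := (stage_add_bit hs.2.1 hs.2.2.2.1 (m := 2 * (A.phi - 2) + 1) (by omega)).1
    rw [add_assoc, this]
    omega
  have hM : nbrOutputs G.lineGraph (X.cfg (n₀ + 2 * (A.phi - 2) + 1)) e =
      nbrOutputs G.lineGraph (X.cfg (n₀ + (2 * A.phi - 2))) e := by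
    refine nbrOutputs_congr fun f hf => ?_
    rw [show n₀ + (2 * A.phi - 2) = n₀ + 2 * (A.phi - 2) + 1 + 1 by omega]
    have hf' : G.lineGraph.Adj (lineNode _ _ (adj_tail_head (X.bit n₀) e)) f := by
      rw [← eq_tail_head]
      exact hf
    rcases lineGraph_adj_lineNode hf' with ⟨w, h', -, rfl⟩ | ⟨w, h', -, rfl⟩
    · exact (cfg_eq_of_decision hc (by omega) hcn hcon hst).symm
    · exact (cfg_eq_of_decision hc (by omega) hcn hcon hst').symm
  conv_lhs => rw [eq_tail_head (X.bit n₀) e]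
  rw [cfg_eq_val hs.1 hs.2.1 (hv.1.trans hv.2.symm), hv.1]
  exact hI.dec hn (hnb _ (by change 2 ≤ k (tail (X.bit n₀) e); omega))
    (hnb _ (by change 2 ≤ k (head (X.bit n₀) e); omega)) hcon hM

end Exec

/-! ### Cores -/

theorem LCLProblem.exists_core {O : Type} {P : LCLProblem O} {o : O} {M : Multiset O}
    (h : P.ok o M) : ∃ M₀ ≤ M, Minimal (P.ok o) M₀ :=
  exists_minimal_le_of_wellFoundedLT _ M h

/-- A core that is visible in `C` is visible in `C'` if all its elements are kept. -/
theorem le_nbrOutputs_of_kept {O V : Type} {D : ℕ} {G : SimpleGraph V} (hG : DegreeBounded D G)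
    {C C' : V → Option O} {v : V} {M₀ : Multiset O} (hM : M₀ ≤ nbrOutputs G C v)
    (hk : ∀ w, G.Adj v w → ∀ o ∈ M₀, C w = some o → C' w = some o) :
    M₀ ≤ nbrOutputs G C' v := by
  classical
  have hf := hG.finite_neighborSet v
  have h1 : M₀ ≤ (nbrOutputs G C v).filter (· ∈ M₀) := by
    have := Multiset.filter_le_filter (· ∈ M₀) hM
    rwa [Multiset.filter_eq_self.2 fun _ h => h] at this
  refine h1.trans ?_
  have h2 : (nbrOutputs G C v).filter (· ∈ M₀) =
      nbrOutputs G (fun w => (C w).filter fun o => decide (o ∈ M₀)) v := by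
    rw [nbrOutputs_eq hf, nbrOutputs_eq hf, Multiset.filter_filterMap]
  rw [h2]
  refine nbrOutputs_mono fun w hw o ho => ?_
  rw [Option.filter_eq_some_iff] at ho
  exact hk w hw o (by simpa using ho.2) ho.1

/-- If a node that was content becomes uncontent because of the loss of the outputs of some of its
neighbors, then one of the lost outputs supports it. -/
theorem LCLProblem.CoreCoverage.exists_lost {O V : Type} {P : LCLProblem O} (hP : P.CoreCoverage)
    {D : ℕ} {G : SimpleGraph V} (hG : DegreeBounded D G) {C C' : V → Option O} {v : V} {o : O}
    (h1 : P.ok o (nbrOutputs G C v)) (h2 : ¬ P.ok o (nbrOutputs G C' v))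
    (h3 : ∀ w, G.Adj v w → C' w = none ∨ C' w = C w) :
    ∃ w, G.Adj v w ∧ ∃ o', C w = some o' ∧ C' w = none ∧ P.Supports o o' := by
  obtain ⟨M₀, hM₀, hmin⟩ := P.exists_core h1
  by_contra hne
  push Not at hne
  refine h2 ((hP o).2 M₀ _ _ (le_nbrOutputs_of_kept hG hM₀ fun w hw o' ho' hC => ?_)
    (nbrOutputs_mono fun w hw o' ho' => ?_) hmin.1 h1)
  · rcases h3 w hw with h | h
    · exact absurd ⟨M₀, hmin, ho'⟩ (hne w hw o' hC h)
    · rw [h, hC]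
  · rcases h3 w hw with h | h
    · rw [h] at ho'
      cases ho'
    · rw [← h, ho']

/-- All directed walks from `o` in the supportive digraph have at most `m` edges. -/
def LCLProblem.InfluenceAtMost {O : Type} (P : LCLProblem O) (m : ℕ) (o : O) : Prop :=
  ∀ l : List O, (o :: l).IsChain P.Supports → l.length ≤ m

theorem LCLProblem.BoundedInfluence.influenceAtMost {O : Type} {P : LCLProblem O} {ν : ℕ}
    (h : P.BoundedInfluence ν) (o : O) : P.InfluenceAtMost ν o := fun l hl => by
  have := h _ hl
  simpa using this

theorem LCLProblem.InfluenceAtMost.supports {O : Type} {P : LCLProblem O} {m : ℕ} {o o' : O}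
    (h : P.InfluenceAtMost m o) (hs : P.Supports o o') :
    ∃ m', m = m' + 1 ∧ P.InfluenceAtMost m' o' := by
  have key : ∀ l : List O, (o' :: l).IsChain P.Supports → l.length + 1 ≤ m := fun l hl =>
    h (o' :: l) (List.isChain_cons_cons.2 ⟨hs, hl⟩)
  have h1 := key [] (List.isChain_singleton o')
  refine ⟨m - 1, by simp at h1; omega, fun l hl => ?_⟩
  have := key l hl
  omega

/-! ### Influence and recovery -/

section Deep

variable {V : Type} {G : SimpleGraph V} {k : V → ℕ}

/-- Both endpoints of `e` have rank at least `m`. -/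
def Deep (k : V → ℕ) (m : ℕ) (e : G.edgeSet) : Prop := ∀ v ∈ (e : Sym2 V), m ≤ k v

theorem deep_lineNode {m : ℕ} {u v : V} {h : G.Adj u v} :
    Deep k m (lineNode u v h) ↔ m ≤ k u ∧ m ≤ k v := by
  simp [Deep, lineNode]

theorem Deep.mono {m m' : ℕ} {e : G.edgeSet} (h : Deep k m e) (hm : m' ≤ m) : Deep k m' e :=
  fun v hv => hm.trans (h v hv)

theorem Deep.adj (hk1 : ∀ u v, G.Adj u v → k u ≤ k v + 1) {m : ℕ} {e f : G.edgeSet}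
    (h : Deep k (m + 1) e) (hf : G.lineGraph.Adj e f) : Deep k m f := by
  obtain ⟨u, v, huv, rfl⟩ := exists_lineNode e
  rw [deep_lineNode] at h
  rcases lineGraph_adj_lineNode hf with ⟨w, h', -, rfl⟩ | ⟨w, h', -, rfl⟩
  · have := hk1 _ _ h'
    rw [deep_lineNode]
    omega
  · have := hk1 _ _ h'
    rw [deep_lineNode]
    omega

end Deep

/-- The assumptions on the problem, the simulated algorithm, the graph and the coins. -/
structure Admissible {V O : Type} (A : PhaseAlgorithm O) (P : LCLProblem O) (Δ b : ℕ)
    (G : SimpleGraph V) (r : ℕ → V → ℕ) : Prop where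
  core : P.CoreCoverage
  respectful : A.RespectfulDecisions P (2 * Δ - 2)
  short : A.MessagesAtMost (2 * Δ - 2) b
  bounded : DegreeBounded Δ G
  isInstance : P.Instance (2 * Δ - 2) G.lineGraph
  support : ∀ n v, r n v ∈ (seedCoin A.coin (Fin Δ × Fin A.phi) (Draw A.phi)).support

namespace Exec

variable {V O : Type} {A : PhaseAlgorithm O} {P : LCLProblem O} {Δ b : ℕ}
  {G : SimpleGraph V} {p : PortNumbering G} {good : Set V} {r : ℕ → V → ℕ}
  {X : Exec A P Δ b G p good r} {n n₀ c : ℕ} {k : V → ℕ}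

variable (X) in
/-- From time `c` on, the edges between good nodes are port-consistent and commitments result from
phases that started at positive times. -/
def SteadyFrom (c : ℕ) : Prop := X.CommitsFrom c ∧ ∀ n, c ≤ n → X.Consistent n

theorem steadyFrom_two_mul_phi : X.SteadyFrom (2 * A.phi) := by
  have h0 := A.two_le_phi
  have h1 := commitsFrom_two_mul_phi (X := X)
  refine ⟨⟨by omega, fun n hn => h1.2 n (by omega)⟩, fun n hn => ?_⟩
  obtain ⟨n, rfl⟩ : ∃ m, n = m + 1 := ⟨n - 1, by omega⟩
  exact consistent_succ h1 (by omega)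

theorem steadyFrom_one (h1 : ∀ u v (h : G.Adj u v), u ∈ good → v ∈ good → X.val 1 u v h ≠ none)
    (h2 : X.Consistent 1) : X.SteadyFrom 1 := by
  refine ⟨commitsFrom_one h1, fun n hn => ?_⟩
  rcases n with _ | _ | n
  · omega
  · exact h2
  · exact consistent_succ (commitsFrom_one h1) (by omega)

theorem outputs_eq_of_deep (hk0 : ∀ v, 0 < k v → v ∈ good)
    (hk1 : ∀ u v, G.Adj u v → k u ≤ k v + 1) (hc : X.Consistent n) {u v : V} {h : G.Adj u v}
    (hd : Deep k 2 (lineNode u v h)) :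
    X.outputs n u v h = nbrOutputs G.lineGraph (X.cfg n) (lineNode u v h) := by
  rw [deep_lineNode] at hd
  have hnb : ∀ x, 2 ≤ k x → ∀ w, G.Adj x w → w ∈ good := fun x hx w hw =>
    hk0 _ (by have := hk1 x w hw; omega)
  exact outputs_eq_nbrOutputs hc (hk0 u (by omega)) (hk0 v (by omega)) (hnb u hd.1) (hnb v hd.2) h

/-- Up to the loss of the outputs of some uncontent edges, a round leads to a configuration `C'`
that extends the current configuration by respectful decisions. -/
theorem exists_respectful_extension (hk0 : ∀ v, 0 < k v → v ∈ good)
    (hk1 : ∀ u v, G.Adj u v → k u ≤ k v + 1) (hadm : Admissible A P Δ b G r)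
    (hs : X.SteadyFrom c) (hcn : c ≤ n) (hn : c + 1 ≤ n ∨ n < 2 * A.phi - 1) :
    ∃ C' : G.edgeSet → Option O,
      (∀ e, Content P G.lineGraph (X.cfg n) e → Content P G.lineGraph C' e) ∧
      (∀ e o, X.cfg n e = some o → C' e = some o) ∧
      ∀ e, Deep k A.phi e →
        (X.cfg (n + 1) e = C' e ∨
          X.cfg (n + 1) e = none ∧ Uncontent P G.lineGraph (X.cfg n) e) ∧
        (X.cfg n e = none → X.cfg (n + 1) e ≠ none → Content P G.lineGraph C' e) := by
  have h0 := A.two_le_phi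
  have hlost : ∀ e, Deep k A.phi e → ∀ o, X.cfg n e = some o →
      X.cfg (n + 1) e = some o ∨
        X.cfg (n + 1) e = none ∧ Uncontent P G.lineGraph (X.cfg n) e := by
    intro e hd o ho
    obtain ⟨u, v, h, rfl⟩ := exists_lineNode e
    rcases cfg_succ_of_some (hs.1.1.trans hcn) (hs.2 _ (by omega)) ho with h1 | h1
    · exact Or.inl h1
    · refine Or.inr ⟨h1.1, o, ho, ?_⟩
      rw [← outputs_eq_of_deep hk0 hk1 (hs.2 n hcn) (hd.mono h0)]
      exact h1.2.2
  have hgain : ∀ e, X.cfg n e = none → X.cfg (n + 1) e ≠ none →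
      ∃ n₀, 1 ≤ n₀ ∧ n = n₀ + (2 * A.phi - 2) ∧ e ∈ X.startEdges n₀ := by
    intro e h1 h2
    obtain ⟨u, v, h, rfl⟩ := exists_lineNode e
    obtain ⟨n₀, h3, h4, h5⟩ := cfg_succ_of_none hs.1 hcn (hs.2 n hcn) h1 h2
    exact ⟨n₀, h3, h4, mem_startEdges.2 h5⟩
  by_cases hph : 2 * A.phi - 1 ≤ n
  · -- All decisions written in this round belong to the phases started at the same time `n₀`.
    obtain ⟨n₀, rfl⟩ : ∃ n₀, n = n₀ + (2 * A.phi - 2) := ⟨n - (2 * A.phi - 2), by omega⟩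
    have hn₀ : 1 ≤ n₀ := by omega
    have hW : ∀ e ∈ X.startEdges n₀, X.cfg (n₀ + (2 * A.phi - 2)) e = none := by
      rintro _ ⟨u, v, h, rfl, hst⟩
      exact cfg_of_starts hn₀ hst le_rfl
    obtain ⟨ρ, hρ, hρ'⟩ := PhaseAlgorithm.exists_phaseOn_eq (A := A) (G := G.lineGraph)
      (C := X.cfg (n₀ + (2 * A.phi - 2))) (W := X.startEdges n₀)
      (p := linePorts p (X.bit n₀) (X.startEdges n₀)) (r := X.simCoins n₀)
      fun e j hj => X.simCoins_mem_support hadm.bounded hadm.support n₀ e hj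
    refine ⟨A.phaseOn G.lineGraph (X.cfg (n₀ + (2 * A.phi - 2))) (X.startEdges n₀)
        (linePorts p (X.bit n₀) (X.startEdges n₀)) (X.simCoins n₀), fun e he => ?_,
        fun e o ho => PhaseAlgorithm.phaseOn_of_decided hW ho _, fun e hd => ?_⟩
    · rw [← hρ']
      exact hadm.respectful.content_phaseOn hadm.isInstance hW hρ e (Or.inl he)
    · by_cases he : e ∈ X.startEdges n₀
      · have heq := cfg_commit (X := X) hk0 hk1 hn₀ hadm.bounded hadm.short hadm.support hs.1
          (by omega) (hs.2 _ (by omega)) he fun u v h hlin => by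
            rw [hlin, deep_lineNode] at hd
            exact hd.1
        refine ⟨Or.inl heq, fun _ hne => ?_⟩
        rw [heq] at hne
        rw [← hρ'] at hne ⊢
        exact hadm.respectful.content_phaseOn hadm.isInstance hW hρ e (Or.inr ⟨he, hne⟩)
      · rw [PhaseAlgorithm.phaseOn_of_notMem he]
        have hno : X.cfg (n₀ + (2 * A.phi - 2)) e = none →
            X.cfg (n₀ + (2 * A.phi - 2) + 1) e = none := by
          intro h1
          by_contra h2
          obtain ⟨n₁, h3, h4, h5⟩ := hgain e h1 h2
          obtain rfl : n₀ = n₁ := by omega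
          exact he h5
        refine ⟨?_, fun h1 h2 => absurd (hno h1) h2⟩
        rcases ho : X.cfg (n₀ + (2 * A.phi - 2)) e with _ | o
        · exact Or.inl (hno ho)
        · exact hlost e hd o ho
  · have hno : ∀ e, X.cfg n e = none → X.cfg (n + 1) e = none := by
      intro e h1
      by_contra h2
      obtain ⟨n₀, h3, h4, h5⟩ := hgain e h1 h2
      omega
    refine ⟨X.cfg n, fun _ h => h, fun _ _ h => h, fun e hd => ⟨?_, fun h1 h2 =>
      absurd (hno e h1) h2⟩⟩
    rcases ho : X.cfg n e with _ | o
    · exact Or.inl (hno e ho)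
    · exact hlost e hd o ho

/-- Edges far from the nodes that are not good keep their original output values: the distance
needed grows with the height of the output value in the supportive digraph. -/
theorem cfg_eq_of_deep (hk0 : ∀ v, 0 < k v → v ∈ good)
    (hk1 : ∀ u v, G.Adj u v → k u ≤ k v + 1) (hadm : Admissible A P Δ b G r)
    (hs : X.SteadyFrom 1)
    (h1 : ∀ e, Deep k 2 e → Content P G.lineGraph (X.cfg 1) e) (n : ℕ) (hn : 1 ≤ n) :
    ∀ e o m, X.cfg 1 e = some o → P.InfluenceAtMost m o → Deep k (A.phi + 1 + m) e →
      X.cfg n e = some o ∧ Content P G.lineGraph (X.cfg n) e := by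
  have h0 := A.two_le_phi
  induction n, hn using Nat.le_induction with
  | base => exact fun e o m ho _ hd => ⟨ho, h1 e (hd.mono (by omega))⟩
  | succ n hn ih =>
    obtain ⟨C', hC1, hC2, hC3⟩ := exists_respectful_extension hk0 hk1 hadm hs hn (by omega)
    have hkeep : ∀ e o m, X.cfg 1 e = some o → P.InfluenceAtMost m o →
        Deep k (A.phi + 1 + m) e → X.cfg (n + 1) e = some o := by
      intro e o m ho hm hd
      obtain ⟨h2, h3⟩ := ih e o m ho hm hd
      rcases (hC3 e (hd.mono (by omega))).1 with h4 | ⟨-, o', ho', hnok⟩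
      · rw [h4, hC2 e o h2]
      · rw [h2] at ho'
        obtain rfl := Option.some.inj ho'
        exact absurd ((content_iff h2).1 h3) hnok
    intro e o m ho hm hd
    refine ⟨hkeep e o m ho hm hd, ?_⟩
    rw [content_iff (hkeep e o m ho hm hd)]
    obtain ⟨h2, h3⟩ := ih e o m ho hm hd
    obtain ⟨M₀, hM₀, hmin⟩ := P.exists_core ((content_iff ho).1 (h1 e (hd.mono (by omega))))
    -- The visible output values lie between the original core `M₀`, whose members are kept by
    -- induction since they have smaller height, and those in `C'`, where `e` is content.
    refine (hadm.core o).2 M₀ _ (nbrOutputs G.lineGraph C' e)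
      (le_nbrOutputs_of_kept hadm.isInstance.2 hM₀ fun f hf o' ho' hof => ?_)
      (nbrOutputs_mono fun f hf o' hof => ?_) hmin.1 ((content_iff (hC2 e o h2)).1 (hC1 e h3))
    · obtain ⟨m', rfl, hm'⟩ := hm.supports ⟨M₀, hmin, ho'⟩
      exact hkeep f o' m' hof hm' (Deep.adj hk1 hd hf)
    · rcases (hC3 f (Deep.adj hk1 (hd.mono (by omega)) hf)).1 with h4 | h4
      · rw [← h4, hof]
      · rw [h4.1] at hof
        cases hof

/-- In an execution without manipulations, an uncontent edge was protected in the round before or is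
supported by the lost output of an edge that was uncontent. -/
theorem uncontent_succ (hadm : Admissible A P Δ b G r) {X : Exec A P Δ b G p Set.univ r}
    (hs : X.SteadyFrom c) (hn : c + 1 ≤ n) {u v : V} {h : G.Adj u v} {o : O}
    (ho : X.cfg (n + 1) (lineNode u v h) = some o)
    (hun : Uncontent P G.lineGraph (X.cfg (n + 1)) (lineNode u v h)) :
    X.Held n u v ∧ X.cfg n (lineNode u v h) = some o ∧
      Uncontent P G.lineGraph (X.cfg n) (lineNode u v h) ∨
    ∃ f o', X.cfg n f = some o' ∧ Uncontent P G.lineGraph (X.cfg n) f ∧ P.Supports o o' := by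
  have h0 := A.two_le_phi
  have hk0 : ∀ v : V, 0 < (fun _ : V => A.phi) v → v ∈ (Set.univ : Set V) := fun v _ => trivial
  have hk1 : ∀ u v, G.Adj u v → (fun _ : V => A.phi) u ≤ (fun _ : V => A.phi) v + 1 :=
    fun u v _ => Nat.le_succ _
  have hdeep : ∀ e : G.edgeSet, Deep (fun _ : V => A.phi) A.phi e := fun e v _ => le_rfl
  obtain ⟨C', hC1, hC2, hC3⟩ := exists_respectful_extension hk0 hk1 hadm hs (by omega) (Or.inl hn)
  obtain ⟨o₁, ho₁, hnok⟩ := hun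
  rw [ho] at ho₁
  obtain rfl := Option.some.inj ho₁
  have hCe : C' (lineNode u v h) = some o := by
    rcases (hC3 (lineNode u v h) (hdeep _)).1 with h4 | h4
    · rw [← h4, ho]
    · rw [ho] at h4
      cases h4.1
  have hlost : Content P G.lineGraph C' (lineNode u v h) →
      ∃ f o', X.cfg n f = some o' ∧ Uncontent P G.lineGraph (X.cfg n) f ∧ P.Supports o o' := by
    intro hcont
    obtain ⟨f, hf, o', hof, hnone, hsup⟩ := hadm.core.exists_lost hadm.isInstance.2
      ((content_iff hCe).1 hcont) hnok fun f hf => by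
        rcases (hC3 f (hdeep _)).1 with h4 | h4
        · exact Or.inr h4
        · exact Or.inl h4.1
    refine ⟨f, o', ?_, ?_, hsup⟩
    · rcases (hC3 f (hdeep _)).1 with h4 | ⟨-, o₂, h5, -⟩
      · rw [h4, hof] at hnone
        cases hnone
      · rw [← hof, hC2 f o₂ h5, h5]
    · rcases (hC3 f (hdeep _)).1 with h4 | h4
      · rw [h4, hof] at hnone
        cases hnone
      · exact h4.2
  rcases hne : X.cfg n (lineNode u v h) with _ | o₁
  · -- An edge that has just decided is content in `C'`, so a lost output is to blame.
    exact Or.inr (hlost ((hC3 _ (hdeep _)).2 hne (by rw [ho]; simp)))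
  · have h5 := hC2 _ _ hne
    rw [hCe] at h5
    obtain rfl := Option.some.inj h5
    by_cases hok : P.ok o (nbrOutputs G.lineGraph (X.cfg n) (lineNode u v h))
    · exact Or.inr (hlost (hC1 _ ((content_iff hne).2 hok)))
    · refine Or.inl ⟨?_, rfl, o, hne, hok⟩
      by_contra hheld
      have := cfg_succ_eq_none (X := X) (h := h) (by have := hs.1.1; omega) (hs.2 _ (by omega)) hne
        hheld (by
          rw [outputs_eq_of_deep hk0 hk1 (hs.2 n (by omega)) ((hdeep _).mono h0)]
          exact hok)
      rw [ho] at this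
      cases this

/-- An edge is not protected in three consecutive rounds. -/
theorem not_held_three {X : Exec A P Δ b G p Set.univ r} {u v : V} (h1 : X.Held n u v)
    (h2 : X.Held (n + 1) u v) (h3 : X.Held (n + 2) u v) : False := by
  have h0 := A.two_le_phi
  have key : ∀ m (x : V), X.stage (m + 1) x = 2 * A.phi - 2 → X.stage m x = 2 * A.phi - 3 := by
    intro m x hx
    have := stage_of_succ (X := X) (n := m) (v := x) (k := 2 * A.phi - 4) trivial (by omega)
    omega
  have key1 : ∀ m (x : V), X.stage m x = 2 * A.phi - 2 → X.stage (m + 1) x = 2 * A.phi - 1 := by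
    intro m x hx
    have := (stage_succ (X := X) (n := m) (v := x) trivial (by omega) (by omega)).1
    omega
  have a1 := key n u
  have a2 := key (n + 1) u
  have a3 := key n v
  have a4 := key (n + 1) v
  have b1 := key1 n u
  have b2 := key1 (n + 1) u
  have b3 := key1 n v
  have b4 := key1 (n + 1) v
  unfold Held at h1 h2 h3
  simp only [add_assoc, Nat.reduceAdd] at *
  omega

/-- At most three rounds earlier, the blame for an uncontent edge lies with an edge whose output
value supports its own. Hence uncontent edges at late times give long walks in the supportive
digraph. -/
theorem exists_chain_of_uncontent (hadm : Admissible A P Δ b G r)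
    {X : Exec A P Δ b G p Set.univ r} (hs : X.SteadyFrom c) (j : ℕ) :
    ∀ n e o, c + 1 + 3 * j ≤ n → X.cfg n e = some o → Uncontent P G.lineGraph (X.cfg n) e →
      ∃ l : List O, (o :: l).IsChain P.Supports ∧ l.length = j := by
  induction j with
  | zero => exact fun n e o _ _ _ => ⟨[], List.isChain_singleton o, rfl⟩
  | succ j ih =>
    intro n e o hn ho hun
    obtain ⟨u, v, h, rfl⟩ := exists_lineNode e
    obtain ⟨m, rfl⟩ : ∃ m, n = m + 2 + 1 := ⟨n - 3, by omega⟩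
    have fin : ∀ m', c + 1 + 3 * j ≤ m' → (∃ f o', X.cfg m' f = some o' ∧
        Uncontent P G.lineGraph (X.cfg m') f ∧ P.Supports o o') →
        ∃ l : List O, (o :: l).IsChain P.Supports ∧ l.length = j + 1 := by
      rintro m' hm' ⟨f, o', hf, hunf, hsup⟩
      obtain ⟨l, hl, hlen⟩ := ih m' f o' hm' hf hunf
      exact ⟨o' :: l, List.isChain_cons_cons.2 ⟨hsup, hl⟩, by simp [hlen]⟩
    rcases uncontent_succ hadm hs (by omega) ho hun with ⟨hh, ho1, hun1⟩ | hex
    · rcases uncontent_succ hadm hs (by omega) ho1 hun1 with ⟨hh1, ho2, hun2⟩ | hex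
      · rcases uncontent_succ hadm hs (by omega) ho2 hun2 with ⟨hh2, -, -⟩ | hex
        · exact (not_held_three hh2 hh1 hh).elim
        · exact fin _ (by omega) hex
      · exact fin _ (by omega) hex
    · exact fin _ (by omega) hex

/-- Without manipulations the configuration is strong from some time on. -/
theorem strong_cfg (hadm : Admissible A P Δ b G r) {X : Exec A P Δ b G p Set.univ r}
    {ν : ℕ} (hν : P.BoundedInfluence ν) (hn : 2 * A.phi + 1 + 3 * (ν + 1) ≤ n) :
    Strong P G.lineGraph (X.cfg n) := by
  intro e he
  obtain ⟨o, ho⟩ := Option.ne_none_iff_exists'.1 he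
  by_contra hc
  obtain ⟨l, hl, hlen⟩ := exists_chain_of_uncontent hadm steadyFrom_two_mul_phi (ν + 1) n e o hn ho
    ⟨o, ho, fun h => hc ((content_iff ho).2 h)⟩
  have := hν.influenceAtMost o l hl
  omega

end Exec

/-! ### From global states to executions -/

section NodeStates

variable {O V : Type} {B : EdgeAlgorithm O}

/-- The node state has the degree and the port assignment of `s`. -/
def NodeState.SamePorts (s : NodeState B V) (x : Option (NodeState B V)) : Prop :=
  ∃ y : B.Reg s.deg × (Fin s.deg → Option O) × (Fin s.deg → Option Message),
    x = some ⟨s.deg, s.nbr, y.1, y.2.1, y.2.2⟩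

open Classical in
/-- The registers of a node whose ports are those of `s`. -/
noncomputable def NodeState.content (s : NodeState B V) (x : Option (NodeState B V)) :
    B.Reg s.deg × (Fin s.deg → Option O) × (Fin s.deg → Option Message) :=
  if h : s.SamePorts x then h.choose else (s.reg, s.out, s.inbox)

theorem NodeState.eq_some_of_samePorts {s : NodeState B V} {x : Option (NodeState B V)}
    (h : s.SamePorts x) :
    x = some ⟨s.deg, s.nbr, (s.content x).1, (s.content x).2.1, (s.content x).2.2⟩ := by
  rw [NodeState.content, dif_pos h]
  exact h.choose_spec

theorem NodeState.content_eq {s : NodeState B V} {x : Option (NodeState B V)} {a b c}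
    (h : x = some ⟨s.deg, s.nbr, a, b, c⟩) : s.content x = (a, b, c) := by
  have h1 : s.SamePorts x := ⟨(a, b, c), h⟩
  have h2 := NodeState.eq_some_of_samePorts h1
  rw [h] at h2
  simp only [Option.some.injEq, NodeState.mk.injEq, heq_eq_eq, true_and] at h2
  rw [h]
  exact Prod.ext h2.1.symm (Prod.ext h2.2.1.symm h2.2.2.symm)

end NodeStates

namespace GlobalState

variable {O V : Type} {B : EdgeAlgorithm O} {S : GlobalState B V}

/-- The state of a node that is present. -/
def node (S : GlobalState B V) (v : ↥S.verts) : NodeState B V :=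
  (S v).get (Option.ne_none_iff_isSome.1 v.2)

theorem some_node (v : ↥S.verts) : S v = some (S.node v) := by simp [node]

theorem hasPort_iff (v : ↥S.verts) (w : V) : S.HasPort v w ↔ ∃ i, (S.node v).nbr i = w := by
  constructor
  · rintro ⟨s, hs, hi⟩
    rw [some_node v] at hs
    cases hs
    exact hi
  · exact fun h => ⟨_, some_node v, h⟩

theorem HasPort.mem_verts {u v : V} (h : S.HasPort u v) : u ∈ S.verts := by
  obtain ⟨s, hs, -⟩ := h
  simp [verts, hs]

theorem WellFormed.symm (hS : S.WellFormed) {u v : V} (h : S.HasPort u v) : S.HasPort v u := by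
  obtain ⟨s, hs, i, rfl⟩ := h
  exact ((hS u s hs).2 i).2

theorem WellFormed.ne (hS : S.WellFormed) {u v : V} (h : S.HasPort u v) : u ≠ v := by
  obtain ⟨s, hs, i, rfl⟩ := h
  exact ((hS u s hs).2 i).1.symm

theorem WellFormed.adj_iff (hS : S.WellFormed) {u v : ↥S.verts} :
    S.graph.Adj u v ↔ S.HasPort u v :=
  ⟨fun h => h.2.1, fun h => ⟨fun he => hS.ne h (congrArg _ he), h, hS.symm h⟩⟩

/-- The port numbering of the communication graph. -/
noncomputable def ports (S : GlobalState B V) (hS : S.WellFormed) : PortNumbering S.graph where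
  deg v := (S.node v).deg
  port v := Equiv.ofBijective
    (fun i => ⟨⟨(S.node v).nbr i, (hS.symm ⟨_, some_node v, i, rfl⟩).mem_verts⟩,
      hS.adj_iff.2 ⟨_, some_node v, i, rfl⟩⟩) (by
    constructor
    · intro i j h
      exact (hS v _ (some_node v)).1 (congrArg (fun x => (x.1 : V)) h)
    · rintro ⟨w, hw⟩
      obtain ⟨i, hi⟩ := (hasPort_iff v w).1 (hS.adj_iff.1 hw)
      exact ⟨i, Subtype.ext (Subtype.ext hi)⟩)

theorem nbr_ix (hS : S.WellFormed) {u v : ↥S.verts} (h : S.graph.Adj u v) :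
    (S.node u).nbr ((S.ports hS).ix u v h) = v := by
  have := (S.ports hS).nbr_ix u v h
  exact congrArg Subtype.val this

theorem eq_ix (hS : S.WellFormed) {u v : ↥S.verts} (h : S.graph.Adj u v)
    {i : Fin (S.node u).deg} (hi : (S.node u).nbr i = v) : i = (S.ports hS).ix u v h :=
  ((S.ports hS).ix_of_eq h (Subtype.ext hi)).symm

end GlobalState

section ToExec

variable {O V : Type} {A : PhaseAlgorithm O} {P : LCLProblem O} {Δ b : ℕ}
  {S : GlobalState (edgeAlgorithm A P Δ b) V} (hS : S.WellFormed)

/-- The nodes in `good` have the same ports in all states `T n` as in `S`, and they follow the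
algorithm with the coins `R n`. -/
structure Follows (S : GlobalState (edgeAlgorithm A P Δ b) V) (good : Set ↥S.verts)
    (T : ℕ → GlobalState (edgeAlgorithm A P Δ b) V) (R : ℕ → V → ℕ) : Prop where
  samePorts : ∀ n, ∀ v ∈ good, (S.node v).SamePorts (T n v)
  next : ∀ n, ∀ v ∈ good, T (n + 1) v = (T n).next (R n) v

variable {good : Set ↥S.verts} {T : ℕ → GlobalState (edgeAlgorithm A P Δ b) V} {R : ℕ → V → ℕ}

theorem Follows.content_succ (hF : Follows S good T R) (n : ℕ) {v : ↥S.verts} (hv : v ∈ good) :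
    (S.node v).content (T (n + 1) v) =
      (((edgeAlgorithm A P Δ b).step _ ((S.node v).content (T n v)).1
          ((S.node v).content (T n v)).2.1 ((S.node v).content (T n v)).2.2 (R n v)).1,
        ((edgeAlgorithm A P Δ b).step _ ((S.node v).content (T n v)).1
          ((S.node v).content (T n v)).2.1 ((S.node v).content (T n v)).2.2 (R n v)).2.1,
        fun i => (T n).msg (R n) ((S.node v).nbr i) v) := by
  refine NodeState.content_eq ?_
  rw [hF.next n v hv, GlobalState.next]
  conv_lhs => rw [NodeState.eq_some_of_samePorts (hF.samePorts n v hv)]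
  rfl

theorem Follows.msg_eq (hF : Follows S good T R) (n : ℕ) {u v : ↥S.verts} (hu : u ∈ good)
    (h : S.graph.Adj u v) :
    (T n).msg (R n) u v = ((edgeAlgorithm A P Δ b).step _ ((S.node u).content (T n u)).1
          ((S.node u).content (T n u)).2.1 ((S.node u).content (T n u)).2.2 (R n u)).2.2
          ((S.ports hS).ix u v h) := by
  have hs := NodeState.eq_some_of_samePorts (hF.samePorts n u hu)
  have hex : ∃ i, (S.node u).nbr i = v := ⟨_, GlobalState.nbr_ix hS h⟩
  unfold GlobalState.msg
  generalize (S.node u).content (T n u) = y at hs ⊢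
  rw [hs]
  dsimp only
  rw [dif_pos hex]
  exact congrArg _ (GlobalState.eq_ix hS h hex.choose_spec)

/-- The execution given by a sequence of global states. -/
noncomputable def Follows.exec (hF : Follows S good T R) :
    Exec A P Δ b S.graph (S.ports hS) good (fun n v => R n v) where
  reg n v := ((S.node v).content (T n v)).1
  out n v := ((S.node v).content (T n v)).2.1
  rc n v i := Summary.decode A (((S.node v).content (T n v)).2.2 i)
  reg_succ n v hv := by
    rw [hF.content_succ n hv]
    rfl
  out_succ n v hv := by
    rw [hF.content_succ n hv]
    rfl
  rc_eq n hn u v h hu hv := by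
    obtain ⟨n, rfl⟩ : ∃ m, n = m + 1 := ⟨n - 1, by omega⟩
    rw [hF.content_succ n hu]
    dsimp only
    rw [GlobalState.nbr_ix hS h, hF.msg_eq hS n hv h.symm]
    change Summary.decode A (some (Summary.encode A _)) = _
    rw [Summary.decode_encode, hF.content_succ n hv]
    rfl

theorem Follows.outReg_eq (hF : Follows S good T R) (n : ℕ) {u v : ↥S.verts} (hu : u ∈ good)
    (h : S.graph.Adj u v) : (T n).outReg u v = (hF.exec hS).val n u v h := by
  have hs := NodeState.eq_some_of_samePorts (hF.samePorts n u hu)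
  have hex : ∃ i, (S.node u).nbr i = v := ⟨_, GlobalState.nbr_ix hS h⟩
  unfold GlobalState.outReg
  rw [hs]
  dsimp only
  rw [dif_pos hex]
  exact congrArg _ (GlobalState.eq_ix hS h hex.choose_spec)

/-- The configuration of the execution is the one given by the edge outputs of the global states.
-/
theorem Follows.edgeOut_eq (hF : Follows S good T R) (n : ℕ) {u v : ↥S.verts} (hu : u ∈ good)
    (hv : v ∈ good) (h : S.graph.Adj u v) :
    (T n).edgeOut s(u.1, v.1) = (hF.exec hS).cfg n (lineNode u v h) := by
  classical
  have h1 : (T n).edgeOut s(u.1, v.1) =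
      if (T n).outReg u v = (T n).outReg v u then (T n).outReg u v else none := rfl
  rw [h1, hF.outReg_eq hS n hu h, hF.outReg_eq hS n hv h.symm]
  by_cases he : (hF.exec hS).val n u v h = (hF.exec hS).val n v u h.symm
  · rw [if_pos he, Exec.cfg_eq_val hu hv he]
  · rw [if_neg he]
    by_contra hne
    obtain ⟨o, ho⟩ := Option.ne_none_iff_exists'.1 (Ne.symm hne)
    obtain ⟨-, -, h3, h4⟩ := Exec.cfg_eq_some ho
    exact he (h3.trans h4.symm)

end ToExec

/-! ### Runs without manipulations -/

namespace GlobalState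

variable {O V : Type} {B : EdgeAlgorithm O} {S : GlobalState B V}

theorem samePorts_next {s : NodeState B V} {T : GlobalState B V} {r : V → ℕ} {v : V}
    (h : s.SamePorts (T v)) : s.SamePorts (T.next r v) := by
  obtain ⟨y, hy⟩ := h
  exact ⟨((B.step s.deg y.1 y.2.1 y.2.2 (r v)).1, (B.step s.deg y.1 y.2.1 y.2.2 (r v)).2.1,
    fun i => T.msg r (s.nbr i) v), by rw [next, hy]; rfl⟩

theorem samePorts_of_next {s : NodeState B V} {T : GlobalState B V} {r : V → ℕ} {v : V}
    (h : s.SamePorts (T.next r v)) : s.SamePorts (T v) := by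
  obtain ⟨y, hy⟩ := h
  rw [next] at hy
  rcases hT : T v with _ | t
  · rw [hT] at hy
    cases hy
  · rw [hT] at hy
    obtain ⟨d, nb, rg, ou, ib⟩ := t
    simp only [Option.map_some, Option.some.injEq, NodeState.mk.injEq] at hy
    obtain ⟨rfl, h2, -⟩ := hy
    obtain rfl := eq_of_heq h2
    exact ⟨(rg, ou, ib), rfl⟩

theorem samePorts_node (v : ↥S.verts) : (S.node v).SamePorts (S v) :=
  ⟨((S.node v).reg, (S.node v).out, (S.node v).inbox), some_node v⟩

theorem samePorts_run (w : ℕ × V → ℕ) (n : ℕ) (v : ↥S.verts) :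
    (S.node v).SamePorts (S.run w n v) := by
  induction n with
  | zero => exact samePorts_node v
  | succ n ih => exact samePorts_next ih

theorem run_eq_none {v : V} (w : ℕ × V → ℕ) (n : ℕ) (hv : v ∉ S.verts) : S.run w n v = none := by
  induction n with
  | zero =>
    by_contra h
    exact hv h
  | succ n ih => rw [run, next, ih]; rfl

theorem verts_run (w : ℕ × V → ℕ) (n : ℕ) : (S.run w n).verts = S.verts := by
  ext v
  constructor
  · intro hv
    by_contra h
    exact hv (run_eq_none w n h)
  · intro hv
    obtain ⟨y, hy⟩ := samePorts_run w n ⟨v, hv⟩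
    change S.run w n v ≠ none
    rw [show S.run w n v = _ from hy]
    simp

theorem hasPort_run (w : ℕ × V → ℕ) (n : ℕ) : (S.run w n).HasPort = S.HasPort := by
  funext u v
  refine propext ?_
  by_cases hu : u ∈ S.verts
  · rw [hasPort_iff ⟨u, hu⟩]
    obtain ⟨y, hy⟩ := samePorts_run w n ⟨u, hu⟩
    change (∃ s, S.run w n u = some s ∧ _) ↔ _
    rw [show S.run w n u = _ from hy]
    simp
  · constructor
    · intro h
      have := h.mem_verts
      rw [verts_run] at this
      exact absurd this hu
    · exact fun h => absurd h.mem_verts hu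

end GlobalState

theorem follows_run {O V : Type} {A : PhaseAlgorithm O} {P : LCLProblem O} {Δ b : ℕ}
    (S : GlobalState (edgeAlgorithm A P Δ b) V) (w : ℕ × V → ℕ) :
    Follows S Set.univ (S.run w) fun n v => w (n, v) where
  samePorts n v _ := GlobalState.samePorts_run w n v
  next _ _ _ := rfl

namespace GlobalState

variable {O V : Type} {B : EdgeAlgorithm O} {S : GlobalState B V}

/-- The graph with nodes `W` in which two nodes are adjacent if they have ports for each other. -/
def graphOn (W : Set V) (H : V → V → Prop) : SimpleGraph ↥W where
  Adj u v := u ≠ v ∧ H u v ∧ H v u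
  symm := ⟨fun _ _ h => ⟨h.1.symm, h.2.2, h.2.1⟩⟩
  loopless := ⟨fun _ h => h.1 rfl⟩

/-- Legality in terms of the nodes, the ports and the edge outputs. -/
def LegalOn (P : LCLProblem O) (W : Set V) (H : V → V → Prop) (C : Sym2 V → Option O) : Prop :=
  ∀ e, Content P (graphOn W H).lineGraph
    (fun e : (graphOn W H).edgeSet => C ((e : Sym2 ↥W).map Subtype.val)) e

theorem legal_run_iff (P : LCLProblem O) (w : ℕ × V → ℕ) (n : ℕ) :
    (S.run w n).Legal P ↔ ∀ e, Content P S.graph.lineGraph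
      (fun e => (S.run w n).edgeOut (S.name e)) e := by
  change LegalOn P (S.run w n).verts (S.run w n).HasPort (S.run w n).edgeOut ↔ _
  rw [verts_run, hasPort_run]
  rfl

theorem outReg_eq_none {u v : V} (h : ¬ S.HasPort u v) : S.outReg u v = none := by
  unfold outReg
  rcases hs : S u with _ | s
  · rfl
  · dsimp only
    rw [dif_neg]
    exact fun hi => h ⟨s, hs, hi⟩

/-- Agreement of the edge outputs need only be checked at the edges. -/
theorem edgeOut_run_eq (hS : S.WellFormed) {w : ℕ × V → ℕ} {n m : ℕ}
    (h : ∀ e : S.graph.edgeSet,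
      (S.run w n).edgeOut (S.name e) = (S.run w m).edgeOut (S.name e)) :
    (S.run w n).edgeOut = (S.run w m).edgeOut := by
  funext e
  induction e with
  | h u v =>
    by_cases hp : S.HasPort u v
    · have hp' := hS.symm hp
      exact h ⟨s(⟨u, hp.mem_verts⟩, ⟨v, hp'.mem_verts⟩),
        (hS.adj_iff (u := ⟨u, hp.mem_verts⟩) (v := ⟨v, hp'.mem_verts⟩)).2 hp⟩
    · have hp' : ¬ S.HasPort v u := fun h' => hp (hS.symm h')
      have key : ∀ n, (S.run w n).edgeOut s(u, v) = none := by
        intro n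
        rw [← hasPort_run w n] at hp hp'
        simp [edgeOut, outReg_eq_none hp]
      rw [key, key]

end GlobalState

/-! ### The influence radius -/

/-- An edge meets at most `Δ - 1` other edges at each of its endpoints. -/
theorem DegreeBounded.lineGraph {V : Type} {G : SimpleGraph V} {Δ : ℕ} (hG : DegreeBounded Δ G) :
    DegreeBounded (2 * Δ - 2) G.lineGraph := by
  have := hG.1
  have : Countable (Sym2 V) := by unfold Sym2; infer_instance
  refine ⟨inferInstance, fun e => ?_⟩
  obtain ⟨u, v, h, rfl⟩ := exists_lineNode e
  have key : ∀ u v, G.Adj u v → ((fun w => s(u, w)) '' (G.neighborSet u \ {v})).encard + 1 ≤ Δ := by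
    intro u v h
    calc ((fun w => s(u, w)) '' (G.neighborSet u \ {v})).encard + 1
        ≤ (G.neighborSet u \ {v}).encard + 1 := by gcongr; exact Set.encard_image_le _ _
      _ = (G.neighborSet u).encard := Set.encard_sdiff_singleton_add_one h
      _ ≤ Δ := hG.2 u
  have hsub : Subtype.val '' (G.lineGraph.neighborSet (lineNode u v h)) ⊆
      (fun w => s(u, w)) '' (G.neighborSet u \ {v}) ∪
        (fun w => s(v, w)) '' (G.neighborSet v \ {u}) := by
    rintro _ ⟨f, hf, rfl⟩
    rcases lineGraph_adj_lineNode hf with ⟨w, h', hw, rfl⟩ | ⟨w, h', hw, rfl⟩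
    · exact Or.inl ⟨w, ⟨h', hw⟩, rfl⟩
    · exact Or.inr ⟨w, ⟨h', hw⟩, rfl⟩
  have h1 := key u v h
  have h2 := key v u h.symm
  rw [← Subtype.val_injective.encard_image]
  refine (Set.encard_le_encard hsub).trans ((Set.encard_union_le _ _).trans ?_)
  generalize ((fun w => s(u, w)) '' (G.neighborSet u \ {v})).encard = x at h1
  generalize ((fun w => s(v, w)) '' (G.neighborSet v \ {u})).encard = y at h2
  have hx : x ≠ ⊤ := by rintro rfl; simp at h1
  have hy : y ≠ ⊤ := by rintro rfl; simp at h2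
  lift x to ℕ using hx
  lift y to ℕ using hy
  norm_cast at h1 h2 ⊢
  omega

/-- The visible output values depend only on the names and the output values of the neighbors. -/
theorem nbrOutputs_eq_of_image_eq {O U U' N : Type} {G : SimpleGraph U} {G' : SimpleGraph U'}
    {f : U → N} {f' : U' → N} (hf : Function.Injective f) (hf' : Function.Injective f')
    (D : N → Option O) {v : U} {v' : U'}
    (h : f '' G.neighborSet v = f' '' G'.neighborSet v') :
    nbrOutputs G (fun x => D (f x)) v = nbrOutputs G' (fun x => D (f' x)) v' := by
  classical
  have key : ∀ {U : Type} {G : SimpleGraph U} {f : U → N} (_ : Function.Injective f) (v : U),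
      nbrOutputs G (fun x => D (f x)) v =
        if h : (f '' G.neighborSet v).Finite then h.toFinset.val.filterMap D else 0 := by
    intro U G f hf v
    by_cases hfin : (G.neighborSet v).Finite
    · rw [nbrOutputs_eq hfin, dif_pos (hfin.image f)]
      have : (hfin.image f).toFinset = hfin.toFinset.map ⟨f, hf⟩ := by
        ext x
        simp
      rw [this, Finset.map_val, Multiset.filterMap_map]
      rfl
    · rw [dif_neg fun h' => hfin (h'.of_finite_image hf.injOn)]
      simp [nbrOutputs, hfin]
  rw [key hf, key hf']
  simp only [h]

namespace GlobalState

variable {O V : Type} {B : EdgeAlgorithm O} {S : GlobalState B V}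

theorem name_injective : Function.Injective S.name := fun _ _ h =>
  Subtype.ext (Sym2.map.injective Subtype.val_injective h)

theorem image_name_neighborSet (hS : S.WellFormed) {u v : ↥S.verts} (h : S.graph.Adj u v) :
    S.name '' (S.graph.lineGraph.neighborSet (lineNode u v h)) =
      {x | (∃ w, S.HasPort u w ∧ w ≠ v ∧ x = s(u.1, w)) ∨
        ∃ w, S.HasPort v w ∧ w ≠ u ∧ x = s(v.1, w)} := by
  ext x
  constructor
  · rintro ⟨f, hf, rfl⟩
    rcases lineGraph_adj_lineNode hf with ⟨w, h', hw, rfl⟩ | ⟨w, h', hw, rfl⟩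
    · exact Or.inl ⟨w, hS.adj_iff.1 h', fun he => hw (Subtype.ext he), rfl⟩
    · exact Or.inr ⟨w, hS.adj_iff.1 h', fun he => hw (Subtype.ext he), rfl⟩
  · rintro (⟨w, hw, hne, rfl⟩ | ⟨w, hw, hne, rfl⟩)
    · have hadj : S.graph.Adj u ⟨w, (hS.symm hw).mem_verts⟩ := hS.adj_iff.2 hw
      exact ⟨lineNode _ _ hadj,
        lineGraph_adj_right _ _ fun he => hne (congrArg Subtype.val he.symm), rfl⟩
    · have hadj : S.graph.Adj v ⟨w, (hS.symm hw).mem_verts⟩ := hS.adj_iff.2 hw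
      refine ⟨lineNode _ _ hadj, ?_, rfl⟩
      rw [lineNode_comm u v]
      exact lineGraph_adj_right _ _ fun he => hne (congrArg Subtype.val he.symm)

theorem hasPort_iff_of_samePorts {T : GlobalState B V} {v : ↥S.verts}
    (h : (S.node v).SamePorts (T v)) (w : V) : T.HasPort v w ↔ S.HasPort v w := by
  rw [hasPort_iff v]
  obtain ⟨y, hy⟩ := h
  change (∃ s, T v = some s ∧ _) ↔ _
  rw [hy]
  simp

end GlobalState

section Influence

variable {O : Type} {P : LCLProblem O} {A : PhaseAlgorithm O} {Δ b : ℕ}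

/-- The assumptions on the problem and the algorithm that concern a single graph. -/
theorem Admissible.of_family {V : Type} {G : SimpleGraph V} {r : ℕ → V → ℕ}
    (hΔ : ∀ (V : Type) (G : SimpleGraph V), P.edgeProblem.family G → DegreeBounded Δ G)
    (hA : A.MessagesAtMost (2 * Δ - 2) b) (hcore : P.CoreCoverage)
    (hres : A.RespectfulDecisions P (2 * Δ - 2)) (hG : P.edgeProblem.family G)
    (hr : ∀ n v, r n v ∈ (seedCoin A.coin (Fin Δ × Fin A.phi) (Draw A.phi)).support) :
    Admissible A P Δ b G r :=
  ⟨hcore, hres, hA, hΔ V G hG, ⟨hG.2, (hΔ V G hG).lineGraph⟩, hr⟩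

variable {V : Type} {S : ℕ → GlobalState (edgeAlgorithm A P Δ b) V} {ta tb : ℕ} {K : Set V}

/-- The nodes that are present at the end and were never manipulated. -/
def unmanipulated (S : ℕ → GlobalState (edgeAlgorithm A P Δ b) V) (tb : ℕ) (K : Set V) :
    Set ↥(S tb).verts := {v | v.1 ∉ K}

/-- The states at the times from `ta - 1` on, continued by a run without manipulations. -/
noncomputable def history (S : ℕ → GlobalState (edgeAlgorithm A P Δ b) V) (ta tb : ℕ)
    (w : ℕ × V → ℕ) (n : ℕ) : GlobalState (edgeAlgorithm A P Δ b) V :=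
  if n ≤ tb - (ta - 1) then S (ta - 1 + n) else (S tb).run w (n - (tb - (ta - 1)))

/-- The nodes that were never manipulated follow the algorithm, with some possible coins, from the
round before the first manipulation on. -/
theorem follows_history
    (hE : (edgeAlgorithm A P Δ b).AdversarialExecution P.edgeProblem S ta tb K)
    {w : ℕ × V → ℕ} (hw : ∀ x, w x ∈ (edgeAlgorithm A P Δ b).coin.support) :
    ∃ R : ℕ → V → ℕ, (∀ n v, R n v ∈ (edgeAlgorithm A P Δ b).coin.support) ∧
      Follows (S tb) (unmanipulated S tb K) (history S ta tb w) R := by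
  have h1 := hE.ta_pos
  have h2 := hE.ta_lt_tb
  obtain ⟨r, hr, hm1, hK⟩ := hE.rounds
  have hnm : ∀ v ∉ K, ∀ t, ta - 1 ≤ t → t < tb →
      S (t + 1) v = none ∨ S (t + 1) v = (S t).next (r t) v := by
    intro v hv t ht ht'
    have hv' : v ∉ (edgeAlgorithm A P Δ b).manipulated (S t) (S (t + 1)) (r t) := by
      by_cases hta : ta ≤ t
      · intro hmem
        rw [hK] at hv
        exact hv ⟨t, hta, ht', hmem⟩
      · obtain rfl : t = ta - 1 := by omega
        rw [show ta - 1 + 1 = ta by omega, hm1]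
        exact Set.notMem_empty v
    by_contra hne
    push Not at hne
    exact hv' hne
  have hpres : ∀ v ∉ K, S tb v ≠ none → ∀ d t, t + d = tb → ta - 1 ≤ t → S t v ≠ none := by
    intro v hv hvb d
    induction d with
    | zero =>
      rintro t rfl _
      exact hvb
    | succ d ih =>
      intro t ht hta h0
      have h3 := ih (t + 1) (by omega) (by omega)
      rcases hnm v hv t hta (by omega) with h4 | h4
      · exact h3 h4
      · refine h3 (h4.trans ?_)
        rw [GlobalState.next, h0]
        rfl
  have hnext : ∀ v : ↥(S tb).verts, v.1 ∉ K → ∀ t, ta - 1 ≤ t → t < tb →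
      S (t + 1) v = (S t).next (r t) v := by
    intro v hv t ht ht'
    exact (hnm v hv t ht ht').resolve_left
      (hpres v hv v.2 (tb - (t + 1)) (t + 1) (by omega) (by omega))
  have hsame : ∀ v : ↥(S tb).verts, v.1 ∉ K → ∀ d t, t + d = tb → ta - 1 ≤ t →
      ((S tb).node v).SamePorts (S t v) := by
    intro v hv d
    induction d with
    | zero =>
      rintro t rfl _
      exact GlobalState.samePorts_node v
    | succ d ih =>
      intro t ht hta
      have h3 := ih (t + 1) (by omega) (by omega)
      rw [hnext v hv t hta (by omega)] at h3
      exact GlobalState.samePorts_of_next h3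
  refine ⟨fun n => if n < tb - (ta - 1) then r (ta - 1 + n) else
    fun v => w (n - (tb - (ta - 1)), v), fun n v => ?_, fun n v hv => ?_, fun n v hv => ?_⟩
  · dsimp only
    split_ifs
    · exact hr _ _
    · exact hw _
  · unfold history
    split_ifs with hn
    · exact hsame v hv (tb - (ta - 1 + n)) _ (by omega) (by omega)
    · exact GlobalState.samePorts_run _ _ v
  · unfold history
    rcases lt_trichotomy n (tb - (ta - 1)) with hn | hn | hn
    · rw [if_pos (by omega), if_pos (by omega), if_pos (by omega)]
      exact hnext v hv (ta - 1 + n) (by omega) (by omega)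
    · rw [if_neg (by omega), if_pos (by omega), if_neg (by omega), hn]
      simp only [Nat.add_sub_cancel_left, Nat.sub_self, show ta - 1 + (tb - (ta - 1)) = tb by omega]
      rfl
    · rw [if_neg (by omega), if_neg (by omega), if_neg (by omega),
        show n + 1 - (tb - (ta - 1)) = n - (tb - (ta - 1)) + 1 by omega]
      rfl

/-- The distance from `v` to the nearest manipulated node, if it is at most `R`, and `R` otherwise.
-/
noncomputable def distanceRank {V : Type} (G : SimpleGraph V) (K : Set V) (R : ℕ) (v : V) : ℕ :=
  open Classical in Nat.findGreatest (fun j => ∀ m ∈ K, (j : ℕ∞) ≤ G.edist v m) R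

theorem distanceRank_le_add_one {V : Type} (G : SimpleGraph V) (K : Set V) (R : ℕ) {u v : V}
    (h : G.Adj u v) : distanceRank G K R u ≤ distanceRank G K R v + 1 := by
  classical
  unfold distanceRank
  set k := Nat.findGreatest (fun j => ∀ m ∈ K, (j : ℕ∞) ≤ G.edist u m) R with hk
  rcases hk0 : k with _ | j
  · omega
  · have hle : k ≤ R := Nat.findGreatest_le R
    have hP : ∀ m ∈ K, (k : ℕ∞) ≤ G.edist u m := Nat.findGreatest_of_ne_zero hk.symm (by omega)
    refine Nat.succ_le_succ (Nat.le_findGreatest (by omega) fun m hm => ?_)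
    have h1 := hP m hm
    rw [hk0] at h1
    have h2 := G.edist_triangle (u := u) (v := v) (w := m)
    rw [SimpleGraph.edist_eq_one_iff_adj.2 h] at h2
    have h3 := h1.trans h2
    push_cast at h3
    rw [add_comm 1] at h3
    exact (ENat.add_le_add_iff_right (by simp)).1 h3

/-- Far from all manipulated nodes the output values never change, whatever the coins: the history
and its continuation are a single execution in which the nodes outside `K` are good, and
`distanceRank` serves as rank. -/
theorem influence
    (hΔ : ∀ (V : Type) (G : SimpleGraph V), P.edgeProblem.family G → DegreeBounded Δ G)
    (hA : A.MessagesAtMost (2 * Δ - 2) b) (hcore : P.CoreCoverage)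
    (hres : A.RespectfulDecisions P (2 * Δ - 2)) {ν : ℕ} (hν : P.BoundedInfluence ν)
    (hE : (edgeAlgorithm A P Δ b).AdversarialExecution P.edgeProblem S ta tb K)
    {w : ℕ × V → ℕ} (hw : ∀ x, w x ∈ (edgeAlgorithm A P Δ b).coin.support)
    (e : (S tb).graph.edgeSet)
    (he : ∀ u ∈ (e : Sym2 ↥(S tb).verts), ∀ m : ↥(S tb).verts, (m : V) ∈ K →
        ((ν + 2 * A.phi + 1 : ℕ) : ℕ∞) ≤ (S tb).graph.edist u m) :
    ∃ o, (∀ t, ta ≤ t → t ≤ tb → (S t).edgeOut ((S tb).name e) = some o) ∧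
      ∀ n, ((S tb).run w n).edgeOut ((S tb).name e) = some o := by
  classical
  have ht1 := hE.ta_pos
  have ht2 := hE.ta_lt_tb
  have hφ := A.two_le_phi
  have hS := hE.wellFormed tb (by omega) le_rfl
  have hSa := hE.wellFormed ta (by omega) (by omega)
  obtain ⟨R, hR, hF⟩ := follows_history hE hw
  have hT1 : history S ta tb w 1 = S ta := by
    rw [history, if_pos (by omega), show ta - 1 + 1 = ta by omega]
  set good := unmanipulated S tb K with hgood
  set X := hF.exec hS with hX
  have hadm : Admissible A P Δ b (S tb).graph (fun n v => R n v.1) :=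
    Admissible.of_family hΔ hA hcore hres (hE.family tb (by omega) le_rfl) fun n v => hR n v
  set k := distanceRank (S tb).graph {m | m.1 ∈ K} (ν + 2 * A.phi + 1) with hk
  have hk0 : ∀ v, 0 < k v → v ∈ good := by
    intro v hv hvK
    have h1 : ∀ m ∈ {m : ↥(S tb).verts | m.1 ∈ K}, ((k v : ℕ) : ℕ∞) ≤ (S tb).graph.edist v m :=
      Nat.findGreatest_of_ne_zero (n := ν + 2 * A.phi + 1) rfl (by
        change k v ≠ 0
        omega)
    have h2 := h1 v hvK
    rw [SimpleGraph.edist_self] at h2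
    simp at h2
    omega
  have hk1 : ∀ u v, (S tb).graph.Adj u v → k u ≤ k v + 1 := fun u v h =>
    distanceRank_le_add_one _ _ _ h
  -- The state at time `ta`, which is time `1` of the execution `X`.
  have hport : ∀ v ∈ good, ∀ x, (S ta).HasPort v.1 x ↔ (S tb).HasPort v.1 x := by
    intro v hv x
    have := hF.samePorts 1 v hv
    rw [hT1] at this
    exact GlobalState.hasPort_iff_of_samePorts this x
  have hcfg1 : ∀ u v (h : (S tb).graph.Adj u v), u ∈ good → v ∈ good →
      (S ta).edgeOut s(u.1, v.1) = X.cfg 1 (lineNode u v h) := by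
    intro u v h hu hv
    rw [← hF.edgeOut_eq hS 1 hu hv h, hT1]
  have hlegal : ∀ u v (h : (S tb).graph.Adj u v), u ∈ good → v ∈ good →
      ∃ (u' v' : ↥(S ta).verts) (h' : (S ta).graph.Adj u' v'), u'.1 = u.1 ∧ v'.1 = v.1 ∧
        Content P (S ta).graph.lineGraph (S ta).config (lineNode u' v' h') := by
    intro u v h hu hv
    have h1 := (hport u hu v).2 (hS.adj_iff.1 h)
    exact ⟨⟨u, h1.mem_verts⟩, ⟨v, (hSa.symm h1).mem_verts⟩, hSa.adj_iff.2 h1, rfl, rfl,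
      hE.legal' _⟩
  have hsome : ∀ u v (h : (S tb).graph.Adj u v), u ∈ good → v ∈ good →
      ∃ o, X.cfg 1 (lineNode u v h) = some o := by
    intro u v h hu hv
    obtain ⟨u', v', h', hu', hv', o, ho, -⟩ := hlegal u v h hu hv
    refine ⟨o, ?_⟩
    rw [← hcfg1 u v h hu hv, ← ho, ← hu', ← hv']
    rfl
  have hsteady : X.SteadyFrom 1 := by
    refine Exec.steadyFrom_one (fun u v h hu hv => ?_) fun u v h hu hv => ?_
    · obtain ⟨o, ho⟩ := hsome u v h hu hv
      rw [(Exec.cfg_eq_some ho).2.2.1]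
      simp
    · obtain ⟨o, ho⟩ := hsome u v h hu hv
      rw [(Exec.cfg_eq_some ho).2.2.1, (Exec.cfg_eq_some ho).2.2.2]
  have hcontent : ∀ e, Deep k 2 e → Content P (S tb).graph.lineGraph (X.cfg 1) e := by
    intro e hd
    obtain ⟨u, v, h, rfl⟩ := exists_lineNode e
    have hd' := hd
    rw [deep_lineNode] at hd
    have hu := hk0 u (by omega)
    have hv := hk0 v (by omega)
    obtain ⟨u', v', h', hu', hv', o, ho, hok⟩ := hlegal u v h hu hv
    refine ⟨o, ?_, ?_⟩
    · rw [← hcfg1 u v h hu hv, ← ho, ← hu', ← hv']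
      rfl
    · have h3 : nbrOutputs (S tb).graph.lineGraph (X.cfg 1) (lineNode u v h) =
          nbrOutputs (S tb).graph.lineGraph (fun x => (S ta).edgeOut ((S tb).name x))
            (lineNode u v h) := by
        refine nbrOutputs_congr fun f hf => ?_
        have hdf := Deep.adj hk1 hd' hf
        obtain ⟨x, y, hxy, rfl⟩ := exists_lineNode f
        rw [deep_lineNode] at hdf
        exact (hcfg1 x y hxy (hk0 x (by omega)) (hk0 y (by omega))).symm
      rw [h3, nbrOutputs_eq_of_image_eq (G' := (S ta).graph.lineGraph) (v' := lineNode u' v' h')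
        GlobalState.name_injective (GlobalState.name_injective (S := S ta))]
      · exact hok
      · rw [GlobalState.image_name_neighborSet hS, GlobalState.image_name_neighborSet hSa, hu', hv']
        simp only [hport u hu, hport v hv]
  obtain ⟨u, v, h, rfl⟩ := exists_lineNode e
  have hdeep : Deep k (A.phi + 1 + ν) (lineNode u v h) := by
    have hfar : ∀ x ∈ (lineNode u v h : Sym2 _), ν + 2 * A.phi + 1 ≤ k x := fun x hx =>
      Nat.le_findGreatest le_rfl fun m hm => he x hx m hm
    exact fun x hx => le_trans (by omega) (hfar x hx)
  have hd := hdeep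
  rw [deep_lineNode] at hd
  have hu := hk0 u (by omega)
  have hv := hk0 v (by omega)
  obtain ⟨o, ho⟩ := hsome u v h hu hv
  have hall : ∀ n, 1 ≤ n → (history S ta tb w n).edgeOut ((S tb).name (lineNode u v h)) =
      some o := by
    intro n hn
    have h1 := (Exec.cfg_eq_of_deep hk0 hk1 hadm hsteady hcontent n hn (lineNode u v h) o ν ho
      (hν.influenceAtMost o) hdeep).1
    rw [← h1]
    exact hF.edgeOut_eq hS n hu hv h
  refine ⟨o, fun t h1 h2 => ?_, fun n => ?_⟩
  · have h3 := hall (t - (ta - 1)) (by omega)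
    rwa [history, if_pos (by omega), show ta - 1 + (t - (ta - 1)) = t by omega] at h3
  · have h3 := hall (n + (tb - (ta - 1))) (by omega)
    rcases Nat.eq_zero_or_pos n with rfl | hn
    · rw [history, if_pos (by omega), zero_add, show ta - 1 + (tb - (ta - 1)) = tb by omega] at h3
      exact h3
    · rwa [history, if_neg (by omega), Nat.add_sub_cancel] at h3

theorem edgeAlgorithm_influenceRadius
    (hΔ : ∀ (V : Type) (G : SimpleGraph V), P.edgeProblem.family G → DegreeBounded Δ G)
    (hA : A.MessagesAtMost (2 * Δ - 2) b) (hcore : P.CoreCoverage)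
    (hres : A.RespectfulDecisions P (2 * Δ - 2)) {ν : ℕ} (hν : P.BoundedInfluence ν) :
    (edgeAlgorithm A P Δ b).InfluenceRadius P.edgeProblem (ν + 2 * A.phi + 1) := by
  intro V _ S ta tb K hE _ _ e he
  have ht := hE.ta_lt_tb
  obtain ⟨a, ha⟩ := (edgeAlgorithm A P Δ b).coin.support_nonempty
  constructor
  · obtain ⟨o, h1, -⟩ := influence hΔ hA hcore hres hν hE (w := fun _ => a) (fun _ => ha) e he
    intro t h2 h3
    rw [h1 t h2 h3, h1 ta le_rfl ht.le]
  · filter_upwards [ae_mem_support (ι := ℕ × V) (edgeAlgorithm A P Δ b).coin] with w hw n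
    obtain ⟨o, h1, h2⟩ := influence hΔ hA hcore hres hν hE hw e he
    rw [h1 ta le_rfl ht.le, h2 n]

end Influence

/-! ### Dependence of a run on the coins -/

theorem dependsOn_run {O V : Type} {B : EdgeAlgorithm O} (S : GlobalState B V) (n : ℕ) :
    DependsOn (fun w => S.run w n) {x : ℕ × V | x.1 < n} := by
  induction n with
  | zero => exact fun w w' _ => rfl
  | succ n ih =>
    intro w w' h
    have h1 : S.run w n = S.run w' n := ih fun x hx => h x (Nat.lt_succ_of_lt hx)
    have h2 : (fun v => w (n, v)) = fun v => w' (n, v) :=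
      funext fun v => h (n, v) (Nat.lt_succ_self n)
    simp only [GlobalState.run, h1, h2]

theorem finiteDep_run {O V : Type} {B : EdgeAlgorithm O} (S : GlobalState B V) (n : ℕ) (v : V) :
    FiniteDep fun w => S.run w n v := by
  classical
  induction n generalizing v with
  | zero => exact FiniteDep.const _
  | succ n ih =>
    by_cases hv : v ∈ S.verts
    · let s := S.node ⟨v, hv⟩
      choose f hf using ih
      refine ⟨f v ∪ {(n, v)} ∪ Finset.univ.biUnion (fun i => f (s.nbr i) ∪ {(n, s.nbr i)}),
        fun w w' h => ?_⟩
      have h1 : S.run w n v = S.run w' n v := hf v fun i hi => h i (by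
        simp only [Finset.coe_union, Set.mem_union]
        exact Or.inl (Or.inl hi))
      have h2 : w (n, v) = w' (n, v) := h _ (by simp)
      have h3 : ∀ i, S.run w n (s.nbr i) = S.run w' n (s.nbr i) := fun i => hf _ fun j hj => h j (by
        simp only [Finset.coe_union, Set.mem_union, Finset.coe_biUnion, Set.mem_iUnion]
        exact Or.inr ⟨i, by simp, Or.inl hj⟩)
      have h4 : ∀ i, w (n, s.nbr i) = w' (n, s.nbr i) := fun i => h _ (by
        simp only [Finset.coe_union, Set.mem_union, Finset.coe_biUnion, Set.mem_iUnion]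
        exact Or.inr ⟨i, by simp, Or.inr (by simp)⟩)
      obtain ⟨y, hy⟩ := GlobalState.samePorts_run (S := S) w n ⟨v, hv⟩
      have hy' : S.run w n v = _ := hy
      simp only [GlobalState.run, GlobalState.next, ← h1, ← h2]
      rw [hy']
      simp only [Option.map_some, Option.some.injEq, NodeState.mk.injEq, heq_eq_eq, true_and]
      funext i
      unfold GlobalState.msg
      beta_reduce
      rw [show S.run w n ((S.node ⟨v, hv⟩).nbr i) = S.run w' n ((S.node ⟨v, hv⟩).nbr i) from h3 i,
        show w (n, (S.node ⟨v, hv⟩).nbr i) = w' (n, (S.node ⟨v, hv⟩).nbr i) from h4 i]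
    · simp only [GlobalState.run_eq_none _ _ hv]
      exact FiniteDep.const _

theorem finiteDep_edgeOut {O V : Type} {B : EdgeAlgorithm O} (S : GlobalState B V) (n : ℕ)
    (e : Sym2 V) : FiniteDep fun w => (S.run w n).edgeOut e := by
  classical
  induction e with
  | h u v =>
    have key : ∀ u v, FiniteDep fun w => (S.run w n).outReg u v := fun u v =>
      (finiteDep_run S n u).map fun x => GlobalState.outReg (fun _ => x) u v
    exact ((key u v).prodMk (key v u)).map fun x => if x.1 = x.2 then x.1 else none

section RunExec

variable {O V : Type} {P : LCLProblem O} {A : PhaseAlgorithm O} {Δ b : ℕ}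
  {S : GlobalState (edgeAlgorithm A P Δ b) V} (hS : S.WellFormed)

/-- The run with the coins `w` as an execution. -/
noncomputable abbrev runExec (w : ℕ × V → ℕ) :
    Exec A P Δ b S.graph (S.ports hS) Set.univ (fun n (v : ↥S.verts) => w (n, v.1)) :=
  (follows_run S w).exec hS

theorem runExec_cfg (w : ℕ × V → ℕ) (n : ℕ) (e : S.graph.edgeSet) :
    (runExec hS w).cfg n e = (S.run w n).edgeOut (S.name e) := by
  obtain ⟨u, v, h, rfl⟩ := exists_lineNode e
  exact ((follows_run S w).edgeOut_eq hS n trivial trivial h).symm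

theorem finiteDep_cfg (n : ℕ) (e : S.graph.edgeSet) :
    FiniteDep fun w => (runExec hS w).cfg n e := by
  simp only [runExec_cfg]
  exact finiteDep_edgeOut S n _

variable {w w' : ℕ × V → ℕ} {n n₀ : ℕ}

theorem runExec_cfg_congr (h : S.run w n = S.run w' n) :
    (runExec hS w).cfg n = (runExec hS w').cfg n := by
  funext e
  rw [runExec_cfg, runExec_cfg, h]

theorem runExec_reg_congr (h : S.run w n = S.run w' n) :
    (runExec hS w).reg n = (runExec hS w').reg n := by
  funext v
  change ((S.node v).content (S.run w n v)).1 = ((S.node v).content (S.run w' n v)).1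
  rw [h]

theorem runExec_bit_congr (h : S.run w n = S.run w' n) :
    (runExec hS w).bit n = (runExec hS w').bit n := by
  funext v
  unfold Exec.bit
  rw [runExec_reg_congr hS h]

theorem starts_iff_runExec {u v : ↥S.verts} {h : S.graph.Adj u v} :
    (runExec hS w).Starts n u v h ↔
      (((S.node u).content (S.run w n u)).1.stage = 1 ∧
      ((S.node v).content (S.run w n v)).1.stage = 1 ∧
      ((S.node u).content (S.run w n u)).1.bit ≠ ((S.node v).content (S.run w n v)).1.bit ∧
      ((S.node u).content (S.run w n u)).2.1 ((S.ports hS).ix u v h) = none ∧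
      ((S.node v).content (S.run w n v)).2.1 ((S.ports hS).ix v u h.symm) = none) :=
  ⟨fun h => h.2.2, fun h => ⟨trivial, trivial, h⟩⟩

theorem runExec_startEdges_congr (h : S.run w n = S.run w' n) :
    (runExec hS w).startEdges n = (runExec hS w').startEdges n := by
  ext e
  obtain ⟨u, v, huv, rfl⟩ := exists_lineNode e
  rw [Exec.mem_startEdges, Exec.mem_startEdges, starts_iff_runExec, starts_iff_runExec, h]

theorem finiteDep_startEdges (n : ℕ) (e : S.graph.edgeSet) :
    FiniteDep fun w => e ∈ (runExec hS w).startEdges n := by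
  obtain ⟨u, v, huv, rfl⟩ := exists_lineNode e
  simp only [Exec.mem_startEdges, starts_iff_runExec]
  exact ((finiteDep_run S n u).prodMk (finiteDep_run S n v)).map fun x =>
      (((S.node u).content x.1).1.stage = 1 ∧
      ((S.node v).content x.2).1.stage = 1 ∧
      ((S.node u).content x.1).1.bit ≠ ((S.node v).content x.2).1.bit ∧
      ((S.node u).content x.1).2.1 ((S.ports hS).ix u v huv) = none ∧
      ((S.node v).content x.2).2.1 ((S.ports hS).ix v u huv.symm) = none)

/-! ### The configurations of a run -/

/-- A time from which on the configuration of a run without manipulations is strong. -/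
def strongTime (φ ν : ℕ) : ℕ := 2 * φ + 1 + 3 * (ν + 1)

variable {ν : ℕ}

/-- The configuration after a phase in which the edges in `W` take part, with the roles given by the
bits `β`. -/
noncomputable def phaseStep {V O : Type} (A : PhaseAlgorithm O) {G : SimpleGraph V}
    (p : PortNumbering G) (C : G.edgeSet → Option O) (W : Set G.edgeSet) (β : V → Bool)
    (ρ : G.edgeSet × ℕ → ℕ) : G.edgeSet → Option O :=
  A.phaseOn G.lineGraph C W (linePorts p β W) ρ

theorem startEdges_undecided (hn : 1 ≤ n₀) :
    ∀ e ∈ (runExec hS w).startEdges n₀, ∀ m ≤ 2 * A.phi - 2,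
      (runExec hS w).cfg (n₀ + m) e = none := by
  rintro _ ⟨u, v, h, rfl, hst⟩ m hm
  exact Exec.cfg_of_starts hn hst hm

/-- In the strong regime no output value is lost, so a round changes the configuration exactly by
the decisions of the phase that ends in this round. -/
theorem cfg_succ_eq_phaseStep (hadm : Admissible A P Δ b S.graph fun n v => w (n, v.1))
    (hν : P.BoundedInfluence ν) (hn : strongTime A.phi ν ≤ n₀ + (2 * A.phi - 2)) :
    (runExec hS w).cfg (n₀ + (2 * A.phi - 2) + 1) =
      phaseStep A (S.ports hS) ((runExec hS w).cfg (n₀ + (2 * A.phi - 2)))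
        ((runExec hS w).startEdges n₀) ((runExec hS w).bit n₀) ((runExec hS w).simCoins n₀) := by
  have h0 := A.two_le_phi
  unfold strongTime at hn
  have hk0 : ∀ v : ↥S.verts, 0 < (fun _ : ↥S.verts => A.phi) v → v ∈ (Set.univ : Set ↥S.verts) :=
    fun v _ => trivial
  have hk1 : ∀ u v, S.graph.Adj u v →
      (fun _ : ↥S.verts => A.phi) u ≤ (fun _ : ↥S.verts => A.phi) v + 1 :=
    fun u v _ => Nat.le_succ _
  have hs := Exec.steadyFrom_two_mul_phi (X := runExec hS w)
  have hstrong := Exec.strong_cfg hadm (X := runExec hS w) hν hn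
  funext e
  by_cases he : e ∈ (runExec hS w).startEdges n₀
  · exact Exec.cfg_commit hk0 hk1 (by omega) hadm.bounded hadm.short hadm.support hs.1 (by omega)
      (hs.2 _ (by omega)) he fun _ _ _ _ => le_rfl
  · rw [phaseStep, PhaseAlgorithm.phaseOn_of_notMem he]
    obtain ⟨u, v, h, rfl⟩ := exists_lineNode e
    rcases ho : (runExec hS w).cfg (n₀ + (2 * A.phi - 2)) (lineNode u v h) with _ | o
    · by_contra hne
      obtain ⟨n₁, h1, h2, h3⟩ := Exec.cfg_succ_of_none hs.1 (by omega) (hs.2 _ (by omega)) ho hne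
      obtain rfl : n₀ = n₁ := by omega
      exact he (Exec.mem_startEdges.2 h3)
    · rcases Exec.cfg_succ_of_some (by omega) (hs.2 _ (by omega)) ho with h1 | h1
      · exact h1
      · refine absurd ?_ h1.2.2
        rw [Exec.outputs_eq_of_deep hk0 hk1 (hs.2 _ (by omega)) fun _ _ => h0]
        exact (content_iff ho).1 (hstrong _ (by simp [ho]))

/-- In the strong regime output values are never lost. -/
theorem cfg_extends (hadm : Admissible A P Δ b S.graph fun n v => w (n, v.1))
    (hν : P.BoundedInfluence ν) (hn : strongTime A.phi ν ≤ n) {m : ℕ} (hm : n ≤ m)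
    {e : S.graph.edgeSet} {o : O} (ho : (runExec hS w).cfg n e = some o) :
    (runExec hS w).cfg m e = some o := by
  have h0 := A.two_le_phi
  induction m, hm using Nat.le_induction with
  | base => exact ho
  | succ m hm ih =>
    obtain ⟨n₀, rfl⟩ : ∃ n₀, m = n₀ + (2 * A.phi - 2) :=
      ⟨m - (2 * A.phi - 2), by unfold strongTime at hn; omega⟩
    rw [cfg_succ_eq_phaseStep hS hadm hν (by omega)]
    refine PhaseAlgorithm.phaseOn_of_decided (fun e he => ?_) ih _
    exact startEdges_undecided hS (by unfold strongTime at hn; omega) e he _ le_rfl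

/-- The configuration in whose presence the decisions of a phase are taken does not depend on the
coins of the simulated algorithm in this phase. -/
theorem cfg_eq_of_coins_eq (hadm : Admissible A P Δ b S.graph fun n v => w (n, v.1))
    (hadm' : Admissible A P Δ b S.graph fun n v => w' (n, v.1))
    (hν : P.BoundedInfluence ν) (hn : strongTime A.phi ν ≤ n₀)
    (h : ∀ x : ℕ × V, x.1 < n₀ → w x = w' x) {m : ℕ} (hm : m ≤ 2 * A.phi - 2) :
    (runExec hS w).cfg (n₀ + m) = (runExec hS w').cfg (n₀ + m) := by
  have h0 := A.two_le_phi
  induction m with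
  | zero => exact runExec_cfg_congr hS (dependsOn_run S n₀ h)
  | succ m ih =>
    obtain ⟨n₁, hn₁⟩ : ∃ n₁, n₀ + m = n₁ + (2 * A.phi - 2) :=
      ⟨n₀ + m - (2 * A.phi - 2), by unfold strongTime at hn; omega⟩
    have hlt : n₁ < n₀ := by omega
    have hrun : S.run w n₁ = S.run w' n₁ := dependsOn_run S n₁ fun x hx => h x (by
      have : x.1 < n₁ := hx
      omega)
    have hih := ih (by omega)
    rw [hn₁] at hih
    have hbit := runExec_bit_congr hS hrun
    have hcoins : (runExec hS w).simCoins n₁ = (runExec hS w').simCoins n₁ := by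
      funext x
      have h1 := congrArg (fun β => coinAt A Δ (w (n₁, (tail β x.1).1))
        ((S.ports hS).ix (tail β x.1) (head β x.1) (adj_tail_head _ _)) x.2) hbit
      refine h1.trans ?_
      rw [h _ (show (n₁, _).1 < n₀ from hlt)]
      rfl
    rw [← add_assoc, hn₁, cfg_succ_eq_phaseStep hS hadm hν (by omega),
      cfg_succ_eq_phaseStep hS hadm' hν (by omega), hih, hbit, hcoins,
      runExec_startEdges_congr hS hrun]

end RunExec

/-! ### The expected progress of a run -/

instance {O : Type} (B : EdgeAlgorithm O) (V : Type) : IsProbabilityMeasure (B.coins V) := by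
  unfold EdgeAlgorithm.coins
  infer_instance

theorem lintegral_coins_resample {O V : Type} {B : EdgeAlgorithm O} (J : Set (ℕ × V))
    {f : (ℕ × V → ℕ) → ℝ≥0∞} (hf : Measurable f) :
    ∫⁻ w, f w ∂B.coins V = ∫⁻ w, ∫⁻ w', f (resample J w w') ∂B.coins V ∂B.coins V :=
  lintegral_resample B.coin J hf

/-- The assumptions under which the progress of a run on the graph `G` is analysed. -/
structure Progressive {V O : Type} (A : PhaseAlgorithm O) (P : LCLProblem O) (Δ b ν : ℕ) (β : ℝ)
    (κ : PotentialCoefficients O) (G : SimpleGraph V) : Prop where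
  core : P.CoreCoverage
  respectful : A.RespectfulDecisions P (2 * Δ - 2)
  short : A.MessagesAtMost (2 * Δ - 2) b
  bounded : DegreeBounded Δ G
  isInstance : P.Instance (2 * Δ - 2) G.lineGraph
  hereditary : P.HereditaryClosure (2 * Δ - 2)
  influence : P.BoundedInfluence ν
  pos : 0 < β
  lt_one : β < 1
  progress : A.ProgressWith P (2 * Δ - 2) β κ

theorem Progressive.admissible {V O : Type} {A : PhaseAlgorithm O} {P : LCLProblem O} {Δ b ν : ℕ}
    {β : ℝ} {κ : PotentialCoefficients O} {G : SimpleGraph V} (h : Progressive A P Δ b ν β κ G)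
    {r : ℕ → V → ℕ}
    (hr : ∀ n v, r n v ∈ (seedCoin A.coin (Fin Δ × Fin A.phi) (Draw A.phi)).support) :
    Admissible A P Δ b G r :=
  ⟨h.core, h.respectful, h.short, h.bounded, h.isInstance, hr⟩

section ExpectedProgress

variable {O V : Type} {P : LCLProblem O} {A : PhaseAlgorithm O} {Δ b ν : ℕ} {β : ℝ}
  {κ : PotentialCoefficients O} {S : GlobalState (edgeAlgorithm A P Δ b) V} (hS : S.WellFormed)

theorem measurable_potential_cfg (hG : Progressive A P Δ b ν β κ S.graph) (n : ℕ) :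
    Measurable fun w => κ.potential S.graph.lineGraph ((runExec hS w).cfg n) :=
  κ.measurable_potential hG.isInstance.2 (finiteDep_cfg hS n)

open Classical in
/-- The contribution to the potential, at time `n`, of a pair of adjacent edges that both started a
phase at time `n₀`. -/
noncomputable def startedPair (κ : PotentialCoefficients O) (w : ℕ × V → ℕ) (n₀ n : ℕ)
    (e : Sym2 S.graph.edgeSet) : ℝ≥0∞ :=
  if ∀ x ∈ e, x ∈ (runExec hS w).startEdges n₀ then
    κ.pair S.graph.lineGraph ((runExec hS w).cfg n) e else 0

theorem finiteDep_pair_cfg (hG : Progressive A P Δ b ν β κ S.graph) (n : ℕ)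
    (e : Sym2 S.graph.edgeSet) :
    FiniteDep fun w => κ.pair S.graph.lineGraph ((runExec hS w).cfg n) e :=
  FiniteDep.pair κ hG.isInstance.2 (finiteDep_cfg hS n) e

theorem finiteDep_startedPair (hG : Progressive A P Δ b ν β κ S.graph) (n₀ n : ℕ)
    (e : Sym2 S.graph.edgeSet) : FiniteDep fun w => startedPair hS κ w n₀ n e := by
  classical
  have h1 := finiteDep_pair_cfg hS hG n e
  induction e with
  | h x y =>
    have h2 := FiniteDep.map (((finiteDep_startEdges hS n₀ x).prodMk
      (finiteDep_startEdges hS n₀ y)).prodMk h1) (fun z => if z.1.1 ∧ z.1.2 then z.2 else 0)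
    convert h2 using 3
    simp [startedPair]

variable {n₀ : ℕ}

/-- The coins of the simulated edges are as good as independent coins of the edges: different edges
use different ports of their tails or have different tails. -/
theorem lintegral_phaseStep (hG : Progressive A P Δ b ν β κ S.graph) (w : ℕ × V → ℕ) :
    ∫⁻ w', κ.potential S.graph.lineGraph (phaseStep A (S.ports hS)
        ((runExec hS w).cfg (n₀ + (2 * A.phi - 2))) ((runExec hS w).startEdges n₀)
        ((runExec hS w).bit n₀)
        (fun x => coinAt A Δ (w' (n₀, (tail ((runExec hS w).bit n₀) x.1).1))
          ((S.ports hS).ix _ _ (adj_tail_head ((runExec hS w).bit n₀) x.1)) x.2))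
        ∂(edgeAlgorithm A P Δ b).coins V =
    ∫⁻ r, κ.potential S.graph.lineGraph (phaseStep A (S.ports hS)
        ((runExec hS w).cfg (n₀ + (2 * A.phi - 2))) ((runExec hS w).startEdges n₀)
        ((runExec hS w).bit n₀) r) ∂A.coins S.graph.edgeSet := by
  set C := (runExec hS w).cfg (n₀ + (2 * A.phi - 2))
  set W := (runExec hS w).startEdges n₀
  set τ := (runExec hS w).bit n₀
  have hdeg : ∀ v, (S.ports hS).deg v ≤ Δ := (S.ports hS).deg_le hG.bounded
  refine lintegral_seed (ι := ℕ × V) (Z := Draw A.phi) A.coin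
    (f := fun x : S.graph.edgeSet => ((n₀, (tail τ x).1),
      (⟨(S.ports hS).ix _ _ (adj_tail_head τ x), lt_of_lt_of_le (Fin.is_lt _) (hdeg _)⟩ : Fin Δ)))
    ?_ (g := fun r => κ.potential S.graph.lineGraph (phaseStep A (S.ports hS) C W τ r)) ?_ ?_
    (ρ := fun w' x => coinAt A Δ (w' (n₀, (tail τ x.1).1))
      ((S.ports hS).ix _ _ (adj_tail_head τ x.1)) x.2) ?_
  · intro x y hxy
    simp only [Prod.mk.injEq, true_and, Fin.mk.injEq] at hxy
    have ht : tail τ x = tail τ y := Subtype.ext hxy.1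
    rw [eq_tail_head τ x, eq_tail_head τ y]
    have key : ∀ (u u' v v' : ↥S.verts) (h : S.graph.Adj u v) (h' : S.graph.Adj u' v'), u = u' →
        ((S.ports hS).ix u v h : ℕ) = (S.ports hS).ix u' v' h' →
        lineNode u v h = lineNode u' v' h' := by
      rintro u u' v v' h h' rfl hi
      obtain rfl := (S.ports hS).ix_inj (Fin.ext hi)
      rfl
    exact key _ _ _ _ _ _ ht hxy.2
  · exact κ.measurable_potential hG.isInstance.2 fun v => PhaseAlgorithm.finiteDep_phaseOn v
  · intro r r' h
    exact congrArg (κ.potential S.graph.lineGraph) (PhaseAlgorithm.dependsOn_phaseOn h)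
  · intro w' x j
    exact dif_pos ⟨lt_of_lt_of_le (Fin.is_lt _) (hdeg _), j.2⟩

variable [Countable V]

theorem ae_progressive_admissible (hG : Progressive A P Δ b ν β κ S.graph) :
    ∀ᵐ w ∂(edgeAlgorithm A P Δ b).coins V,
      Admissible A P Δ b S.graph fun n (v : ↥S.verts) => w (n, v.1) := by
  filter_upwards [ae_mem_support (ι := ℕ × V)
    (seedCoin A.coin (Fin Δ × Fin A.phi) (Draw A.phi))] with w hw
  exact hG.admissible fun n v => hw _

/-- One step of the run: the pairs of edges that decide together lose the fraction `β` of their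
potential in expectation. -/
theorem lintegral_potential_step (hG : Progressive A P Δ b ν β κ S.graph)
    (hn : strongTime A.phi ν ≤ n₀) :
    ∫⁻ w, κ.potential S.graph.lineGraph ((runExec hS w).cfg (n₀ + (2 * A.phi - 2) + 1))
        ∂(edgeAlgorithm A P Δ b).coins V +
      ENNReal.ofReal β * ∫⁻ w, ∑' e : S.graph.lineGraph.edgeSet,
        startedPair hS κ w n₀ (n₀ + (2 * A.phi - 2)) e ∂(edgeAlgorithm A P Δ b).coins V ≤
    ∫⁻ w, κ.potential S.graph.lineGraph ((runExec hS w).cfg (n₀ + (2 * A.phi - 2)))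
        ∂(edgeAlgorithm A P Δ b).coins V := by
  have : Countable S.graph.lineGraph.edgeSet := by
    have : Countable ↥S.verts := inferInstance
    infer_instance
  have hm : Measurable fun w => ∑' e : S.graph.lineGraph.edgeSet,
      startedPair hS κ w n₀ (n₀ + (2 * A.phi - 2)) e :=
    Measurable.tsum fun e => (finiteDep_startedPair hS hG _ _ _).measurable
  rw [← lintegral_const_mul _ hm]
  -- Redraw the coins of round `n₀`. The configuration before the decisions, the participants and
  -- their roles do not depend on them.
  rw [lintegral_coins_resample {x : ℕ × V | x.1 = n₀}
    (measurable_potential_cfg hS hG (n₀ + (2 * A.phi - 2) + 1)),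
    ← lintegral_add_right _ (hm.const_mul _)]
  refine lintegral_mono_ae ?_
  have hsup := ae_mem_support (ι := ℕ × V) (seedCoin A.coin (Fin Δ × Fin A.phi) (Draw A.phi))
  filter_upwards [hsup] with w hw
  have hadm : Admissible A P Δ b S.graph fun n (v : ↥S.verts) => w (n, v.1) :=
    hG.admissible fun n v => hw _
  have hinner : ∫⁻ w', κ.potential S.graph.lineGraph
      ((runExec hS (resample {x : ℕ × V | x.1 = n₀} w w')).cfg (n₀ + (2 * A.phi - 2) + 1))
        ∂(edgeAlgorithm A P Δ b).coins V =
      ∫⁻ r, κ.potential S.graph.lineGraph (phaseStep A (S.ports hS)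
        ((runExec hS w).cfg (n₀ + (2 * A.phi - 2))) ((runExec hS w).startEdges n₀)
        ((runExec hS w).bit n₀) r) ∂A.coins S.graph.edgeSet := by
    rw [← lintegral_phaseStep hS hG w]
    refine lintegral_congr_ae ?_
    filter_upwards [hsup] with w' hw'
    set y := resample {x : ℕ × V | x.1 = n₀} w w' with hy
    have hyw : ∀ x : ℕ × V, x.1 < n₀ → y x = w x := fun x hx =>
      resample_of_notMem (J := {x : ℕ × V | x.1 = n₀}) (ne_of_lt hx) w w'
    have hadm' : Admissible A P Δ b S.graph fun n (v : ↥S.verts) => y (n, v.1) := by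
      refine hG.admissible fun n v => ?_
      by_cases h : ((n, v.1) : ℕ × V) ∈ {x : ℕ × V | x.1 = n₀}
      · rw [hy, resample_of_mem h]; exact hw' _
      · rw [hy, resample_of_notMem h]; exact hw _
    have hrun : S.run y n₀ = S.run w n₀ := dependsOn_run S n₀ hyw
    have hbit := runExec_bit_congr hS hrun
    have hst := runExec_startEdges_congr hS hrun
    have hcfg := cfg_eq_of_coins_eq hS hadm' hadm hG.influence hn hyw le_rfl
    rw [cfg_succ_eq_phaseStep hS hadm' hG.influence (by omega), hcfg, hst]
    have hcoins : (runExec hS y).simCoins n₀ =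
        fun x => coinAt A Δ (w' (n₀, (tail ((runExec hS w).bit n₀) x.1).1))
          ((S.ports hS).ix _ _ (adj_tail_head ((runExec hS w).bit n₀) x.1)) x.2 := by
      funext x
      have h1 := congrArg (fun τ => coinAt A Δ (y (n₀, (tail τ x.1).1))
        ((S.ports hS).ix (tail τ x.1) (head τ x.1) (adj_tail_head _ _)) x.2) hbit
      refine h1.trans ?_
      have h2 : y (n₀, (tail ((runExec hS w).bit n₀) x.1).1) =
          w' (n₀, (tail ((runExec hS w).bit n₀) x.1).1) :=
        resample_of_mem (J := {x : ℕ × V | x.1 = n₀}) rfl w w'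
      rw [h2]
    rw [hcoins, hbit]
  rw [hinner]
  exact hG.progress.lintegral_potential_phaseOn hG.pos hG.lt_one hG.hereditary hG.isInstance
    (Exec.strong_cfg hadm hG.influence (by unfold strongTime at hn; omega))
    fun e he => startEdges_undecided hS (by unfold strongTime at hn; omega) e he _ le_rfl

end ExpectedProgress

/-! ### Synchronization of neighboring nodes -/

/-- Among `N = 6 * φ - 2` consecutive times there is one at which the clocks of three given nodes
all show one of the values `1, …, 4 * φ - 1`: each clock excludes `2 * φ - 1` of the times. -/
theorem exists_good_time {α : Type*} (Z : Finset α) (hZ : Z.card ≤ 3) {φ : ℕ} (hφ : 2 ≤ φ)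
    (c : α → ℕ) (B : ℕ) : ∃ n, B ≤ n ∧ n < B + (6 * φ - 2) ∧
      ∀ z ∈ Z, 1 ≤ (c z + n) % (6 * φ - 2) ∧ (c z + n) % (6 * φ - 2) ≤ 4 * φ - 1 := by
  classical
  by_contra! hcon
  set N := 6 * φ - 2 with hN
  let bad : Finset ℕ := insert 0 (Finset.Ico (4 * φ) N)
  have hbad : bad.card ≤ 2 * φ - 1 := by
    refine (Finset.card_insert_le _ _).trans ?_
    rw [Nat.card_Ico]
    omega
  have hsub : Finset.Ico B (B + N) ⊆
      Z.biUnion fun z => {n ∈ Finset.Ico B (B + N) | (c z + n) % N ∈ bad} := by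
    intro n hn
    have hn' := Finset.mem_Ico.1 hn
    obtain ⟨z, hz, h1⟩ := hcon n hn'.1 hn'.2
    have hlt : (c z + n) % N < N := Nat.mod_lt _ (by omega)
    simp only [Finset.mem_biUnion, Finset.mem_filter, bad, Finset.mem_insert, Finset.mem_Ico]
    refine ⟨z, hz, hn'.imp id id |> fun h => by simpa using h, ?_⟩
    by_contra hb
    push Not at hb
    have := h1 (by omega)
    have := hb.2 (by omega)
    omega
  have h1 := Finset.card_le_card hsub
  have h2 : (Z.biUnion fun z => {n ∈ Finset.Ico B (B + N) | (c z + n) % N ∈ bad}).card ≤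
      Z.card * (2 * φ - 1) := by
    refine Finset.card_biUnion_le_card_mul _ _ _ fun z _ => le_trans ?_ hbad
    refine Finset.card_le_card_of_injOn (fun n => (c z + n) % N)
      (fun n hn => (Finset.mem_filter.1 hn).2) ?_
    intro n hn m hm hnm
    have hn' := Finset.mem_Ico.1 (Finset.mem_filter.1 hn).1
    have hm' := Finset.mem_Ico.1 (Finset.mem_filter.1 hm).1
    have h3 : n ≡ m [MOD N] := Nat.ModEq.add_left_cancel' (c z) hnm
    rcases le_total n m with h | h
    · have h4 := (Nat.modEq_iff_dvd' h).1 h3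
      have := Nat.eq_zero_of_dvd_of_lt h4 (by omega)
      omega
    · have h4 := (Nat.modEq_iff_dvd' h).1 h3.symm
      have := Nat.eq_zero_of_dvd_of_lt h4 (by omega)
      omega
  have h3 : Z.card * (2 * φ - 1) ≤ 3 * (2 * φ - 1) := Nat.mul_le_mul_right _ hZ
  rw [Nat.card_Ico] at h1
  omega

section Clock

variable {V O : Type} {A : PhaseAlgorithm O} {P : LCLProblem O} {Δ b : ℕ}
  {G : SimpleGraph V} {p : PortNumbering G} {r : ℕ → V → ℕ}
  (X : Exec A P Δ b G p Set.univ r)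

theorem Exec.ctr_eq (n : ℕ) (v : V) :
    ((X.reg n v).ctr : ℕ) = ((X.reg 0 v).ctr + n) % (6 * A.phi - 2) := by
  have h0 := A.two_le_phi
  have hN : 6 * A.phi - 3 + 1 = 6 * A.phi - 2 := by omega
  induction n with
  | zero => rw [add_zero, Nat.mod_eq_of_lt (hN ▸ (X.reg 0 v).ctr.2)]
  | succ n ih =>
    rw [X.reg_succ n v trivial]
    simp only [EdgeRegs.next]
    rw [ih]
    simp only [hN]
    rw [Nat.mod_add_mod, add_assoc]

/-- What a node draws when its clock shows `0` stays in force until the clock shows `0` again. -/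
theorem Exec.draw_eq {n : ℕ} {v : V} (h : ((X.reg n v).ctr : ℕ) = 0) {j : ℕ}
    (hj : j + 1 ≤ 6 * A.phi - 3) :
    ((X.reg (n + (j + 1)) v).ctr : ℕ) = j + 1 ∧
      (X.reg (n + (j + 1)) v).off = (coinDraw A Δ (r n v)).1 ∧
      (X.reg (n + (j + 1)) v).bit = (coinDraw A Δ (r n v)).2 := by
  have h0 := A.two_le_phi
  induction j with
  | zero =>
    have hz : (X.reg n v).ctr = 0 := Fin.ext h
    rw [zero_add, X.reg_succ n v trivial]
    simp only [EdgeRegs.next, hz, if_true, Fin.val_zero, zero_add, and_true]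
    exact Nat.mod_eq_of_lt (by omega)
  | succ j ih =>
    obtain ⟨h1, h2, h3⟩ := ih (by omega)
    have hz : (X.reg (n + (j + 1)) v).ctr ≠ 0 := by
      intro hz
      rw [hz] at h1
      simp at h1
    rw [← add_assoc n, X.reg_succ _ v trivial]
    simp only [EdgeRegs.next, if_neg hz, h1, h2, h3, and_true]
    exact Nat.mod_eq_of_lt (by omega)

end Clock

section Synchronize

variable {O V : Type} {P : LCLProblem O} {A : PhaseAlgorithm O} {Δ b : ℕ}
  {S : GlobalState (edgeAlgorithm A P Δ b) V} (hS : S.WellFormed)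

/-- A lower bound on the probability that at most three nodes start a phase together, with given
roles. -/
noncomputable def syncProb (φ : ℕ) : ℝ≥0∞ := ((8 * φ - 2 : ℕ) : ℝ≥0∞)⁻¹ ^ 3

theorem coinDraw_uniform (z : Draw A.phi) :
    (edgeAlgorithm A P Δ b).coin.toMeasure {n | coinDraw A Δ n = z} =
      ((8 * A.phi - 2 : ℕ) : ℝ≥0∞)⁻¹ := by
  have h0 := A.two_le_phi
  refine (seedCoin_uniform A.coin z).trans ?_
  rw [Fintype.card_prod, Fintype.card_fin, Fintype.card_bool]
  congr 2
  omega

/-- Whatever happened before time `T`, at most three nodes have a good chance to start a phase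
together, with prescribed roles, at a time determined by the clocks. -/
theorem exists_sync (Z : Finset ↥S.verts) (hZ : Z.card ≤ 3) (τ : ↥S.verts → Bool) (T : ℕ) :
    ∃ n₀, T ≤ n₀ ∧ n₀ < T + 2 * (6 * A.phi - 2) ∧ ∃ E : Set (ℕ × V → ℕ), MeasurableSet E ∧
      DependsOn (· ∈ E) {x : ℕ × V | T ≤ x.1} ∧
      syncProb A.phi ≤ (edgeAlgorithm A P Δ b).coins V E ∧
      ∀ w ∈ E, ∀ z ∈ Z, (runExec hS w).stage n₀ z = 1 ∧ (runExec hS w).bit n₀ z = τ z := by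
  classical
  have h0 := A.two_le_phi
  set N := 6 * A.phi - 2 with hN
  let c : ↥S.verts → ℕ := fun z => ((S.node z).content (S z)).1.ctr
  obtain ⟨n₀, h1, h2, h3⟩ := exists_good_time Z hZ h0 c (T + N)
  rw [← hN] at h2
  simp only [← hN] at h3
  have hlt : ∀ z, (c z + n₀) % N < N := fun z => Nat.mod_lt _ (by omega)
  -- The last time up to `n₀` when the clock of `z` showed `0`, and the offset which, drawn at this
  -- time, makes `z` start a phase at time `n₀`.
  let t : ↥S.verts → ℕ := fun z => n₀ - (c z + n₀) % N
  let off : ↥S.verts → Fin (4 * A.phi - 2 + 1) := fun z => Fin.ofNat _ ((c z + n₀) % N - 1)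
  let E : Set (ℕ × V → ℕ) := {w | ∀ z ∈ Z, coinDraw A Δ (w (t z, z.1)) = (off z, τ z)}
  have hdep : ∀ z, FiniteDep fun w : ℕ × V → ℕ => coinDraw A Δ (w (t z, z.1)) = (off z, τ z) :=
    fun z => (FiniteDep.eval (t z, z.1)).map fun n => coinDraw A Δ n = (off z, τ z)
  refine ⟨n₀, by omega, by omega, E, ?_, ?_, ?_, ?_⟩
  · have : E = ⋂ z ∈ Z, {w : ℕ × V → ℕ | coinDraw A Δ (w (t z, z.1)) = (off z, τ z)} := by
      ext w; simp [E]
    rw [this]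
    exact Finset.measurableSet_biInter _ fun z _ => measurableSet_setOfPred.2 (hdep z).measurable
  · intro w w' h
    refine propext (forall₂_congr fun z _ => ?_)
    rw [h (t z, z.1) (by
      have := hlt z
      change T ≤ n₀ - (c z + n₀) % N
      omega)]
  · let I : Finset (ℕ × V) := Z.image fun z => (t z, z.1)
    have hinj : Function.Injective fun z : ↥S.verts => (t z, z.1) := fun x y h =>
      Subtype.ext (Prod.ext_iff.1 h).2
    let s : ℕ × V → Set ℕ := fun x =>
      {n | ∀ z : ↥S.verts, z.1 = x.2 → coinDraw A Δ n = (off z, τ z)}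
    have hE : E = (I : Set (ℕ × V)).pi s := by
      ext w
      simp only [E, I, s, Set.mem_ofPred_eq, Set.mem_pi, Finset.mem_coe, Finset.mem_image]
      constructor
      · rintro h _ ⟨z, hz, rfl⟩ z' hz'
        obtain rfl := Subtype.ext hz'
        exact h _ hz
      · exact fun h z hz => h _ ⟨z, hz, rfl⟩ z rfl
    rw [hE, EdgeAlgorithm.coins, Measure.infinitePi_pi _ (fun _ _ => MeasurableSet.of_discrete),
      Finset.prod_image fun x _ y _ h => hinj h]
    have hp : ∀ z ∈ Z, (edgeAlgorithm A P Δ b).coin.toMeasure (s (t z, z.1)) =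
        ((8 * A.phi - 2 : ℕ) : ℝ≥0∞)⁻¹ := by
      intro z _
      rw [← coinDraw_uniform (P := P) (b := b) (Δ := Δ) (off z, τ z)]
      congr 1
      ext n
      exact ⟨fun h => h z rfl, fun h z' hz' => Subtype.ext hz' ▸ h⟩
    rw [Finset.prod_congr rfl hp, Finset.prod_const, syncProb]
    refine pow_le_pow_of_le_one zero_le ?_ hZ
    rw [ENNReal.inv_le_one]
    exact_mod_cast (by omega : 1 ≤ 8 * A.phi - 2)
  · intro w hw z hz
    obtain ⟨h4, h5⟩ := h3 z hz
    have h6 := hlt z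
    have h7 : n₀ = t z + (((c z + n₀) % N - 1) + 1) := by
      simp only [t]; omega
    have hc0 : (((runExec hS w).reg (t z) z).ctr : ℕ) = 0 := by
      rw [Exec.ctr_eq]
      change (c z + (n₀ - (c z + n₀) % N)) % N = 0
      have h8 : c z + (n₀ - (c z + n₀) % N) = (c z + n₀) - (c z + n₀) % N := by omega
      rw [h8]
      exact Nat.mod_eq_zero_of_dvd (Nat.dvd_sub_mod _)
    obtain ⟨h8, h9, h10⟩ := Exec.draw_eq (runExec hS w) hc0 (j := (c z + n₀) % N - 1) (by omega)
    rw [← h7] at h8 h9 h10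
    have hd := hw z hz
    have hd' : coinDraw A Δ ((fun n (v : ↥S.verts) => w (n, v.1)) (t z) z) = (off z, τ z) := hd
    constructor
    · unfold Exec.stage EdgeRegs.stage
      rw [h8, h9, hd']
      have : (off z : ℕ) = (c z + n₀) % N - 1 := by
        simp only [off, Fin.ofNat]
        exact Nat.mod_eq_of_lt (by omega)
      simp only [this]
      omega
    · unfold Exec.bit
      rw [h10, hd']

end Synchronize

/-! ### Decrease of the potential in a time window -/

section Windows

variable {O V : Type} {P : LCLProblem O} {A : PhaseAlgorithm O} {Δ b ν : ℕ} {β : ℝ}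
  {κ : PotentialCoefficients O} {S : GlobalState (edgeAlgorithm A P Δ b) V} (hS : S.WellFormed)

/-- The expected potential at time `n`. -/
noncomputable def expectedPotential (κ : PotentialCoefficients O) (n : ℕ) : ℝ≥0∞ :=
  ∫⁻ w, κ.potential S.graph.lineGraph ((runExec hS w).cfg n) ∂(edgeAlgorithm A P Δ b).coins V

/-- The expected potential of the pairs of edges that started a phase at time `n₀`, when the
decisions of this phase are taken. -/
noncomputable def expectedStarted (κ : PotentialCoefficients O) (n₀ : ℕ) : ℝ≥0∞ :=
  ∫⁻ w, ∑' e : S.graph.lineGraph.edgeSet, startedPair hS κ w n₀ (n₀ + (2 * A.phi - 2)) e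
    ∂(edgeAlgorithm A P Δ b).coins V

/-- The length of a time window in which any three nodes start a phase together with positive
probability. -/
def window (φ : ℕ) : ℕ := 2 * (6 * φ - 2) + (2 * φ - 2)

theorem mem_startEdges_of_cfg_eq_none {w : ℕ × V → ℕ} {n : ℕ} (hn : 2 * A.phi ≤ n)
    {u v : ↥S.verts} {h : S.graph.Adj u v} (hu : (runExec hS w).stage n u = 1)
    (hv : (runExec hS w).stage n v = 1) (hb : (runExec hS w).bit n u ≠ (runExec hS w).bit n v)
    (hc : (runExec hS w).cfg n (lineNode u v h) = none) :
    lineNode u v h ∈ (runExec hS w).startEdges n := by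
  have hcon := (Exec.steadyFrom_two_mul_phi (X := runExec hS w)).2 n hn
  have h1 := hcon.cfg (u := u) (v := v) trivial trivial h
  have h2 := hcon u v h trivial trivial
  rw [hc] at h1
  exact Exec.mem_startEdges.2 ⟨trivial, trivial, hu, hv, hb, h1.symm, h2 ▸ h1.symm⟩

variable {w : ℕ × V → ℕ}

open Classical in
/-- If three nodes are synchronized so that two adjacent edges start a phase together unless they
are decided, then all that is left of the potential of the pair after the phase belongs to edges
that started this phase. -/
theorem pair_le_startedPair (hG : Progressive A P Δ b ν β κ S.graph)
    (hadm : Admissible A P Δ b S.graph fun n (v : ↥S.verts) => w (n, v.1)) {n₀ m : ℕ}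
    (hn : strongTime A.phi ν ≤ n₀) (hm : n₀ + (2 * A.phi - 2) ≤ m) {x u v : ↥S.verts}
    {h : S.graph.Adj x u} {h' : S.graph.Adj x v}
    (hst : ∀ z ∈ ({x, u, v} : Finset ↥S.verts), (runExec hS w).stage n₀ z = 1 ∧
      (runExec hS w).bit n₀ z = decide (z = x)) :
    κ.pair S.graph.lineGraph ((runExec hS w).cfg m) s(lineNode x u h, lineNode x v h') ≤
      startedPair hS κ w n₀ (n₀ + (2 * A.phi - 2)) s(lineNode x u h, lineNode x v h') := by
  have h1 := hst x (by simp)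
  have h2 := hst u (by simp)
  have h3 := hst v (by simp)
  have hanti := fun (n n' : ℕ) (h : strongTime A.phi ν ≤ n) (h' : n ≤ n') e o =>
    cfg_extends hS (w := w) hadm hG.influence h h' (e := e) (o := o)
  have key : ∀ (y : ↥S.verts) (hy : S.graph.Adj x y), (runExec hS w).stage n₀ y = 1 →
      (runExec hS w).bit n₀ y = decide (y = x) →
      lineNode x y hy ∉ (runExec hS w).startEdges n₀ →
      (runExec hS w).cfg m (lineNode x y hy) ≠ none := by
    intro y hy hs hb hni hno
    refine hni (mem_startEdges_of_cfg_eq_none hS (by unfold strongTime at hn; omega) h1.1 hs ?_ ?_)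
    · rw [h1.2, hb]
      simp [hy.ne']
    · rcases ho : (runExec hS w).cfg n₀ (lineNode x y hy) with _ | o
      · rfl
      · rw [hanti n₀ m hn (by omega) _ o ho] at hno
        cases hno
  by_cases hx : lineNode x u h ∈ (runExec hS w).startEdges n₀
  · by_cases hy : lineNode x v h' ∈ (runExec hS w).startEdges n₀
    · rw [startedPair, if_pos]
      · exact κ.pair_anti (hanti _ _ (by omega) hm) _
      · intro e he
        rcases Sym2.mem_iff.1 he with rfl | rfl
        · exact hx
        · exact hy
    · rw [κ.pair_eq_zero (Sym2.mem_mk_right _ _) (key v h' h3.1 h3.2 hy)]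
      exact zero_le
  · rw [κ.pair_eq_zero (Sym2.mem_mk_left _ _) (key u h h2.1 h2.2 hx)]
    exact zero_le

/-- The probability that an event about the coins from time `T` on coincides with an event about
the past. -/
theorem lintegral_mul_syncProb_le {f : (ℕ × V → ℕ) → ℝ≥0∞} (hf : Measurable f) {T : ℕ}
    (hfT : DependsOn f {x : ℕ × V | x.1 < T}) {E : Set (ℕ × V → ℕ)} (hE : MeasurableSet E)
    (hET : DependsOn (· ∈ E) {x : ℕ × V | T ≤ x.1})
    (hp : syncProb A.phi ≤ (edgeAlgorithm A P Δ b).coins V E) :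
    syncProb A.phi * ∫⁻ w, f w ∂(edgeAlgorithm A P Δ b).coins V ≤
      ∫⁻ w, f w * E.indicator 1 w ∂(edgeAlgorithm A P Δ b).coins V := by
  have hc : {x : ℕ × V | T ≤ x.1}ᶜ = {x : ℕ × V | x.1 < T} := by
    ext x; simp
  have h := lintegral_mul_indicator_of_dependsOn (edgeAlgorithm A P Δ b).coin
    {x : ℕ × V | T ≤ x.1} hf (hc ▸ hfT) hE hET
  unfold EdgeAlgorithm.coins at hp ⊢
  rw [h, mul_comm]
  gcongr

/-- In the absence of potential, the next phase of an undecided edge decides it. -/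
theorem cfg_ne_none_of_sync (hG : Progressive A P Δ b ν β κ S.graph)
    (hw : ∀ n v, w (n, v) ∈ (seedCoin A.coin (Fin Δ × Fin A.phi) (Draw A.phi)).support)
    {n₀ m : ℕ} (hn : strongTime A.phi ν ≤ n₀) (hm : n₀ + (2 * A.phi - 2) < m)
    (h0 : κ.potential S.graph.lineGraph ((runExec hS w).cfg n₀) = 0) {u v : ↥S.verts}
    {h : S.graph.Adj u v} (hu : (runExec hS w).stage n₀ u = 1)
    (hv : (runExec hS w).stage n₀ v = 1)
    (hb : (runExec hS w).bit n₀ u ≠ (runExec hS w).bit n₀ v) :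
    (runExec hS w).cfg m (lineNode u v h) ≠ none := by
  have hadm : Admissible A P Δ b S.graph fun n (v : ↥S.verts) => w (n, v.1) :=
    hG.admissible fun n v => hw _ _
  have hanti := fun (n n' : ℕ) (h : strongTime A.phi ν ≤ n) (h' : n ≤ n') e o =>
    cfg_extends hS (w := w) hadm hG.influence h h' (e := e) (o := o)
  have hkeep : ∀ n, strongTime A.phi ν ≤ n → n ≤ m →
      (runExec hS w).cfg n (lineNode u v h) ≠ none →
      (runExec hS w).cfg m (lineNode u v h) ≠ none := by
    intro n h1 h2 h3
    obtain ⟨o, ho⟩ := Option.ne_none_iff_exists'.1 h3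
    simp [hanti n m h1 h2 _ o ho]
  by_cases hc : (runExec hS w).cfg n₀ (lineNode u v h) = none
  · refine hkeep (n₀ + (2 * A.phi - 2) + 1) (by omega) (by omega) ?_
    have hmem := mem_startEdges_of_cfg_eq_none hS (by unfold strongTime at hn; omega) hu hv hb hc
    rw [cfg_succ_eq_phaseStep hS hadm hG.influence (by omega), phaseStep]
    obtain ⟨r', hr', heq⟩ := PhaseAlgorithm.exists_phaseOn_eq (A := A) (G := S.graph.lineGraph)
      (C := (runExec hS w).cfg (n₀ + (2 * A.phi - 2))) (W := (runExec hS w).startEdges n₀)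
      (p := linePorts (S.ports hS) ((runExec hS w).bit n₀) ((runExec hS w).startEdges n₀))
      (r := (runExec hS w).simCoins n₀) fun e j hj =>
        Exec.simCoins_mem_support (X := runExec hS w) hG.bounded (fun n v => hw _ _) n₀ e hj
    rw [← heq]
    refine hG.progress.phaseOn_ne_none hG.hereditary hG.isInstance
      (Exec.strong_cfg hadm hG.influence (by unfold strongTime at hn; omega))
      (fun e he => startEdges_undecided hS (by unfold strongTime at hn; omega) e he _ le_rfl)
      ?_ hr' hmem
    exact le_antisymm (h0 ▸ κ.potential_anti (hanti _ _ hn (by omega))) zero_le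
  · exact hkeep n₀ hn (by omega) hc

variable [Countable V]

theorem expectedPotential_anti (hG : Progressive A P Δ b ν β κ S.graph) {n m : ℕ}
    (hn : strongTime A.phi ν ≤ n) (hm : n ≤ m) :
    expectedPotential hS κ m ≤ expectedPotential hS κ n := by
  refine lintegral_mono_ae ?_
  filter_upwards [ae_progressive_admissible hG] with w hadm
  exact κ.potential_anti fun e o => cfg_extends hS hadm hG.influence hn hm

/-- The expected losses of the single rounds add up. -/
theorem expectedPotential_add (hG : Progressive A P Δ b ν β κ S.graph) {T : ℕ}
    (hT : strongTime A.phi ν ≤ T) (M : ℕ) :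
    expectedPotential hS κ (T + (2 * A.phi - 2) + M) +
      ENNReal.ofReal β * ∑ i ∈ Finset.range M, expectedStarted hS κ (T + i) ≤
    expectedPotential hS κ T := by
  induction M with
  | zero =>
    simp only [Finset.range_zero, Finset.sum_empty, mul_zero, add_zero]
    exact expectedPotential_anti hS hG hT (by omega)
  | succ M ih =>
    refine le_trans ?_ ih
    rw [Finset.sum_range_succ, mul_add, add_comm (ENNReal.ofReal β * _), ← add_assoc]
    gcongr
    have h := lintegral_potential_step hS hG (n₀ := T + M) (by omega)
    have e1 : T + (2 * A.phi - 2) + (M + 1) = T + M + (2 * A.phi - 2) + 1 := by omega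
    have e2 : T + (2 * A.phi - 2) + M = T + M + (2 * A.phi - 2) := by omega
    rw [e1, e2]
    exact h

/-- With probability at least `syncProb` the three nodes of a pair of adjacent edges are
synchronized at a suitable time in the window. In this case the potential of the pair disappears or
is charged to a phase started by both edges; in any case it does not increase. -/
theorem lintegral_pair_le (hG : Progressive A P Δ b ν β κ S.graph) {T : ℕ}
    (hT : strongTime A.phi ν ≤ T) (e : S.graph.lineGraph.edgeSet) :
    ∫⁻ w, κ.pair S.graph.lineGraph ((runExec hS w).cfg (T + window A.phi)) e
        ∂(edgeAlgorithm A P Δ b).coins V +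
      syncProb A.phi * ∫⁻ w, κ.pair S.graph.lineGraph ((runExec hS w).cfg T) e
        ∂(edgeAlgorithm A P Δ b).coins V ≤
    ∑ i ∈ Finset.range (2 * (6 * A.phi - 2)),
      ∫⁻ w, startedPair hS κ w (T + i) (T + i + (2 * A.phi - 2)) e
        ∂(edgeAlgorithm A P Δ b).coins V +
      ∫⁻ w, κ.pair S.graph.lineGraph ((runExec hS w).cfg T) e
        ∂(edgeAlgorithm A P Δ b).coins V := by
  classical
  obtain ⟨x, u, v, h, h', he⟩ : ∃ x u v h h',
      (e : Sym2 S.graph.edgeSet) = s(lineNode x u h, lineNode x v h') := by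
    obtain ⟨e, he⟩ := e
    induction e with
    | h y z =>
      obtain ⟨u, v, h, rfl⟩ := exists_lineNode y
      rcases lineGraph_adj_lineNode he with ⟨w, h', -, rfl⟩ | ⟨w, h', -, rfl⟩
      · exact ⟨u, v, w, h, h', rfl⟩
      · refine ⟨v, u, w, h.symm, h', ?_⟩
        exact congrArg (fun y => s(y, lineNode v w h')) (lineNode_comm u v h)
  rw [he]
  have hmeas : ∀ n, Measurable fun w => κ.pair S.graph.lineGraph ((runExec hS w).cfg n)
      s(lineNode x u h, lineNode x v h') := fun n => (finiteDep_pair_cfg hS hG n _).measurable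
  -- The common endpoint `x` is to simulate both edges.
  obtain ⟨n₀, h1, h2, E, hE, hET, hp, hst⟩ := exists_sync hS {x, u, v} Finset.card_le_three
    (fun z => decide (z = x)) T
  have hdep : DependsOn (fun w => κ.pair S.graph.lineGraph ((runExec hS w).cfg T)
      s(lineNode x u h, lineNode x v h')) {x : ℕ × V | x.1 < T} := by
    intro w w' hw
    dsimp only
    rw [runExec_cfg_congr hS (dependsOn_run S T hw)]
  have hm0 : Measurable fun w => startedPair hS κ w n₀ (n₀ + (2 * A.phi - 2))
      s(lineNode x u h, lineNode x v h') := (finiteDep_startedPair hS hG _ _ _).measurable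
  calc _ ≤ ∫⁻ w, κ.pair S.graph.lineGraph ((runExec hS w).cfg (T + window A.phi))
            s(lineNode x u h, lineNode x v h') ∂(edgeAlgorithm A P Δ b).coins V +
          ∫⁻ w, κ.pair S.graph.lineGraph ((runExec hS w).cfg T)
            s(lineNode x u h, lineNode x v h') * E.indicator 1 w
            ∂(edgeAlgorithm A P Δ b).coins V := by
        gcongr
        exact lintegral_mul_syncProb_le (hmeas T) hdep hE hET hp
    _ = ∫⁻ w, (κ.pair S.graph.lineGraph ((runExec hS w).cfg (T + window A.phi))
            s(lineNode x u h, lineNode x v h') +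
          κ.pair S.graph.lineGraph ((runExec hS w).cfg T)
            s(lineNode x u h, lineNode x v h') * E.indicator 1 w)
            ∂(edgeAlgorithm A P Δ b).coins V := (lintegral_add_left (hmeas _) _).symm
    _ ≤ ∫⁻ w, (startedPair hS κ w n₀ (n₀ + (2 * A.phi - 2))
            s(lineNode x u h, lineNode x v h') +
          κ.pair S.graph.lineGraph ((runExec hS w).cfg T)
            s(lineNode x u h, lineNode x v h')) ∂(edgeAlgorithm A P Δ b).coins V := by
        refine lintegral_mono_ae ?_
        filter_upwards [ae_progressive_admissible hG] with w hadm
        by_cases hw : w ∈ E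
        · rw [Set.indicator_of_mem hw, Pi.one_apply, mul_one]
          gcongr
          exact pair_le_startedPair hS hG hadm (by omega) (by unfold window; omega) (hst w hw)
        · rw [Set.indicator_of_notMem hw, mul_zero, add_zero]
          refine le_trans ?_ le_add_self
          exact κ.pair_anti (fun e o => cfg_extends hS hadm hG.influence hT (by omega)) _
    _ = ∫⁻ w, startedPair hS κ w n₀ (n₀ + (2 * A.phi - 2))
            s(lineNode x u h, lineNode x v h') ∂(edgeAlgorithm A P Δ b).coins V +
          ∫⁻ w, κ.pair S.graph.lineGraph ((runExec hS w).cfg T)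
            s(lineNode x u h, lineNode x v h') ∂(edgeAlgorithm A P Δ b).coins V :=
        lintegral_add_left hm0 _
    _ ≤ _ := by
        gcongr
        obtain ⟨i, rfl⟩ := Nat.exists_eq_add_of_le h1
        exact Finset.single_le_sum (f := fun i => ∫⁻ w, startedPair hS κ w (T + i)
          (T + i + (2 * A.phi - 2)) s(lineNode x u h, lineNode x v h')
          ∂(edgeAlgorithm A P Δ b).coins V) (fun _ _ => zero_le)
          (Finset.mem_range.2 (by omega : i < 2 * (6 * A.phi - 2)))

/-- The sum of `lintegral_pair_le` over all pairs of adjacent edges. -/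
theorem expectedPotential_add_le (hG : Progressive A P Δ b ν β κ S.graph) {T : ℕ}
    (hT : strongTime A.phi ν ≤ T) :
    expectedPotential hS κ (T + window A.phi) + syncProb A.phi * expectedPotential hS κ T ≤
      ∑ i ∈ Finset.range (2 * (6 * A.phi - 2)), expectedStarted hS κ (T + i) +
        expectedPotential hS κ T := by
  have : Countable S.graph.lineGraph.edgeSet := by
    have : Countable ↥S.verts := inferInstance
    infer_instance
  have h1 : ∀ n, expectedPotential hS κ n = ∑' e : S.graph.lineGraph.edgeSet,
      ∫⁻ w, κ.pair S.graph.lineGraph ((runExec hS w).cfg n) e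
        ∂(edgeAlgorithm A P Δ b).coins V := fun n =>
    lintegral_tsum fun e => (finiteDep_pair_cfg hS hG n e).measurable.aemeasurable
  have h2 : ∀ n, expectedStarted hS κ n = ∑' e : S.graph.lineGraph.edgeSet,
      ∫⁻ w, startedPair hS κ w n (n + (2 * A.phi - 2)) e
        ∂(edgeAlgorithm A P Δ b).coins V := fun n =>
    lintegral_tsum fun e => (finiteDep_startedPair hS hG _ _ e).measurable.aemeasurable
  simp only [h1, h2]
  rw [← ENNReal.tsum_mul_left, ← ENNReal.tsum_add,
    ← Summable.tsum_finsetSum fun _ _ => ENNReal.summable,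
    ← ENNReal.tsum_add]
  exact ENNReal.tsum_le_tsum fun e => lintegral_pair_le hS hG hT e

/-- The relative loss of expected potential in a time window. -/
noncomputable def lossRate (φ : ℕ) (β : ℝ) : ℝ := β * (syncProb φ).toReal / 2

theorem syncProb_toReal {φ : ℕ} : (syncProb φ).toReal = ((8 * φ - 2 : ℕ) : ℝ)⁻¹ ^ 3 := by
  rw [syncProb, ENNReal.toReal_pow, ENNReal.toReal_inv, ENNReal.toReal_natCast]

theorem syncProb_le_one {φ : ℕ} (hφ : 2 ≤ φ) : syncProb φ ≤ 1 := by
  refine pow_le_one₀ zero_le ?_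
  rw [ENNReal.inv_le_one]
  exact_mod_cast (by omega : 1 ≤ 8 * φ - 2)

/-- Here `e₀` and `e₁` are the expected potentials before and after a time window, and `s` is the
potential involved in phases in this window. If `s` is large, then `hA` forces a loss, and
otherwise `hC` does. -/
theorem add_mul_le_of_le {e₀ e₁ s q : ℝ≥0∞} {β : ℝ} (h0 : 0 < β) (h1 : β < 1) (hq : q ≤ 1)
    (he : e₀ ≠ ⊤) (hA : e₁ + ENNReal.ofReal β * s ≤ e₀) (hC : e₁ + q * e₀ ≤ s + e₀) :
    e₁ ≤ ENNReal.ofReal (1 - β * q.toReal / 2) * e₀ := by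
  have hqt : q ≠ ⊤ := ne_top_of_le_ne_top ENNReal.one_ne_top hq
  have hq1 : q.toReal ≤ 1 := ENNReal.toReal_mono ENNReal.one_ne_top hq
  have he1 : e₁ ≠ ⊤ := ne_top_of_le_ne_top he (le_self_add.trans hA)
  have hs : s ≠ ⊤ := by
    rintro rfl
    rw [ENNReal.mul_top (by simpa using h0), add_top] at hA
    exact he (top_le_iff.1 hA)
  have hA' := ENNReal.toReal_mono he hA
  have hC' := ENNReal.toReal_mono (ENNReal.add_ne_top.2 ⟨hs, he⟩) hC
  rw [ENNReal.toReal_add he1 (ENNReal.mul_ne_top ENNReal.ofReal_ne_top hs), ENNReal.toReal_mul,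
    ENNReal.toReal_ofReal h0.le] at hA'
  rw [ENNReal.toReal_add he1 (ENNReal.mul_ne_top hqt he), ENNReal.toReal_mul,
    ENNReal.toReal_add hs he] at hC'
  have hq0 : 0 ≤ q.toReal := ENNReal.toReal_nonneg
  have e0p : 0 ≤ e₀.toReal := ENNReal.toReal_nonneg
  rw [← ENNReal.toReal_le_toReal he1 (ENNReal.mul_ne_top ENNReal.ofReal_ne_top he),
    ENNReal.toReal_mul, ENNReal.toReal_ofReal (by nlinarith)]
  generalize e₁.toReal = a at *
  generalize e₀.toReal = c at *
  generalize s.toReal = d at *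
  generalize q.toReal = t at *
  -- This is `hA' + β * hC'`, from which `d` cancels.
  have h2 : (1 + β) * a ≤ (1 + β - β * t) * c := by nlinarith
  have h3 : (1 + β - β * t) * c ≤ (1 + β) * ((1 - β * t / 2) * c) := by
    have : 0 ≤ β * t * (1 - β) * c := by
      have := sub_nonneg.2 h1.le
      positivity
    nlinarith
  exact le_of_mul_le_mul_left (h2.trans h3) (by linarith)

/-- In a time window the expected potential shrinks by a constant factor. -/
theorem expectedPotential_window (hG : Progressive A P Δ b ν β κ S.graph) {T : ℕ}
    (hT : strongTime A.phi ν ≤ T) (hfin : expectedPotential hS κ T ≠ ⊤) :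
    expectedPotential hS κ (T + window A.phi) ≤
      ENNReal.ofReal (1 - lossRate A.phi β) * expectedPotential hS κ T := by
  refine add_mul_le_of_le hG.pos hG.lt_one (syncProb_le_one A.two_le_phi) hfin ?_
    (expectedPotential_add_le hS hG hT)
  have h := expectedPotential_add hS hG hT (2 * (6 * A.phi - 2))
  have e1 : T + (2 * A.phi - 2) + 2 * (6 * A.phi - 2) = T + window A.phi := by
    unfold window; omega
  rwa [e1] at h

theorem expectedPotential_windows (hG : Progressive A P Δ b ν β κ S.graph) {T : ℕ}
    (hT : strongTime A.phi ν ≤ T) (hfin : expectedPotential hS κ T ≠ ⊤) (m : ℕ) :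
    expectedPotential hS κ (T + m * window A.phi) ≤
      ENNReal.ofReal (1 - lossRate A.phi β) ^ m * expectedPotential hS κ T := by
  induction m with
  | zero => simp
  | succ m ih =>
    have hle : expectedPotential hS κ (T + m * window A.phi) ≤ expectedPotential hS κ T :=
      expectedPotential_anti hS hG hT (by omega)
    have h := expectedPotential_window hS hG (T := T + m * window A.phi) (by omega)
      (ne_top_of_le_ne_top hfin hle)
    rw [Nat.succ_mul, ← add_assoc, pow_succ', mul_assoc]
    exact h.trans (by gcongr)

end Windows

/-! ### The expected stabilization time -/

section GeometricTail

/-- A series of probabilities that decrease geometrically, up to a factor `M`. -/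
theorem tsum_le_of_geometric {a : ℕ → ℝ≥0∞} {η M : ℝ} (h0 : 0 < η) (h1 : η ≤ 1) (hM : 1 ≤ M)
    (ha : ∀ m, a m ≤ 1) (ha' : ∀ m, a m ≤ ENNReal.ofReal (1 - η) ^ m * ENNReal.ofReal M) :
    ∑' m, a m ≤ ENNReal.ofReal ((Real.log M + 2) / η) := by
  have hl : 0 ≤ Real.log M := Real.log_nonneg hM
  set m₀ := ⌈Real.log M / η⌉₊ with hm₀
  -- From the index `m₀` on the geometric bound is at most `1`.
  have hsmall : ENNReal.ofReal (1 - η) ^ m₀ * ENNReal.ofReal M ≤ 1 := by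
    rw [← ENNReal.ofReal_pow (by linarith), ← ENNReal.ofReal_mul (pow_nonneg (by linarith) _),
      ENNReal.ofReal_le_one]
    have h2 : (1 - η) ^ m₀ ≤ Real.exp (-η) ^ m₀ :=
      pow_le_pow_left₀ (by linarith) (Real.one_sub_le_exp_neg η) _
    have h3 : Real.exp (-η) ^ m₀ ≤ M⁻¹ := by
      have h5 : M⁻¹ = Real.exp (-Real.log M) := by
        rw [Real.exp_neg, Real.exp_log (by linarith)]
      rw [← Real.exp_nat_mul, h5]
      refine Real.exp_le_exp.2 ?_
      have h4 : Real.log M / η ≤ m₀ := Nat.le_ceil _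
      rw [div_le_iff₀ h0] at h4
      linarith
    calc (1 - η) ^ m₀ * M ≤ M⁻¹ * M := by gcongr; exact h2.trans h3
      _ = 1 := inv_mul_cancel₀ (by linarith)
  have htail : ∑' m, a (m + m₀) ≤ ENNReal.ofReal (1 / η) := by
    calc ∑' m, a (m + m₀) ≤ ∑' m, ENNReal.ofReal (1 - η) ^ m := by
          refine ENNReal.tsum_le_tsum fun m => (ha' _).trans ?_
          rw [pow_add, mul_assoc]
          exact mul_le_of_le_one_right zero_le hsmall
      _ = ENNReal.ofReal (1 / η) := by
          rw [ENNReal.tsum_geometric, ← ENNReal.ofReal_one, ← ENNReal.ofReal_sub _ (by linarith),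
            one_div, ENNReal.ofReal_inv_of_pos h0]
          congr 2
          ring
  rw [← Summable.sum_add_tsum_nat_add' (k := m₀) ENNReal.summable]
  calc ∑ m ∈ Finset.range m₀, a m + ∑' m, a (m + m₀)
      ≤ (m₀ : ℝ≥0∞) + ENNReal.ofReal (1 / η) := by
        gcongr
        calc ∑ m ∈ Finset.range m₀, a m ≤ ∑ m ∈ Finset.range m₀, 1 :=
              Finset.sum_le_sum fun m _ => ha m
          _ = m₀ := by simp
    _ = ENNReal.ofReal (m₀ + 1 / η) := by
        rw [ENNReal.ofReal_add (by positivity) (by positivity), ENNReal.ofReal_natCast]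
    _ ≤ _ := by
        refine ENNReal.ofReal_le_ofReal ?_
        have h4 : (m₀ : ℝ) < Real.log M / η + 1 := Nat.ceil_lt_add_one (by positivity)
        have h5 : 1 ≤ 1 / η := by rw [le_div_iff₀ h0]; linarith
        have h6 : (Real.log M + 2) / η = Real.log M / η + 1 / η + 1 / η := by ring
        linarith

end GeometricTail

namespace PotentialCoefficients

variable {O V : Type} (κ : PotentialCoefficients O) {G : SimpleGraph V} {C : V → Option O}

theorem potential_le (F : Finset V) (hF : ∀ v ∉ F, C v ≠ none) :
    κ.potential G C ≤ κ.sigma 0 0 * (F.card : ℝ≥0∞) ^ 2 := by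
  classical
  calc κ.potential G C ≤ ∑' e : Sym2 V, κ.pair G C e :=
        ENNReal.tsum_comp_le_tsum_of_injective Subtype.val_injective _
    _ = ∑ e ∈ F.sym2, κ.pair G C e := by
        refine tsum_eq_sum fun e he => ?_
        rw [Finset.mem_sym2_iff] at he
        push Not at he
        obtain ⟨v, hv, hvF⟩ := he
        exact κ.pair_eq_zero hv (hF v hvF)
    _ ≤ ∑ e ∈ F.sym2, (κ.sigma 0 0 : ℝ≥0∞) := by
        refine Finset.sum_le_sum fun e _ => ?_
        induction e with
        | h u v =>
          rw [pair_mk]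
          split_ifs
          · exact_mod_cast κ.anti _ _ _ _ (Multiset.zero_le _) (Multiset.zero_le _)
          · exact zero_le
    _ ≤ _ := by
        rw [Finset.sum_const, nsmul_eq_mul, mul_comm]
        gcongr
        rw [Finset.card_sym2]
        have : (F.card + 1).choose 2 ≤ F.card ^ 2 := by
          rw [Nat.choose_two_right, Nat.add_sub_cancel]
          refine Nat.div_le_of_le_mul ?_
          nlinarith
        exact_mod_cast this

/-- The coefficients are integers, so that a small expected potential makes a positive potential
unlikely. -/
theorem one_le_potential (h : κ.potential G C ≠ 0) : 1 ≤ κ.potential G C := by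
  classical
  obtain ⟨e, he⟩ : ∃ e : G.edgeSet, κ.pair G C e ≠ 0 := by
    by_contra! hc
    exact h (ENNReal.tsum_eq_zero.2 hc)
  refine le_trans ?_ (ENNReal.le_tsum e)
  obtain ⟨e, hG⟩ := e
  induction e with
  | h u v =>
    dsimp only at he ⊢
    rw [pair_mk] at he ⊢
    by_cases hc : C u = none ∧ C v = none
    · rw [if_pos hc] at he ⊢
      exact_mod_cast Nat.one_le_iff_ne_zero.2 (by exact_mod_cast he)
    · rw [if_neg hc] at he
      exact absurd rfl he

end PotentialCoefficients

section Stabilization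

variable {O V : Type} {P : LCLProblem O} {A : PhaseAlgorithm O} {Δ b ν : ℕ} {β : ℝ}
  {κ : PotentialCoefficients O} {S : GlobalState (edgeAlgorithm A P Δ b) V} (hS : S.WellFormed)

theorem stableFrom_of_decided {w : ℕ × V → ℕ} (hG : Progressive A P Δ b ν β κ S.graph)
    (hadm : Admissible A P Δ b S.graph fun n (v : ↥S.verts) => w (n, v.1)) {n : ℕ}
    (hn : strongTime A.phi ν ≤ n) (hd : ∀ e, (runExec hS w).cfg n e ≠ none) :
    S.StableFrom P w n := by
  constructor
  · rw [GlobalState.legal_run_iff]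
    intro e
    have h := Exec.strong_cfg hadm (X := runExec hS w) hG.influence hn e (hd e)
    have hc : (runExec hS w).cfg n = fun e => (S.run w n).edgeOut (S.name e) :=
      funext fun e => runExec_cfg hS w n e
    rwa [hc] at h
  · intro m hm
    refine GlobalState.edgeOut_run_eq hS fun e => ?_
    rw [← runExec_cfg hS, ← runExec_cfg hS]
    obtain ⟨o, ho⟩ := Option.ne_none_iff_exists'.1 (hd e)
    rw [ho, cfg_extends hS hadm hG.influence hn hm ho]

/-- The event that some edge is undecided at time `n`. -/
def undecidedAt (n : ℕ) : Set (ℕ × V → ℕ) := {w | ∃ e, (runExec hS w).cfg n e = none}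

theorem lossRate_pos (hG : Progressive A P Δ b ν β κ S.graph) : 0 < lossRate A.phi β := by
  have h0 := A.two_le_phi
  have := hG.pos
  have : (0 : ℝ) < (8 * A.phi - 2 : ℕ) := by exact_mod_cast (by omega : 0 < 8 * A.phi - 2)
  rw [lossRate, syncProb_toReal]
  positivity

theorem lossRate_le (hG : Progressive A P Δ b ν β κ S.graph) :
    lossRate A.phi β ≤ (syncProb A.phi).toReal := by
  have h1 := hG.pos
  have h2 := hG.lt_one
  have h3 : 0 ≤ (syncProb A.phi).toReal := ENNReal.toReal_nonneg
  rw [lossRate]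
  nlinarith

theorem lossRate_le_one (hG : Progressive A P Δ b ν β κ S.graph) : lossRate A.phi β ≤ 1 :=
  (lossRate_le hG).trans (ENNReal.toReal_mono ENNReal.one_ne_top (syncProb_le_one A.two_le_phi))

variable [Countable V]

theorem measurableSet_undecidedAt (n : ℕ) : MeasurableSet (undecidedAt hS n) := by
  have : Countable S.graph.edgeSet := by
    have : Countable ↥S.verts := inferInstance
    infer_instance
  have h : undecidedAt hS n = ⋃ e, {w | (runExec hS w).cfg n e = none} := by
    ext w; simp [undecidedAt]
  rw [h]
  exact MeasurableSet.iUnion fun e => measurableSet_setOfPred.2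
    ((finiteDep_cfg hS n e).map (· = none)).measurable

/-- In the strong regime the configuration is legal and constant as soon as all edges are decided,
so the time needed is bounded by counting the multiples of `M` at which some edge is undecided. -/
theorem stabilizationTime_le (hG : Progressive A P Δ b ν β κ S.graph) (M : ℕ) (hM : 0 < M) :
    ∀ᵐ w ∂(edgeAlgorithm A P Δ b).coins V, S.stabilizationTime P w ≤
      (strongTime A.phi ν : ℝ≥0∞) +
        M * ∑' m : ℕ, (undecidedAt hS (strongTime A.phi ν + m * M)).indicator 1 w := by
  classical
  filter_upwards [ae_progressive_admissible hG] with w hadm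
  by_cases h : ∃ m, w ∉ undecidedAt hS (strongTime A.phi ν + m * M)
  · set m₀ := Nat.find h
    have hst : S.StableFrom P w (strongTime A.phi ν + m₀ * M) :=
      stableFrom_of_decided hS hG hadm (Nat.le_add_right _ _) (not_exists.1 (Nat.find_spec h))
    have hpos : 0 < strongTime A.phi ν + m₀ * M := by unfold strongTime; omega
    have h1 : S.stabilizationTime P w ≤ ((strongTime A.phi ν + m₀ * M : ℕ) : ℝ≥0∞) :=
      iInf_le (fun n : {n : ℕ // 0 < n ∧ S.StableFrom P w n} => (n.1 : ℝ≥0∞)) ⟨_, hpos, hst⟩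
    refine h1.trans ?_
    rw [Nat.cast_add, Nat.cast_mul, mul_comm (m₀ : ℝ≥0∞)]
    gcongr
    calc (m₀ : ℝ≥0∞) = ∑ m ∈ Finset.range m₀,
          (undecidedAt hS (strongTime A.phi ν + m * M)).indicator 1 w := by
          rw [Finset.sum_congr rfl fun m hm => Set.indicator_of_mem
            (not_not.1 (Nat.find_min h (Finset.mem_range.1 hm))) _]
          simp [m₀]
      _ ≤ _ := ENNReal.sum_le_tsum _
  · push Not at h
    have : ∑' m : ℕ, (undecidedAt hS (strongTime A.phi ν + m * M)).indicator
        (1 : (ℕ × V → ℕ) → ℝ≥0∞) w = ⊤ := by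
      rw [tsum_congr fun m => Set.indicator_of_mem (h m) _]
      simp
    rw [this, ENNReal.mul_top (by exact_mod_cast hM.ne'), add_top]
    exact le_top

/-- Once there is no potential, an undecided edge decides in each time window with positive
probability. -/
theorem measure_undecided_window (hG : Progressive A P Δ b ν β κ S.graph) {T₀ T : ℕ}
    (hT₀ : strongTime A.phi ν ≤ T₀) (hT : T₀ ≤ T) (e : S.graph.edgeSet) :
    (edgeAlgorithm A P Δ b).coins V {w |
        κ.potential S.graph.lineGraph ((runExec hS w).cfg T₀) = 0 ∧
        (runExec hS w).cfg (T + window A.phi) e = none} ≤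
      (1 - syncProb A.phi) * (edgeAlgorithm A P Δ b).coins V {w |
        κ.potential S.graph.lineGraph ((runExec hS w).cfg T₀) = 0 ∧
        (runExec hS w).cfg T e = none} := by
  classical
  have hD : ∀ n, MeasurableSet {w : ℕ × V → ℕ |
      κ.potential S.graph.lineGraph ((runExec hS w).cfg T₀) = 0 ∧
      (runExec hS w).cfg n e = none} := fun n =>
    (measurable_potential_cfg hS hG T₀ (measurableSet_singleton 0)).inter
      (measurableSet_setOfPred.2 ((finiteDep_cfg hS n e).map (· = none)).measurable)
  set D := fun n => {w : ℕ × V → ℕ |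
      κ.potential S.graph.lineGraph ((runExec hS w).cfg T₀) = 0 ∧
      (runExec hS w).cfg n e = none} with hDdef
  obtain ⟨u, v, h, rfl⟩ := exists_lineNode e
  obtain ⟨n₀, h1, h2, E, hE, hET, hp, hst⟩ := exists_sync hS {u, v}
    (Finset.card_le_two.trans (by omega)) (fun z => decide (z = u)) T
  have hdep : DependsOn ((D T).indicator (1 : (ℕ × V → ℕ) → ℝ≥0∞)) {x : ℕ × V | x.1 < T} := by
    intro w w' hw
    have e1 := runExec_cfg_congr hS (dependsOn_run S T hw)
    have e2 := runExec_cfg_congr hS (dependsOn_run S T₀ fun x (hx : x.1 < T₀) =>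
      hw x (show x.1 < T by omega))
    have e3 : w ∈ D T ↔ w' ∈ D T := by
      simp only [hDdef, Set.mem_ofPred_eq, e1, e2]
    by_cases hm : w ∈ D T
    · rw [Set.indicator_of_mem hm, Set.indicator_of_mem (e3.1 hm)]; rfl
    · rw [Set.indicator_of_notMem hm, Set.indicator_of_notMem fun h => hm (e3.2 h)]
  have key := lintegral_mul_syncProb_le (measurable_one.indicator (hD T)) hdep hE hET hp
  have hmain : (edgeAlgorithm A P Δ b).coins V (D (T + window A.phi)) +
      syncProb A.phi * (edgeAlgorithm A P Δ b).coins V (D T) ≤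
      (edgeAlgorithm A P Δ b).coins V (D T) := by
    rw [← lintegral_indicator_one (hD (T + window A.phi)), ← lintegral_indicator_one (hD T)]
    refine (add_le_add_right key _).trans ?_
    rw [← lintegral_add_left (measurable_one.indicator (hD _))]
    refine lintegral_mono_ae ?_
    filter_upwards [ae_mem_support (ι := ℕ × V)
      (seedCoin A.coin (Fin Δ × Fin A.phi) (Draw A.phi))] with w hw
    have hadm : Admissible A P Δ b S.graph fun n (v : ↥S.verts) => w (n, v.1) :=
      hG.admissible fun n v => hw _
    have hsub : w ∈ D (T + window A.phi) → w ∈ D T := by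
      rintro ⟨h3, h4⟩
      refine ⟨h3, ?_⟩
      rcases ho : (runExec hS w).cfg T (lineNode u v h) with _ | o
      · rfl
      · rw [cfg_extends hS hadm hG.influence (by omega) (Nat.le_add_right T _) ho] at h4
        cases h4
    by_cases hwE : w ∈ E
    · have hnot : w ∉ D (T + window A.phi) := by
        rintro ⟨h3, h4⟩
        have hu := hst w hwE u (by simp)
        have hv := hst w hwE v (by simp)
        refine cfg_ne_none_of_sync hS hG (fun n v => hw _) (n₀ := n₀) (by omega)
          (m := T + window A.phi) (by unfold window; omega) ?_ hu.1 hv.1 ?_ h4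
        · exact le_antisymm (h3 ▸ κ.potential_anti fun e o =>
            cfg_extends hS hadm hG.influence hT₀ (by omega)) zero_le
        · rw [hu.2, hv.2]
          simp [h.ne']
      rw [Set.indicator_of_notMem hnot, Set.indicator_of_mem hwE]
      simp
    · rw [Set.indicator_of_notMem hwE, mul_zero, add_zero]
      by_cases hm : w ∈ D (T + window A.phi)
      · rw [Set.indicator_of_mem hm, Set.indicator_of_mem (hsub hm)]
      · rw [Set.indicator_of_notMem hm]
        exact zero_le
  rw [ENNReal.sub_mul fun _ _ => measure_ne_top _ _, one_mul]
  exact ENNReal.le_sub_of_add_le_right (ENNReal.mul_ne_top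
    (ne_top_of_le_ne_top ENNReal.one_ne_top (syncProb_le_one A.two_le_phi))
    (measure_ne_top _ _)) hmain

/-- The iteration of `measure_undecided_window`. -/
theorem measure_undecided_windows (hG : Progressive A P Δ b ν β κ S.graph) {T : ℕ}
    (hT : strongTime A.phi ν ≤ T) (e : S.graph.edgeSet) (m : ℕ) :
    (edgeAlgorithm A P Δ b).coins V {w |
        κ.potential S.graph.lineGraph ((runExec hS w).cfg T) = 0 ∧
        (runExec hS w).cfg (T + m * window A.phi) e = none} ≤
      ENNReal.ofReal (1 - lossRate A.phi β) ^ m := by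
  have hq : 1 - syncProb A.phi ≤ ENNReal.ofReal (1 - lossRate A.phi β) := by
    have h1 : syncProb A.phi ≠ ⊤ :=
      ne_top_of_le_ne_top ENNReal.one_ne_top (syncProb_le_one A.two_le_phi)
    rw [← ENNReal.ofReal_toReal h1, ← ENNReal.ofReal_one, ← ENNReal.ofReal_sub _
      ENNReal.toReal_nonneg]
    exact ENNReal.ofReal_le_ofReal (by linarith [lossRate_le hG])
  induction m with
  | zero => simpa using prob_le_one
  | succ m ih =>
    have h := measure_undecided_window hS hG hT (Nat.le_add_right T (m * window A.phi)) e
    rw [Nat.succ_mul, ← add_assoc, pow_succ']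
    exact h.trans (by gcongr)

variable {F : Finset S.graph.edgeSet}

/-- If only the edges in `F` can ever be undecided, then it becomes exponentially unlikely that
there is an undecided edge: the first half of the time serves to get rid of the potential. -/
theorem measure_undecidedAt_le (hG : Progressive A P Δ b ν β κ S.graph)
    (hF : ∀ᵐ w ∂(edgeAlgorithm A P Δ b).coins V, ∀ n, ∀ e ∉ F, (runExec hS w).cfg n e ≠ none)
    {T : ℕ} (hT : strongTime A.phi ν ≤ T) (m : ℕ) :
    (edgeAlgorithm A P Δ b).coins V (undecidedAt hS (T + m * (2 * window A.phi))) ≤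
      ENNReal.ofReal (1 - lossRate A.phi β) ^ m *
        (κ.sigma 0 0 * (F.card : ℝ≥0∞) ^ 2 + F.card) := by
  have hE : expectedPotential hS κ T ≤ κ.sigma 0 0 * (F.card : ℝ≥0∞) ^ 2 := by
    calc expectedPotential hS κ T ≤ ∫⁻ _, κ.sigma 0 0 * (F.card : ℝ≥0∞) ^ 2
          ∂(edgeAlgorithm A P Δ b).coins V := by
          refine lintegral_mono_ae ?_
          filter_upwards [hF] with w hw
          exact κ.potential_le F (hw T)
      _ = _ := by simp
  have hEfin : expectedPotential hS κ T ≠ ⊤ := by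
    refine ne_top_of_le_ne_top ?_ hE
    exact ENNReal.mul_ne_top (ENNReal.natCast_ne_top _)
      (ENNReal.pow_ne_top (ENNReal.natCast_ne_top _))
  -- The potential is likely to vanish by time `T'`, and then the remaining edges decide.
  set T' := T + m * window A.phi with hT'
  have e1 : T + m * (2 * window A.phi) = T' + m * window A.phi := by rw [hT']; ring
  rw [e1]
  have hpot : (edgeAlgorithm A P Δ b).coins V {w |
      1 ≤ κ.potential S.graph.lineGraph ((runExec hS w).cfg T')} ≤
      ENNReal.ofReal (1 - lossRate A.phi β) ^ m * (κ.sigma 0 0 * (F.card : ℝ≥0∞) ^ 2) := by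
    have h1 := mul_meas_ge_le_lintegral (μ := (edgeAlgorithm A P Δ b).coins V)
      (measurable_potential_cfg hS hG T') 1
    rw [one_mul] at h1
    refine h1.trans ((expectedPotential_windows hS hG hT hEfin m).trans ?_)
    gcongr
  have hedge : (edgeAlgorithm A P Δ b).coins V (⋃ e ∈ F, {w |
        κ.potential S.graph.lineGraph ((runExec hS w).cfg T') = 0 ∧
        (runExec hS w).cfg (T' + m * window A.phi) e = none}) ≤
      ENNReal.ofReal (1 - lossRate A.phi β) ^ m * F.card := by
    refine (measure_biUnion_finset_le _ _).trans ?_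
    refine (Finset.sum_le_sum fun e _ => measure_undecided_windows hS hG
      (T := T') (by omega) e m).trans ?_
    rw [Finset.sum_const, nsmul_eq_mul, mul_comm]
  rw [mul_add]
  refine le_trans ?_ (add_le_add hpot hedge)
  refine le_trans (measure_mono_ae ?_) (measure_union_le _ _)
  filter_upwards [hF] with w hw
  rintro ⟨e, he⟩
  by_cases h0 : κ.potential S.graph.lineGraph ((runExec hS w).cfg T') = 0
  · refine Or.inr ?_
    simp only [Set.mem_iUnion]
    exact ⟨e, by_contra fun h => hw _ e h he, h0, he⟩
  · exact Or.inl (κ.one_le_potential h0)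

/-- A geometrically decreasing sequence of probabilities, capped by `1`, has a sum of the order of
the logarithm of the prefactor over the rate. -/
theorem tsum_measure_undecidedAt_le (hG : Progressive A P Δ b ν β κ S.graph)
    (hF : ∀ᵐ w ∂(edgeAlgorithm A P Δ b).coins V, ∀ n, ∀ e ∉ F, (runExec hS w).cfg n e ≠ none)
    {M : ℝ} (hM : 1 ≤ M) (hFM : (κ.sigma 0 0 : ℝ) * (F.card : ℝ) ^ 2 + F.card ≤ M) :
    ∑' m : ℕ, (edgeAlgorithm A P Δ b).coins V
        (undecidedAt hS (strongTime A.phi ν + m * (2 * window A.phi))) ≤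
      ENNReal.ofReal ((Real.log M + 2) / lossRate A.phi β) := by
  refine tsum_le_of_geometric (lossRate_pos hG) (lossRate_le_one hG) hM (fun m => prob_le_one)
    fun m => ?_
  refine (measure_undecidedAt_le hS hG hF le_rfl m).trans ?_
  gcongr
  rw [← ENNReal.ofReal_natCast, ← ENNReal.ofReal_natCast, ← ENNReal.ofReal_pow (by positivity),
    ← ENNReal.ofReal_mul (by positivity), ← ENNReal.ofReal_add (by positivity) (by positivity)]
  exact ENNReal.ofReal_le_ofReal hFM

/-- If only the edges in `F` can ever be undecided, then the expected stabilization time is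
logarithmic in their number. -/
theorem lintegral_stabilizationTime_le (hG : Progressive A P Δ b ν β κ S.graph)
    (hF : ∀ᵐ w ∂(edgeAlgorithm A P Δ b).coins V, ∀ n, ∀ e ∉ F, (runExec hS w).cfg n e ≠ none)
    {M : ℝ} (hM : 1 ≤ M) (hFM : (κ.sigma 0 0 : ℝ) * (F.card : ℝ) ^ 2 + F.card ≤ M) :
    ∫⁻ w, S.stabilizationTime P w ∂(edgeAlgorithm A P Δ b).coins V ≤
      ENNReal.ofReal (strongTime A.phi ν +
        2 * window A.phi * ((Real.log M + 2) / lossRate A.phi β)) := by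
  have h0 := A.two_le_phi
  have hwin : 0 < 2 * window A.phi := by unfold window; omega
  have hnn : 0 ≤ (Real.log M + 2) / lossRate A.phi β :=
    div_nonneg (by linarith [Real.log_nonneg hM]) (lossRate_pos hG).le
  calc ∫⁻ w, S.stabilizationTime P w ∂(edgeAlgorithm A P Δ b).coins V
      ≤ ∫⁻ w, ((strongTime A.phi ν : ℝ≥0∞) + (2 * window A.phi : ℕ) * ∑' m : ℕ,
          (undecidedAt hS (strongTime A.phi ν + m * (2 * window A.phi))).indicator 1 w)
          ∂(edgeAlgorithm A P Δ b).coins V :=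
        lintegral_mono_ae (stabilizationTime_le hS hG _ hwin)
    _ = (strongTime A.phi ν : ℝ≥0∞) + (2 * window A.phi : ℕ) * ∑' m : ℕ,
          (edgeAlgorithm A P Δ b).coins V
            (undecidedAt hS (strongTime A.phi ν + m * (2 * window A.phi))) := by
        have hm : ∀ n, Measurable ((undecidedAt hS n).indicator (1 : (ℕ × V → ℕ) → ℝ≥0∞)) :=
          fun n => measurable_one.indicator (measurableSet_undecidedAt hS n)
        rw [lintegral_add_left measurable_const,
          lintegral_const_mul _ (Measurable.tsum fun m => hm _),
          lintegral_tsum fun m => (hm _).aemeasurable]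
        simp only [lintegral_indicator_one (measurableSet_undecidedAt hS _)]
        simp
    _ ≤ (strongTime A.phi ν : ℝ≥0∞) + (2 * window A.phi : ℕ) *
          ENNReal.ofReal ((Real.log M + 2) / lossRate A.phi β) := by
        gcongr
        exact tsum_measure_undecidedAt_le hS hG hF hM hFM
    _ = _ := by
        rw [ENNReal.ofReal_add (by positivity) (by positivity), ENNReal.ofReal_natCast,
          ENNReal.ofReal_mul (by positivity), ← ENNReal.ofReal_natCast (2 * window A.phi)]
        push_cast
        rfl

theorem ae_exists_stableFrom (hG : Progressive A P Δ b ν β κ S.graph)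
    (hF : ∀ᵐ w ∂(edgeAlgorithm A P Δ b).coins V, ∀ n, ∀ e ∉ F, (runExec hS w).cfg n e ≠ none) :
    ∀ᵐ w ∂(edgeAlgorithm A P Δ b).coins V, ∃ n, S.StableFrom P w n := by
  have h := ae_eventually_notMem (ne_top_of_le_ne_top ENNReal.ofReal_ne_top
    (tsum_measure_undecidedAt_le hS hG hF (le_max_right _ 1) (le_max_left _ 1)))
  filter_upwards [h, ae_progressive_admissible hG] with w hw hadm
  obtain ⟨m, hm⟩ := hw.exists
  exact ⟨_, stableFrom_of_decided hS hG hadm (Nat.le_add_right _ _) (not_exists.1 hm)⟩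

end Stabilization

/-! ### The edges in the vicinity of a set of nodes -/

section Vicinity

variable {V : Type} {G : SimpleGraph V} {Δ : ℕ}

theorem card_neighbors_le (hG : DegreeBounded Δ G) (u : V) :
    (hG.finite_neighborSet u).toFinset.card ≤ Δ := by
  have h := hG.2 u
  rw [(hG.finite_neighborSet u).encard_eq_coe_toFinset_card] at h
  exact_mod_cast h

/-- There are at most `(Δ + 1) ^ r` nodes within distance `r` of a node. -/
theorem exists_ball (hG : DegreeBounded Δ G) (M : Finset V) (r : ℕ) :
    ∃ B : Finset V, (∀ u, ∀ m ∈ M, G.edist u m ≤ r → u ∈ B) ∧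
      B.card ≤ M.card * (Δ + 1) ^ r := by
  classical
  induction r with
  | zero =>
    refine ⟨M, fun u m hm h => ?_, by simp⟩
    have : u = m := by simpa using h
    exact this ▸ hm
  | succ r ih =>
    obtain ⟨B, hB, hc⟩ := ih
    refine ⟨B.biUnion fun v => insert v (hG.finite_neighborSet v).toFinset, fun u m hm h => ?_, ?_⟩
    · obtain ⟨p, hp⟩ := SimpleGraph.exists_walk_of_edist_ne_top
        (ne_top_of_le_ne_top (ENat.natCast_ne_top (r + 1)) h)
      rw [← hp] at h
      have hl : p.length ≤ r + 1 := by exact_mod_cast h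
      rw [Finset.mem_biUnion]
      cases p with
      | nil => exact ⟨u, hB u u hm (by simp), Finset.mem_insert_self _ _⟩
      | @cons _ v _ hadj p =>
        rw [SimpleGraph.Walk.length_cons] at hl
        refine ⟨v, hB v m hm ?_, Finset.mem_insert_of_mem (by simpa using hadj.symm)⟩
        exact (SimpleGraph.Walk.edist_le p).trans (by exact_mod_cast (by omega : p.length ≤ r))
    · refine (Finset.card_biUnion_le_card_mul _ _ (Δ + 1) fun v _ => ?_).trans ?_
      · exact (Finset.card_insert_le _ _).trans (Nat.succ_le_succ (card_neighbors_le hG v))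
      · rw [pow_succ, ← mul_assoc]
        exact Nat.mul_le_mul_right _ hc

/-- The edges that manipulations of `M` can affect. Their number is exponential in `R`, and its
logarithm is the source of a factor `R` in the run time. -/
theorem exists_near_edges (hG : DegreeBounded Δ G) (M : Finset V) (R : ℕ) :
    ∃ F : Finset G.edgeSet, (∀ e ∉ F, ∀ u ∈ (e : Sym2 V), ∀ m ∈ M, (R : ℕ∞) ≤ G.edist u m) ∧
      F.card ≤ M.card * (Δ + 1) ^ (R + 1) := by
  classical
  obtain ⟨B, hB, hc⟩ := exists_ball hG M R
  refine ⟨B.biUnion fun u => (hG.finite_neighborSet u).toFinset.attach.image fun v =>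
    lineNode u v.1 ((hG.finite_neighborSet u).mem_toFinset.1 v.2), fun e he u hu m hm => ?_, ?_⟩
  · by_contra hlt
    push Not at hlt
    refine he (Finset.mem_biUnion.2 ⟨u, hB u m hm hlt.le, ?_⟩)
    obtain ⟨e, hadj⟩ := e
    obtain ⟨v, rfl⟩ := hu
    exact Finset.mem_image.2 ⟨⟨v, by simpa using hadj⟩, Finset.mem_attach _ _, rfl⟩
  · refine (Finset.card_biUnion_le_card_mul _ _ Δ fun u _ => ?_).trans ?_
    · refine Finset.card_image_le.trans ?_
      rw [Finset.card_attach]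
      exact card_neighbors_le hG u
    · rw [pow_succ, ← mul_assoc]
      exact Nat.mul_le_mul hc (Nat.le_succ _)

end Vicinity

/-! ### The run time -/

theorem log_card_le {k Δ σ₀ R : ℕ} (hk : 0 < k) (hΔ : 0 < Δ) :
    Real.log ((σ₀ + 1) * (k * (Δ + 1) ^ (R + 1)) ^ 2) ≤
      (2 * R + 5) * Real.log (k + Δ + σ₀) := by
  have hk' : (1 : ℝ) ≤ k := by exact_mod_cast hk
  have hΔ' : (1 : ℝ) ≤ Δ := by exact_mod_cast hΔ
  have hσ : (0 : ℝ) ≤ σ₀ := Nat.cast_nonneg _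
  have h1 : Real.log (σ₀ + 1) ≤ Real.log (k + Δ + σ₀) :=
    Real.log_le_log (by linarith) (by linarith)
  have h2 : Real.log k ≤ Real.log (k + Δ + σ₀) := Real.log_le_log (by linarith) (by linarith)
  have h3 : Real.log (Δ + 1) ≤ Real.log (k + Δ + σ₀) :=
    Real.log_le_log (by linarith) (by linarith)
  rw [Real.log_mul (by positivity) (by positivity), Real.log_pow,
    Real.log_mul (by positivity) (by positivity), Real.log_pow]
  push_cast
  have h4 : (0 : ℝ) ≤ R + 1 := by positivity
  nlinarith [mul_le_mul_of_nonneg_left h3 h4]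

/-- The bound on the expected stabilization time, in closed form. -/
theorem run_time_le {φ ν σ₀ k Δ : ℕ} {β : ℝ} (hφ : 2 ≤ φ) (hk : 0 < k) (hΔ : 0 < Δ) (h0 : 0 < β)
    (h1 : β < 1) :
    (strongTime φ ν : ℝ) + 2 * window φ *
        ((Real.log ((σ₀ + 1) * (k * (Δ + 1) ^ (ν + 2 * φ + 1 + 1)) ^ 2) + 2) / lossRate φ β) ≤
      10 ^ 6 * (1 / β * (ν + 1) * (φ : ℝ) ^ 6 * Real.log (k + Δ + σ₀)) := by
  have hlog := log_card_le (σ₀ := σ₀) (R := ν + 2 * φ + 1) hk hΔ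
  set L := Real.log (k + Δ + σ₀) with hL
  have hk' : (1 : ℝ) ≤ k := by exact_mod_cast hk
  have hΔ' : (1 : ℝ) ≤ Δ := by exact_mod_cast hΔ
  -- `L` is bounded below, so additive constants can be absorbed.
  have hL2 : 1 / 2 ≤ L := by
    have h2 : Real.log 2 ≤ L := Real.log_le_log (by norm_num)
      (by linarith [(Nat.cast_nonneg σ₀ : (0 : ℝ) ≤ σ₀)])
    linarith [Real.log_two_gt_d9]
  have hx : (2 : ℝ) ≤ φ := by exact_mod_cast hφ
  have hν : (0 : ℝ) ≤ ν := Nat.cast_nonneg _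
  set ℓ := Real.log ((σ₀ + 1) * (k * (Δ + 1) ^ (ν + 2 * φ + 1 + 1)) ^ 2) with hℓ
  have hℓ0 : 0 ≤ ℓ := by
    refine Real.log_nonneg ?_
    have h2 : (1 : ℝ) ≤ (σ₀ : ℝ) + 1 := by linarith [(Nat.cast_nonneg σ₀ : (0 : ℝ) ≤ σ₀)]
    have h3 : (1 : ℝ) ≤ ((Δ : ℝ) + 1) ^ (ν + 2 * φ + 1 + 1) := one_le_pow₀ (by linarith)
    exact one_le_mul_of_one_le_of_one_le h2 (one_le_pow₀ (one_le_mul_of_one_le_of_one_le hk' h3))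
  have hs : (strongTime φ ν : ℝ) = 2 * φ + 1 + 3 * (ν + 1) := by
    unfold strongTime; push_cast; ring
  have hw : (window φ : ℝ) ≤ 14 * φ := by
    have : window φ ≤ 14 * φ := by unfold window; omega
    exact_mod_cast this
  have h8 : ((8 * φ - 2 : ℕ) : ℝ) ≤ 8 * φ := by
    exact_mod_cast (by omega : 8 * φ - 2 ≤ 8 * φ)
  have h8' : (0 : ℝ) < ((8 * φ - 2 : ℕ) : ℝ) := by
    exact_mod_cast (by omega : 0 < 8 * φ - 2)
  have hloss : 1 / lossRate φ β ≤ 1 / β * (1024 * (φ : ℝ) ^ 3) := by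
    have h2 : 1 / lossRate φ β = 1 / β * (2 * ((8 * φ - 2 : ℕ) : ℝ) ^ 3) := by
      rw [lossRate, syncProb_toReal]
      field_simp
    rw [h2]
    have h3 : ((8 * φ - 2 : ℕ) : ℝ) ^ 3 ≤ (8 * (φ : ℝ)) ^ 3 := pow_le_pow_left₀ h8'.le h8 3
    refine mul_le_mul_of_nonneg_left ?_ (by positivity)
    linarith [h3, (by ring : (8 * (φ : ℝ)) ^ 3 = 512 * (φ : ℝ) ^ 3)]
  have hℓ' : ℓ + 2 ≤ 10 * φ * ((ν + 1) * L) := by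
    have h2 : (ℓ + 2 : ℝ) ≤ (2 * ν + 4 * φ + 11) * L := by
      push_cast at hlog
      linarith
    have h3 : (2 * ν + 4 * φ + 11 : ℝ) ≤ 10 * φ * (ν + 1) := by nlinarith
    calc (ℓ + 2 : ℝ) ≤ (2 * ν + 4 * φ + 11) * L := h2
      _ ≤ (10 * φ * (ν + 1)) * L := by gcongr
      _ = _ := by ring
  have hβ : 1 ≤ 1 / β := by rw [le_div_iff₀ h0]; linarith
  have hX : 0 ≤ 1 / β * ((ν + 1) * L) := by positivity
  have hmain : 2 * (window φ : ℝ) * ((ℓ + 2) / lossRate φ β) ≤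
      286720 * (φ : ℝ) ^ 5 * (1 / β * ((ν + 1) * L)) := by
    have hl0 : 0 ≤ 1 / lossRate φ β := by
      rw [lossRate, syncProb_toReal]; positivity
    calc 2 * (window φ : ℝ) * ((ℓ + 2) / lossRate φ β)
        = 2 * (window φ : ℝ) * ((ℓ + 2) * (1 / lossRate φ β)) := by ring
      _ ≤ 2 * (14 * φ) * ((10 * φ * ((ν + 1) * L)) * (1 / β * (1024 * (φ : ℝ) ^ 3))) := by
          gcongr
      _ = _ := by ring
  have h5 : (φ : ℝ) ^ 5 ≤ (φ : ℝ) ^ 6 := pow_le_pow_right₀ (by linarith) (by norm_num)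
  have h6 : (φ : ℝ) ≤ (φ : ℝ) ^ 6 := le_self_pow₀ (by linarith) (by norm_num)
  have hstrong : (strongTime φ ν : ℝ) ≤ 8 * (φ : ℝ) ^ 6 * (1 / β * ((ν + 1) * L)) := by
    have h7 : (ν + 1 : ℝ) * (1 / 2) ≤ 1 / β * ((ν + 1) * L) := by
      calc (ν + 1 : ℝ) * (1 / 2) ≤ (ν + 1) * L := by gcongr
        _ ≤ 1 / β * ((ν + 1) * L) := le_mul_of_one_le_left (by positivity) hβ
    calc (strongTime φ ν : ℝ) ≤ 8 * φ * ((ν + 1) * (1 / 2)) := by rw [hs]; nlinarith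
      _ ≤ 8 * (φ : ℝ) ^ 6 * (1 / β * ((ν + 1) * L)) := by gcongr
  calc (strongTime φ ν : ℝ) + 2 * window φ * ((ℓ + 2) / lossRate φ β)
      ≤ 8 * (φ : ℝ) ^ 6 * (1 / β * ((ν + 1) * L)) +
          286720 * (φ : ℝ) ^ 6 * (1 / β * ((ν + 1) * L)) := by
        refine add_le_add hstrong (hmain.trans ?_)
        gcongr
    _ = 286728 * ((φ : ℝ) ^ 6 * (1 / β * ((ν + 1) * L))) := by ring
    _ ≤ 10 ^ 6 * ((φ : ℝ) ^ 6 * (1 / β * ((ν + 1) * L))) := by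
        gcongr
        norm_num
    _ = _ := by ring

section Main

variable {O : Type} {P : LCLProblem O} {A : PhaseAlgorithm O} {Δ b ν : ℕ} {β : ℝ}
  {κ : PotentialCoefficients O}

theorem edgeAlgorithm_selfStabilizing
    (hG : ∀ (V : Type) (G : SimpleGraph V), P.edgeProblem.family G → Progressive A P Δ b ν β κ G) :
    (edgeAlgorithm A P Δ b).SelfStabilizing P.edgeProblem := by
  intro V _ S hfin hS hfam
  have : Finite ↥S.verts := hfin
  have : Finite S.graph.edgeSet := by
    have : Finite (Sym2 ↥S.verts) := Quot.finite _
    exact Subtype.finite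
  have h : ∀ᵐ w ∂(edgeAlgorithm A P Δ b).coins V, ∃ n, S.StableFrom P w n :=
    ae_exists_stableFrom hS (hG _ _ hfam)
      (F := (Set.finite_univ (α := S.graph.edgeSet)).toFinset)
      (Filter.Eventually.of_forall fun w n e he => absurd (by simp) he)
  exact h

/-- By `influence`, only the edges near the manipulated nodes can ever be undecided after the
manipulations, which bounds the potential in terms of `k`, `Δ` and `κ.sigma 0 0`. -/
theorem edgeAlgorithm_fullyAdaptiveRunTime (hΔ : 0 < Δ)
    (hG : ∀ (V : Type) (G : SimpleGraph V), P.edgeProblem.family G → Progressive A P Δ b ν β κ G) :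
    (edgeAlgorithm A P Δ b).FullyAdaptiveRunTime P.edgeProblem fun k =>
      10 ^ 6 * (1 / β * (ν + 1) * (A.phi : ℝ) ^ 6 * Real.log (k + Δ + κ.sigma 0 0)) := by
  classical
  intro V _ S ta tb K hE hK hk
  have ht := hE.ta_lt_tb
  have hS := hE.wellFormed tb (by omega) le_rfl
  have hP := hG _ _ (hE.family tb (by omega) le_rfl)
  set M : Finset ↥(S tb).verts := (hK.preimage Subtype.val_injective.injOn).toFinset with hM
  have hMK : M.card ≤ K.ncard := by
    rw [Set.ncard_eq_toFinset_card K hK]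
    refine Finset.card_le_card_of_injOn Subtype.val (fun x hx => ?_) Subtype.val_injective.injOn
    simpa [hM] using hx
  obtain ⟨F, hF, hFc⟩ := exists_near_edges hP.bounded M (ν + 2 * A.phi + 1)
  -- Only edges in `F` can ever be undecided, so that all estimates concern finitely many edges.
  have hFae : ∀ᵐ w ∂(edgeAlgorithm A P Δ b).coins V, ∀ n, ∀ e ∉ F,
      (runExec hS w).cfg n e ≠ none := by
    filter_upwards [ae_mem_support (ι := ℕ × V) (edgeAlgorithm A P Δ b).coin] with w hw n e he
    obtain ⟨o, -, h2⟩ := influence (fun V G h => (hG V G h).bounded) hP.short hP.core hP.respectful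
      hP.influence hE hw e fun u hu m hm => hF e he u hu m (by simpa [hM] using hm)
    rw [runExec_cfg, h2 n]
    simp
  have hcard : (F.card : ℝ) ≤ K.ncard * ((Δ : ℝ) + 1) ^ (ν + 2 * A.phi + 1 + 1) := by
    have : F.card ≤ K.ncard * (Δ + 1) ^ (ν + 2 * A.phi + 1 + 1) :=
      hFc.trans (Nat.mul_le_mul_right _ hMK)
    exact_mod_cast this
  have hone : (1 : ℝ) ≤ K.ncard * ((Δ : ℝ) + 1) ^ (ν + 2 * A.phi + 1 + 1) :=
    one_le_mul_of_one_le_of_one_le (by exact_mod_cast hk)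
      (one_le_pow₀ (by linarith [(Nat.cast_nonneg Δ : (0 : ℝ) ≤ Δ)]))
  set N : ℝ := K.ncard * ((Δ : ℝ) + 1) ^ (ν + 2 * A.phi + 1 + 1) with hN
  have hσ : (0 : ℝ) ≤ κ.sigma 0 0 := Nat.cast_nonneg _
  have hN2 : (1 : ℝ) ≤ N ^ 2 := one_le_pow₀ hone
  have hbound := run_time_le (ν := ν) (σ₀ := κ.sigma 0 0) A.two_le_phi hk hΔ hP.pos hP.lt_one
  refine (lintegral_stabilizationTime_le hS hP hFae (M := (κ.sigma 0 0 + 1) * N ^ 2) ?_ ?_).trans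
    (ENNReal.ofReal_le_ofReal hbound)
  · exact one_le_mul_of_one_le_of_one_le (by linarith) hN2
  · have h3 : (F.card : ℝ) ^ 2 ≤ N ^ 2 := pow_le_pow_left₀ (Nat.cast_nonneg _) hcard 2
    have h4 : (F.card : ℝ) ≤ N ^ 2 := hcard.trans (le_self_pow₀ hone (by norm_num))
    nlinarith [mul_le_mul_of_nonneg_left h3 hσ]

end Main

theorem mainTheorem3 :
    ∃ c : ℝ, 0 < c ∧
      ∀ (O : Type) (P : LCLProblem O) (A : PhaseAlgorithm O) (Δ ν σ₀ : ℕ) (β : ℝ) (μ μA : ℕ → ℕ),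
        0 < Δ → (∀ n, 0 < μ n) →
        (∀ (V : Type) (G : SimpleGraph V), P.edgeProblem.family G → DegreeBounded Δ G) →
        A.MessagesAtMost (2 * Δ - 2) (μA (2 * Δ - 2)) →
        A.Eligible P (2 * Δ - 2) ν μ β σ₀ →
        ∃ B : EdgeAlgorithm O,
          B.SelfStabilizing P.edgeProblem ∧
          B.MessagesAtMost Δ
            (c * (Δ * ((μ (2 * Δ - 2) : ℝ) + μA (2 * Δ - 2)) + Real.log A.phi)) ∧
          B.FullyAdaptiveRunTime P.edgeProblem
            (fun k => c * ((1 / β) * (ν + 1) * (A.phi : ℝ) ^ 6 * Real.log (k + Δ + σ₀))) ∧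
          B.InfluenceRadius P.edgeProblem (ν + 2 * A.phi + 1) := by
  -- The constant is determined by the run time (`run_time_le`).
  refine ⟨10 ^ 6, by norm_num, fun O P A Δ ν σ₀ β μ μA hΔ hμ hfam hA hel => ?_⟩
  obtain ⟨h0, h1, κ, hκ, hprog⟩ := hel.progress
  have hG : ∀ (V : Type) (G : SimpleGraph V), P.edgeProblem.family G →
      Progressive A P Δ (μA (2 * Δ - 2)) ν β κ G := fun V G h =>
    ⟨hel.core, hel.respectful, hA, hfam V G h, ⟨h.2, (hfam V G h).lineGraph⟩, hel.hereditary,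
      hel.influence, h0, h1, hprog⟩
  refine ⟨edgeAlgorithm A P Δ (μA (2 * Δ - 2)), edgeAlgorithm_selfStabilizing hG, ?_, ?_,
    edgeAlgorithm_influenceRadius hfam hA hel.core hel.respectful hel.influence⟩
  · intro d hd s out inb r hr i m hm
    -- `μ ≥ 1` absorbs the bits for degrees, ports, roles and stages, of which there are `O(Δ)`.
    refine (edgeAlgorithm_messagesAtMost A P Δ _ hΔ hA.1 d hd s out inb r hr i m hm).trans ?_
    have h2 : (1 : ℝ) ≤ μ (2 * Δ - 2) := by exact_mod_cast hμ _
    have h3 : 0 ≤ Real.log A.phi := Real.log_natCast_nonneg _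
    have h4 : (0 : ℝ) ≤ Δ := Nat.cast_nonneg _
    have h5 : (0 : ℝ) ≤ μA (2 * Δ - 2) := Nat.cast_nonneg _
    push_cast
    have h6 : (Δ : ℝ) * (1 + μA (2 * Δ - 2)) ≤ Δ * (μ (2 * Δ - 2) + μA (2 * Δ - 2)) := by gcongr
    have h7 : (0 : ℝ) ≤ Δ * (1 + μA (2 * Δ - 2)) := by positivity
    linarith
  · rw [← hκ]
    exact edgeAlgorithm_fullyAdaptiveRunTime hΔ hG
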